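/- Let $p>1$ and $T>0$. For $a,b\ge 0$ put $H_{a,b}(s)=a\,s^{+}+b\,s^{-}$, where $s^{\pm}=\max\{\pm s,0\}$. For a non-negative, convex, positively $1$-homogeneous function $H:\mathbb R\to\mathbb R$ (an asymmetric anisotropy) put $$\lambda_p^{H}(-T,T)=\inf\Big\{\int_{-T}^{T}H(u')^{p}\,dt:\ u\in W^{1,p}_0(-T,T),\ \|u\|_{L^p(-T,T)}=1\Big\},$$ $\lambda_p^{a,b}=\lambda_p^{H_{a,b}}$ and $\lambda_{1,p}=\lambda_p^{|\cdot|}$. Say that $\lambda_p^{H}(-T,T)$ is a fundamental frequency of $-\Delta_p^{H}u=-\big(H^{p-1}(u')H'(u')\big)'$ if there is a non-zero $u\in W_0^{1,p}(-T,T)$ such that $H'(u')$ is well defined a.e. and Lebesgue measurable, and $$\int_{-T}^{T}H^{p-1}(u')H'(u')\psi'\,dt=\lambda_p^{H}(-T,T)\int_{-T}^{T}|u|^{p-2}u\,\psi\,dt\qquad\text{for all }\psi\in W^{1,p}_0(-T,T).$$ Let $\mathcal E(-T,T)$ be the set of operators $-\Delta_p^{H}$ with $H\neq 0$ an asymmetric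 anisotropy for which $\lambda_p^{H}(-T,T)$ is a fundamental frequency. Let $W^{1,p,+}_{pw}(-T,T)$ be the set of functions $u$ on $(-T,T)$ for which there is a finite partition $-T=T_0<T_1<\dots<T_m=T$ such that $u\in W^{1,p}(T_{i-1},T_i)$ for $i=1,\dots,m$, $u(-T)\le 0\le u(T)$, and $u(T_i^-)>u(T_i^+)$ for $0<i<m$. Let $X_b=W_0^{1,p}(-T,T)$ if $b>0$ and $X_0=W^{1,p,+}_{pw}(-T,T)$. Functions are identified when they agree a.e. in $(-T,T)$. There is a principal eigenfunction $\varphi_p\in W_0^{1,p}(-T,T)$ of the $p$-Laplace operator, that is, a function that is positive a.e., has $\|\varphi_p\|_p=1$, and is a weak solution of $-(|\varphi_p'|^{p-2}\varphi_p')'=\lambda_{1,p}(-T,T)\,|\varphi_p|^{p-2}\varphi_p$ in $(-T,T)$. For all $a>0$ and $b\ge 0$ the following hold. (i) $\displaystyle \lambda_p^{a,b}(-T,T)=\Big(\frac{a+b}{2}\Big)^{p}\lambda_{1,p}(-T,T)$. (ii) The inequality $$\int_{-T}^{T}a^p\big((u')^{+}\big)^p+b^p\big((u')^{-}\big)^p\,dt\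 \ge\ \lambda_p^{a,b}(-T,T)\int_{-T}^{T}|u|^p\,dt$$ holds for every $u\in X_b$ (with $u'$ the piecewise weak derivative if $b=0$). A function $u$ is an extremizer (a non-zero element of $X_b$ for which equality holds) if and only if $u=u_p$ or $u=v_p$ for some constant $c>0$, where, with $t_0=\frac{a-b}{a+b}\,T$, $$u_p(t)=\begin{cases}c\,\varphi_p\Big(\dfrac{T(t-t_0)}{T+t_0}\Big), & t\in(-T,t_0),\\[2mm] c\,\varphi_p\Big(\dfrac{T(t-t_0)}{T-t_0}\Big), & t\in[t_0,T),\end{cases}\qquad v_p(t)=\begin{cases}-c\,\varphi_p\Big(\dfrac{T(t+t_0)}{T-t_0}\Big), & t\in(-T,-t_0),\\[2mm] -c\,\varphi_p\Big(\dfrac{T(t+t_0)}{T+t_0}\Big), & t\in[-t_0,T).\end{cases}$$ This holds for every choice of the principal eigenfunction $\varphi_p$. (iii) $\lambda_p^{a,b}(-T,T)$ is a fundamental frequency if and only if $b>0$. Moreover, $\mathcal E(-T,T)=\{-\Delta_p^{H_{a,b}}:\ a,b>0\}$. -/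

import Mathlib

open MeasureTheory Set Filter Topology
open scoped ContDiff

namespace AsymPoincare

noncomputable section

/-- Lebesgue measure on the interval `(s, t)`. -/
abbrev volOn (s t : ℝ) : Measure ℝ := volume.restrict (Ioo s t)

/-- Compactly supported smooth functions in the open interval `(s, t)`. -/
structure IsTest (s t : ℝ) (η : ℝ → ℝ) : Prop where
  smooth : ContDiff ℝ ∞ η
  compact : HasCompactSupport η
  support : tsupport η ⊆ Ioo s t

/-- An element of `W₀^{1,p}(-T,T)`, carried together with its weak derivative: an `L^p` function
`toFun` and an `L^p` function `der` such that `(toFun, der)` is the limit in `L^p × L^p` of pairs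
`(η, η')` with `η` smooth and compactly supported in `(-T,T)`. Only the classes of `toFun` and `der`
modulo equality almost everywhere in `(-T,T)` matter below. -/
structure W0 (p T : ℝ) where
  toFun : ℝ → ℝ
  der : ℝ → ℝ
  memLp_toFun : MemLp toFun (ENNReal.ofReal p) (volOn (-T) T)
  memLp_der : MemLp der (ENNReal.ofReal p) (volOn (-T) T)
  approx : ∃ η : ℕ → ℝ → ℝ, (∀ n, IsTest (-T) T (η n)) ∧
    Tendsto (fun n => eLpNorm (fun t => η n t - toFun t) (ENNReal.ofReal p) (volOn (-T) T))
      atTop (𝓝 0) ∧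
    Tendsto (fun n => eLpNorm (fun t => deriv (η n) t - der t) (ENNReal.ofReal p) (volOn (-T) T))
      atTop (𝓝 0)

instance (p T : ℝ) : CoeFun (W0 p T) (fun _ => ℝ → ℝ) := ⟨W0.toFun⟩

/-- Asymmetric anisotropies in dimension one: non-negative, convex and positively
`1`-homogeneous functions. -/
def Anisotropies : Set (ℝ → ℝ) :=
  {H | (∀ x, 0 ≤ H x) ∧ ConvexOn ℝ univ H ∧ ∀ t : ℝ, 0 < t → ∀ x, H (t * x) = t * H x}

/-- `H_{a,b}(s) = a s⁺ + b s⁻`. -/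
def Hab (a b : ℝ) : ℝ → ℝ := fun s => a * max s 0 + b * max (-s) 0

/-- The norm `‖u‖_p` of `L^p(-T,T)`. -/
def pNorm (p T : ℝ) (u : ℝ → ℝ) : ℝ := (∫ t in Ioo (-T) T, |u t| ^ p) ^ (1 / p)

/-- The anisotropic `L^p` energy of a function with weak derivative `g`. -/
def energy (p T : ℝ) (H : ℝ → ℝ) (g : ℝ → ℝ) : ℝ := ∫ t in Ioo (-T) T, H (g t) ^ p

/-- The least energy level `λ_p^H(-T,T)` on the unit sphere of `L^p(-T,T)`. -/
def level (p T : ℝ) (H : ℝ → ℝ) : ℝ :=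
  sInf {E | ∃ u : W0 p T, pNorm p T u = 1 ∧ E = energy p T H u.der}

/-- `λ_{1,p}(-T,T)`, the first Dirichlet eigenvalue of the `p`-Laplace operator. -/
def lambda1 (p T : ℝ) : ℝ := level p T (fun s => |s|)

/-- `φ` is the principal eigenfunction of the Dirichlet `p`-Laplace operator on `(-T,T)`, positive
and normalized in `L^p`; the equation is understood in the weak sense. -/
structure IsPrincipalEigenfunction (p T : ℝ) (φ : W0 p T) : Prop where
  norm_eq : pNorm p T φ = 1
  pos : ∀ᵐ t ∂(volOn (-T) T), 0 < φ t
  eqn : ∀ ψ : W0 p T,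
    ∫ t in Ioo (-T) T, |φ.der t| ^ (p - 2) * φ.der t * ψ.der t =
      lambda1 p T * ∫ t in Ioo (-T) T, |φ t| ^ (p - 2) * φ t * ψ t

/-- The operator `-Δ_p^H u = -(H^{p-1}(u') H'(u'))'`, acting from `W₀^{1,p}(-T,T)` to functionals
on `W₀^{1,p}(-T,T)`. -/
def negLaplacian (p T : ℝ) (H : ℝ → ℝ) : W0 p T → W0 p T → ℝ :=
  fun u ψ => ∫ t in Ioo (-T) T, H (u.der t) ^ (p - 1) * deriv H (u.der t) * ψ.der t

/-- `λ_p^H(-T,T)` is a fundamental frequency of `-Δ_p^H`: there is a non-zero `u ∈ W₀^{1,p}(-T,T)`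
such that `H'(u')` is well defined almost everywhere, is Lebesgue measurable, and `u` is a weak
solution of `-Δ_p^H u = λ_p^H |u|^{p-2} u`. -/
def IsFundamentalFrequency (p T : ℝ) (H : ℝ → ℝ) : Prop :=
  ∃ u : W0 p T, (¬ ∀ᵐ t ∂(volOn (-T) T), u t = 0) ∧
    (∀ᵐ t ∂(volOn (-T) T), DifferentiableAt ℝ H (u.der t)) ∧
    AEMeasurable (fun t => deriv H (u.der t)) (volOn (-T) T) ∧
    ∀ ψ : W0 p T, negLaplacian p T H u ψ =
      level p T H * ∫ t in Ioo (-T) T, |u t| ^ (p - 2) * u t * ψ t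

/-- The set `𝓔(-T,T)` of the operators `-Δ_p^H` with `H` a non-zero asymmetric anisotropy whose
level is a fundamental frequency. -/
def ellipticClass (p T : ℝ) : Set (W0 p T → W0 p T → ℝ) :=
  {L | ∃ H ∈ Anisotropies, H ≠ 0 ∧ IsFundamentalFrequency p T H ∧ L = negLaplacian p T H}

/-- `u ∈ W^{1,p}(s,t)` with weak derivative `g`. -/
structure IsSobolevOn (p s t : ℝ) (u g : ℝ → ℝ) : Prop where
  memLp_fun : MemLp u (ENNReal.ofReal p) (volOn s t)
  memLp_der : MemLp g (ENNReal.ofReal p) (volOn s t)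
  weak : ∀ η : ℝ → ℝ, IsTest s t η →
    ∫ x in Ioo s t, u x * deriv η x = - ∫ x in Ioo s t, g x * η x

/-- The piecewise Sobolev space `W_pw^{1,p,+}(-T,T)`; `g` is the (piecewise) weak derivative of `u`.
There is a partition `-T = τ 0 < ⋯ < τ (m+1) = T` such that `u` is in `W^{1,p}` of each of the
`m + 1` open pieces, `u(-T) ≤ 0 ≤ u(T)`, and `u` jumps downwards at each interior partition point.
Here `w i` is the representative of `u` on the `i`-th piece that is continuous up to the end points,
so that its end point values are the one-sided limits of `u`. -/
def IsPwSobolevPlus (p T : ℝ) (u g : ℝ → ℝ) : Prop :=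
  ∃ (m : ℕ) (τ : ℕ → ℝ) (w : ℕ → ℝ → ℝ),
    τ 0 = -T ∧ τ (m + 1) = T ∧ (∀ i ≤ m, τ i < τ (i + 1)) ∧
    (∀ i ≤ m, IsSobolevOn p (τ i) (τ (i + 1)) u g) ∧
    (∀ i ≤ m, ContinuousOn (w i) (Icc (τ i) (τ (i + 1))) ∧
      ∀ᵐ t ∂(volOn (τ i) (τ (i + 1))), u t = w i t) ∧
    w 0 (-T) ≤ 0 ∧ 0 ≤ w m T ∧
    ∀ i < m, w (i + 1) (τ (i + 1)) < w i (τ (i + 1))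

/-- The class in which the asymmetric Poincaré inequality and its extremizers are considered:
`W₀^{1,p}(-T,T)` if `b > 0`, and `W_pw^{1,p,+}(-T,T)` if `b = 0`. Here `g` is the weak
derivative of `u`. -/
def IsAdmissible (p T b : ℝ) (u g : ℝ → ℝ) : Prop :=
  (0 < b ∧ ∃ w : W0 p T, w.toFun = u ∧ w.der = g) ∨ (b = 0 ∧ IsPwSobolevPlus p T u g)

/-- `u` is an extremizer of the asymmetric Poincaré inequality: a non-zero admissible function for
which equality holds. -/
def IsExtremizer (p T a b : ℝ) (u : ℝ → ℝ) : Prop :=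
  ∃ g : ℝ → ℝ, IsAdmissible p T b u g ∧ (¬ ∀ᵐ t ∂(volOn (-T) T), u t = 0) ∧
    energy p T (Hab a b) g = level p T (Hab a b) * ∫ t in Ioo (-T) T, |u t| ^ p

/-- The junction point `t₀ = ((a-b)/(a+b)) T`. -/
def junction (T a b : ℝ) : ℝ := (a - b) / (a + b) * T

/-- The function `u_p` built from `φ` with the constant `c` and junction point `t₀`. -/
def uGlued (T t₀ c : ℝ) (φ : ℝ → ℝ) : ℝ → ℝ := fun t =>
  if t < t₀ then c * φ (T * (t - t₀) / (T + t₀)) else c * φ (T * (t - t₀) / (T - t₀))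

/-- The function `v_p` built from `φ` with the constant `c` and the parameter `t₀`. -/
def vGlued (T t₀ c : ℝ) (φ : ℝ → ℝ) : ℝ → ℝ := fun t =>
  if t < -t₀ then -c * φ (T * (t + t₀) / (T - t₀)) else -c * φ (T * (t + t₀) / (T + t₀))

end

end AsymPoincare

open AsymPoincare

/-! The sharp inequality comes from a calibration. Let S = `gsin p` be the generalized sine: S' = (1
- |S|^p)^{1/p}, S(0) = 0, and S reaches 1 at the quarter period q = `quarter p`. Put P(v) = (1 -
|v|^p)^{(p-1)/p} with primitive `calib p`, and k = `freq p T a b` = (a+b)q/(2T). Suppose max |u| = 1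
and u(σ) = 1. Young's inequality s^p + (p-1)y^p ≥ p y^{p-1} s, with s = H(u') and y = k(1 -
|u|^p)^{1/p}, bounds ∫H(u')^p + (p-1)k^p ∫(1 - |u|^p) from below by p k^{p-1} ∫P(u)H(u'). Since
H(u') ≥ a u' before σ and H(u') ≥ -b u' after σ, the last integral is at least (a+b) `calib p 1`: u
climbs from u(-T) ≤ 0 to 1 and, if b > 0, descends back to 0. As `calib p 1` = (p-1)q/p, the choice
of k makes the constants cancel, leaving (p-1)k^p ∫|u|^p ≤ ∫H(u')^p. Scaling and the reflection u ↦
-u(-·) reduce the general case to this one. If b = 0 nothing is asked of u after σ, and a downward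
jump before σ only increases the climb that u' has to supply; this is why piecewise functions are
allowed. See `calibration`, `IsPwPrimitive.calib_sub_le` and `IsPwPrimitive.poincare`.

In the equality case every deficit vanishes. Then there is no jump before σ, u(-T) = 0, and u' =
(k/a)(1 - |u|^p)^{1/p} before σ, so u = S(k(t+T)/a) there (`eq_gsin_of_calibrated`). Reaching 1
takes time aq/k = T + t₀, so σ ≥ t₀; if b > 0 the same argument run backwards from T gives σ ≤ t₀,
and if b = 0 then t₀ = T already. Hence u is `profile p T t₀`, up to scaling and reflection.

The level equals (p-1)k^p (`level_Hab`); for b = 0 it is approached through parameters b' decreasing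
to 0. Part (i) follows because k is linear in a + b. Testing the p-Laplace equation with φ itself
gives equality for a = b = 1, so every principal eigenfunction is a multiple of the symmetric
profile, and `uGlued`, `vGlued` are rescalings of it. For b > 0 the profile solves the
Euler–Lagrange equation (`negLaplacian_profile`). For b = 0 a solution in W₀^{1,p} would be
extremal, hence a multiple of a profile equal to 1 at an end point, which contradicts the zero
trace. One-dimensional anisotropies are exactly the `Hab a b`, which yields the description of the
class of operators. -/

namespace AsymPoincare

noncomputable section

section

/-! ### The generalized sine function -/

/-- The function `(1 - |v|^p)^{1/p}` on `[-1, 1]`, extended by zero. -/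
def slope (p v : ℝ) : ℝ := (max (1 - |v| ^ p) 0) ^ (1 / p)

section slope

variable {p : ℝ}

lemma slope_nonneg (p v : ℝ) : 0 ≤ slope p v := by unfold slope; positivity

lemma slope_neg (p v : ℝ) : slope p (-v) = slope p v := by simp [slope]

lemma continuous_slope (hp : 1 < p) : Continuous (slope p) := by
  unfold slope
  refine Continuous.rpow_const ?_ fun _ => Or.inr (by positivity)
  exact (continuous_const.sub (continuous_abs.rpow_const fun _ => Or.inr (by linarith))).max
    continuous_const

lemma slope_le_one (hp : 1 < p) (v : ℝ) : slope p v ≤ 1 := by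
  unfold slope
  refine Real.rpow_le_one (le_max_right _ _) (max_le ?_ zero_le_one) (by positivity)
  have : 0 ≤ |v| ^ p := by positivity
  linarith

lemma slope_rpow (hp : 1 < p) {v : ℝ} (hv : |v| ≤ 1) : slope p v ^ p = 1 - |v| ^ p := by
  have h : |v| ^ p ≤ 1 := Real.rpow_le_one (abs_nonneg v) hv (by linarith)
  unfold slope
  rw [max_eq_left (by linarith), ← Real.rpow_mul (by linarith), one_div_mul_cancel (by linarith),
    Real.rpow_one]

lemma slope_of_one_le (hp : 1 < p) {v : ℝ} (hv : 1 ≤ |v|) : slope p v = 0 := by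
  have h : 1 ≤ |v| ^ p := Real.one_le_rpow hv (by linarith)
  unfold slope
  rw [max_eq_right (by linarith), Real.zero_rpow (by positivity)]

lemma slope_pos (hp : 1 < p) {v : ℝ} (hv : |v| < 1) : 0 < slope p v := by
  have h : |v| ^ p < 1 := Real.rpow_lt_one (abs_nonneg v) hv (by linarith)
  unfold slope
  rw [max_eq_left (by linarith)]
  exact Real.rpow_pos_of_pos (by linarith) _

/-- The integrand of the arc function: `1 / slope` on `(-1, 1)`, extended by `1`. -/
def arcDensity (p v : ℝ) : ℝ := if |v| < 1 then (slope p v)⁻¹ else 1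

lemma arcDensity_neg (p v : ℝ) : arcDensity p (-v) = arcDensity p v := by
  simp [arcDensity, slope_neg]

lemma one_le_arcDensity (hp : 1 < p) (v : ℝ) : 1 ≤ arcDensity p v := by
  unfold arcDensity
  split_ifs with h
  · exact (one_le_inv₀ (slope_pos hp h)).mpr (slope_le_one hp v)
  · exact le_rfl

lemma measurable_arcDensity (hp : 1 < p) : Measurable (arcDensity p) :=
  Measurable.ite (measurableSet_lt measurable_norm measurable_const)
    (continuous_slope hp).measurable.inv measurable_const

/-- Since v^p ≤ v on [0,1), one has 1 - v^p ≥ 1 - v. The majorant is integrable up to 1 because 1/p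
< 1, which makes the quarter period finite. -/
lemma arcDensity_le (hp : 1 < p) {v : ℝ} (h0 : 0 ≤ v) (h1 : v < 1) :
    arcDensity p v ≤ (1 - v) ^ (-(1 / p)) := by
  have hv : |v| < 1 := by rwa [abs_of_nonneg h0]
  rw [arcDensity, if_pos hv, Real.rpow_neg (by linarith)]
  refine inv_anti₀ (Real.rpow_pos_of_pos (by linarith) _) ?_
  unfold slope
  refine Real.rpow_le_rpow (by linarith) (le_max_of_le_left ?_) (by positivity)
  rw [abs_of_nonneg h0]
  have : v ^ p ≤ v ^ (1 : ℝ) := by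
    rcases h0.eq_or_lt with rfl | h0
    · rw [Real.zero_rpow (by linarith), Real.zero_rpow one_ne_zero]
    · exact Real.rpow_le_rpow_of_exponent_ge h0 h1.le hp.le
  rw [Real.rpow_one] at this
  linarith

lemma intervalIntegrable_arcDensity (hp : 1 < p) (x y : ℝ) :
    IntervalIntegrable (arcDensity p) volume x y := by
  have hm := (measurable_arcDensity hp).aestronglyMeasurable (μ := volume)
  have h01 : IntervalIntegrable (arcDensity p) volume 0 1 := by
    have h : IntervalIntegrable (fun v : ℝ => v ^ (-(1 / p))) volume 0 1 := by
      refine intervalIntegral.intervalIntegrable_rpow' ?_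
      rw [neg_lt_neg_iff, div_lt_one (by linarith)]
      exact hp
    have h' : IntervalIntegrable (fun v : ℝ => (1 - v) ^ (-(1 / p))) volume 0 1 := by
      simpa using (h.comp_sub_left 1).symm
    refine h'.mono_fun' hm.restrict ?_
    rw [uIoc_of_le zero_le_one]
    have hne : ∀ᵐ v : ℝ ∂(volume.restrict (Ioc 0 1)), v ≠ 1 :=
      ae_restrict_of_ae (Measure.ae_ne volume 1)
    filter_upwards [hne, ae_restrict_mem measurableSet_Ioc] with v hv1 hv
    rw [Real.norm_of_nonneg (zero_le_one.trans (one_le_arcDensity hp v))]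
    exact arcDensity_le hp hv.1.le (lt_of_le_of_ne hv.2 hv1)
  have hpos : ∀ z : ℝ, 0 ≤ z → IntervalIntegrable (arcDensity p) volume 0 z := by
    intro z hz
    have h1z : IntervalIntegrable (arcDensity p) volume 1 (max 1 z) := by
      refine (intervalIntegrable_const (c := (1 : ℝ))).congr ?_
      intro v hv
      rw [uIoc_of_le (le_max_left _ _)] at hv
      have : ¬ |v| < 1 := by
        rw [not_lt]; exact hv.1.le.trans (le_abs_self v)
      simp [arcDensity, this]
    refine (h01.trans h1z).mono_set ?_
    rw [uIcc_of_le hz, uIcc_of_le (zero_le_one.trans (le_max_left _ _))]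
    exact Icc_subset_Icc le_rfl (le_max_right _ _)
  have hall : ∀ z : ℝ, IntervalIntegrable (arcDensity p) volume 0 z := by
    intro z
    rcases le_total 0 z with hz | hz
    · exact hpos z hz
    · have h := hpos (-z) (by linarith)
      rw [IntervalIntegrable.iff_comp_neg] at h
      simpa [arcDensity_neg] using h
  exact (hall x).symm.trans (hall y)

/-- The arc function `u ↦ ∫₀ᵘ (1 - |v|^p)^{-1/p} dv`, extended with slope one. -/
def arc (p u : ℝ) : ℝ := ∫ v in (0 : ℝ)..u, arcDensity p v

lemma arc_zero : arc p 0 = 0 := by simp [arc]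

lemma continuous_arc (hp : 1 < p) : Continuous (arc p) :=
  intervalIntegral.continuous_primitive (intervalIntegrable_arcDensity hp) 0

/-- The density is at least 1, also beyond [-1,1] by its extension. Hence the arc function is a
strictly increasing bijection of the whole line and its inverse is automatically continuous. -/
lemma sub_le_arc_sub (hp : 1 < p) {x y : ℝ} (hxy : x ≤ y) : y - x ≤ arc p y - arc p x := by
  have h : arc p y - arc p x = ∫ v in x..y, arcDensity p v :=
    intervalIntegral.integral_interval_sub_left (intervalIntegrable_arcDensity hp _ _)
      (intervalIntegrable_arcDensity hp _ _)
  rw [h]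
  have := intervalIntegral.integral_mono_on hxy (intervalIntegrable_const (c := (1 : ℝ)))
    (intervalIntegrable_arcDensity hp x y) fun v _ => one_le_arcDensity hp v
  simpa using this

lemma strictMono_arc (hp : 1 < p) : StrictMono (arc p) := fun x y hxy => by
  have := sub_le_arc_sub hp hxy.le
  linarith

lemma surjective_arc (hp : 1 < p) : Function.Surjective (arc p) := by
  refine (continuous_arc hp).surjective ?_ ?_
  · refine tendsto_atTop_mono' _ ?_ tendsto_id
    filter_upwards [eventually_ge_atTop 0] with x hx
    have := sub_le_arc_sub hp hx
    rw [arc_zero] at this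
    simpa using this
  · refine tendsto_atBot_mono' _ ?_ tendsto_id
    filter_upwards [eventually_le_atBot 0] with x hx
    have := sub_le_arc_sub hp hx
    rw [arc_zero] at this
    simpa using this

lemma arc_neg (u : ℝ) : arc p (-u) = -arc p u := by
  have h := intervalIntegral.integral_comp_neg (a := 0) (b := u) (arcDensity p)
  simp only [arcDensity_neg, neg_zero] at h
  rw [arc, arc, intervalIntegral.integral_symm, h]

lemma hasDerivAt_arc (hp : 1 < p) {u : ℝ} (hu : |u| < 1) :
    HasDerivAt (arc p) (slope p u)⁻¹ u := by
  have he : arcDensity p =ᶠ[𝓝 u] fun v => (slope p v)⁻¹ := by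
    filter_upwards [(continuous_abs.isOpen_preimage _ isOpen_Iio).mem_nhds
      (show u ∈ abs ⁻¹' Iio (1 : ℝ) from hu)] with v hv
    exact if_pos hv
  have hc : ContinuousAt (arcDensity p) u :=
    (((continuous_slope hp).continuousAt).inv₀ (slope_pos hp hu).ne').congr he.symm
  have h := intervalIntegral.integral_hasDerivAt_right (intervalIntegrable_arcDensity hp 0 u)
    (measurable_arcDensity hp).stronglyMeasurable.stronglyMeasurableAtFilter hc
  rwa [he.eq_of_nhds] at h

/-- The quarter period of the generalized sine function. -/
def quarter (p : ℝ) : ℝ := arc p 1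

lemma quarter_pos (hp : 1 < p) : 0 < quarter p := by
  have := strictMono_arc hp zero_lt_one
  rwa [arc_zero] at this

/-- The arc function as an order isomorphism. -/
def arcIso (hp : 1 < p) : ℝ ≃o ℝ :=
  (strictMono_arc hp).orderIsoOfSurjective _ (surjective_arc hp)

/-- The generalized sine function: inverse of `arc` on `[-quarter, quarter]`, constant outside. -/
def gsin (p x : ℝ) : ℝ := max (-1) (min 1 (Function.invFun (arc p) x))

lemma abs_gsin_le (p x : ℝ) : |gsin p x| ≤ 1 :=
  abs_le.mpr ⟨le_max_left _ _, max_le (by norm_num) (min_le_left _ _)⟩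

lemma gsin_arc (hp : 1 < p) {u : ℝ} (hu : |u| ≤ 1) : gsin p (arc p u) = u := by
  rw [gsin, Function.leftInverse_invFun (strictMono_arc hp).injective]
  rw [abs_le] at hu
  rw [min_eq_right hu.2, max_eq_right hu.1]

lemma invFun_arc_eq (hp : 1 < p) : Function.invFun (arc p) = (arcIso hp).symm := by
  funext x
  apply (strictMono_arc hp).injective
  rw [Function.invFun_eq (surjective_arc hp x)]
  exact ((arcIso hp).apply_symm_apply x).symm

lemma continuous_gsin (hp : 1 < p) : Continuous (gsin p) := by
  unfold gsin
  rw [invFun_arc_eq hp]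
  exact continuous_const.max (continuous_const.min (arcIso hp).symm.continuous)

lemma monotone_gsin (hp : 1 < p) : Monotone (gsin p) := by
  intro x y hxy
  unfold gsin
  rw [invFun_arc_eq hp]
  exact max_le_max le_rfl (min_le_min le_rfl ((arcIso hp).symm.monotone hxy))

lemma gsin_zero (hp : 1 < p) : gsin p 0 = 0 := by
  have := gsin_arc hp (u := 0) (by simp)
  rwa [arc_zero] at this

lemma gsin_quarter (hp : 1 < p) : gsin p (quarter p) = 1 := gsin_arc hp (by simp)

lemma gsin_of_quarter_le (hp : 1 < p) {x : ℝ} (hx : quarter p ≤ x) : gsin p x = 1 :=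
  le_antisymm (abs_le.mp (abs_gsin_le p x)).2 (by
    rw [← gsin_quarter hp]; exact monotone_gsin hp hx)

lemma gsin_of_le_neg_quarter (hp : 1 < p) {x : ℝ} (hx : x ≤ -quarter p) : gsin p x = -1 := by
  refine le_antisymm ?_ (abs_le.mp (abs_gsin_le p x)).1
  have h : gsin p (-quarter p) = -1 := by
    rw [quarter, ← arc_neg]; exact gsin_arc hp (by simp)
  rw [← h]; exact monotone_gsin hp hx

lemma arc_gsin (hp : 1 < p) {x : ℝ} (hx : |x| ≤ quarter p) : arc p (gsin p x) = x := by
  obtain ⟨u, rfl⟩ := surjective_arc hp x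
  rw [abs_le] at hx
  have hu : |u| ≤ 1 := by
    rw [abs_le]
    constructor
    · rw [← (strictMono_arc hp).le_iff_le, arc_neg]; exact hx.1
    · rw [← (strictMono_arc hp).le_iff_le]; exact hx.2
  rw [gsin_arc hp hu]

lemma abs_gsin_lt (hp : 1 < p) {x : ℝ} (hx : |x| < quarter p) : |gsin p x| < 1 := by
  refine lt_of_le_of_ne (abs_gsin_le p x) fun h => ?_
  have h2 := arc_gsin hp hx.le
  rcases eq_or_eq_neg_of_abs_eq h with h1 | h1
  · rw [h1] at h2
    have : |x| = quarter p := by rw [← h2]; exact abs_of_pos (quarter_pos hp)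
    linarith
  · rw [h1, arc_neg] at h2
    have : |x| = quarter p := by rw [← h2, abs_neg]; exact abs_of_pos (quarter_pos hp)
    linarith

lemma gsin_pos (hp : 1 < p) {x : ℝ} (hx : 0 < x) : 0 < gsin p x := by
  rcases le_total (quarter p) x with h | h
  · rw [gsin_of_quarter_le hp h]; exact one_pos
  · rw [← (strictMono_arc hp).lt_iff_lt, arc_zero, arc_gsin hp (by rwa [abs_of_pos hx])]
    exact hx

/-- Inside the quarter period this is the derivative of a local inverse; outside, the function is
locally constant and the slope vanishes at ±1. -/
lemma hasDerivAt_gsin_of_abs_ne (hp : 1 < p) {x : ℝ} (hx : |x| ≠ quarter p) :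
    HasDerivAt (gsin p) (slope p (gsin p x)) x := by
  rcases lt_or_gt_of_ne hx with hx | hx
  · have hs := abs_gsin_lt hp hx
    have h := HasDerivAt.of_local_left_inverse (continuous_gsin hp).continuousAt
      (hasDerivAt_arc hp hs) (inv_ne_zero (slope_pos hp hs).ne') (by
        filter_upwards [(continuous_abs.isOpen_preimage _ isOpen_Iio).mem_nhds
          (show x ∈ abs ⁻¹' Iio (quarter p) from hx)] with y hy
        exact arc_gsin hp (le_of_lt hy))
    rwa [inv_inv] at h
  · have hs : slope p (gsin p x) = 0 := by
      apply slope_of_one_le hp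
      rcases lt_abs.mp hx with h | h
      · rw [gsin_of_quarter_le hp h.le]; simp
      · rw [gsin_of_le_neg_quarter hp (by linarith)]; simp
    rw [hs]
    rcases lt_abs.mp hx with h | h
    · refine (hasDerivAt_const x (1 : ℝ)).congr_of_eventuallyEq ?_
      filter_upwards [Ioi_mem_nhds h] with y hy using gsin_of_quarter_le hp (le_of_lt hy)
    · refine (hasDerivAt_const x (-1 : ℝ)).congr_of_eventuallyEq ?_
      filter_upwards [Iio_mem_nhds (show x < -quarter p by linarith)] with y hy using
        gsin_of_le_neg_quarter hp (le_of_lt hy)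

lemma continuous_slope_gsin (hp : 1 < p) : Continuous fun x => slope p (gsin p x) :=
  (continuous_slope hp).comp (continuous_gsin hp)

lemma hasDerivAt_gsin (hp : 1 < p) (x : ℝ) : HasDerivAt (gsin p) (slope p (gsin p x)) x := by
  have hcs := continuous_slope_gsin hp
  -- The two exceptional points ±`quarter p` are removed by writing the function as the integral of
  -- a continuous one, to which the fundamental theorem of calculus applies everywhere.
  have key : ∀ y, gsin p y = ∫ z in (0 : ℝ)..y, slope p (gsin p z) := by
    intro y
    have := integral_eq_of_hasDerivAt_off_countable (gsin p) (fun z => slope p (gsin p z))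
      (a := 0) (b := y) (s := {quarter p, -quarter p}) (Set.toFinite _).countable
      (continuous_gsin hp).continuousOn (fun z hz => hasDerivAt_gsin_of_abs_ne hp (by
        intro h
        apply hz.2
        rcases eq_or_eq_neg_of_abs_eq h with h | h <;> simp [h])) (hcs.intervalIntegrable _ _)
    rw [this, gsin_zero hp, sub_zero]
  have h := (hcs.integral_hasStrictDerivAt 0 x).hasDerivAt
  rwa [← funext key] at h

/-- The derivative of the generalized cosine function `slope (gsin x) ^ (p - 1)`. -/
lemma hasDerivAt_slope_gsin_rpow (hp : 1 < p) {x : ℝ} (h0 : 0 < x) (hq : x < quarter p) :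
    HasDerivAt (fun x => slope p (gsin p x) ^ (p - 1)) (-(p - 1) * gsin p x ^ (p - 1)) x := by
  have hs0 := gsin_pos hp h0
  have hs1 : gsin p x < 1 := (abs_lt.mp (abs_gsin_lt hp (by rwa [abs_of_pos h0]))).2
  have hlt : gsin p x ^ p < 1 := Real.rpow_lt_one hs0.le hs1 (by linarith)
  have hd : HasDerivAt (fun x => (1 - gsin p x ^ p) ^ ((p - 1) / p))
      (-(slope p (gsin p x) * p * gsin p x ^ (p - 1)) * ((p - 1) / p)
        * (1 - gsin p x ^ p) ^ ((p - 1) / p - 1)) x :=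
    (((hasDerivAt_gsin hp x).rpow_const (Or.inl hs0.ne')).const_sub 1).rpow_const
      (Or.inl (by linarith))
  have he : (fun x => slope p (gsin p x) ^ (p - 1)) =ᶠ[𝓝 x]
      fun x => (1 - gsin p x ^ p) ^ ((p - 1) / p) := by
    filter_upwards [Ioi_mem_nhds h0] with y hy
    have hy0 := gsin_pos hp hy
    have hy1 := (abs_le.mp (abs_gsin_le p y)).2
    have : gsin p y ^ p ≤ 1 := Real.rpow_le_one hy0.le hy1 (by linarith)
    rw [slope, abs_of_pos hy0, max_eq_left (by linarith), ← Real.rpow_mul (by linarith)]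
    congr 1
    ring
  refine (hd.congr_of_eventuallyEq he).congr_deriv ?_
  -- The exponents 1/p and (p-1)/p - 1 = -1/p cancel.
  have hslope : slope p (gsin p x) * (1 - gsin p x ^ p) ^ ((p - 1) / p - 1) = 1 := by
    rw [slope, abs_of_pos hs0, max_eq_left (by linarith), ← Real.rpow_add (by linarith)]
    have : 1 / p + ((p - 1) / p - 1) = 0 := by field_simp; ring
    rw [this, Real.rpow_zero]
  calc _ = -(slope p (gsin p x) * (1 - gsin p x ^ p) ^ ((p - 1) / p - 1)) * (p - 1)
          * gsin p x ^ (p - 1) * (p / p) := by ring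
    _ = _ := by rw [hslope, div_self (by linarith)]; ring

lemma continuous_slope_rpow (hp : 1 < p) : Continuous fun v => slope p v ^ (p - 1) :=
  (continuous_slope hp).rpow_const fun _ => Or.inr (by linarith)

lemma continuous_slope_gsin_rpow (hp : 1 < p) :
    Continuous fun x => slope p (gsin p x) ^ (p - 1) :=
  (continuous_slope_rpow hp).comp (continuous_gsin hp)

lemma rpow_sub_one_mul_self {x : ℝ} (hp : 1 < p) (hx : 0 ≤ x) : x ^ (p - 1) * x = x ^ p := by
  rcases hx.eq_or_lt with rfl | hx
  · rw [mul_zero, Real.zero_rpow (by linarith)]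
  · rw [Real.rpow_sub_one hx.ne', div_mul_cancel₀ _ hx.ne']

/-- With C = (S')^{p-1} the generalized cosine, (S C)' = (S')^p - (p-1)S^p = 1 - p S^p. The product
S C vanishes at both ends of the quarter period. -/
lemma integral_gsin_rpow (hp : 1 < p) :
    ∫ x in (0 : ℝ)..quarter p, gsin p x ^ p = quarter p / p := by
  have hq := quarter_pos hp
  have hc : Continuous fun x => |gsin p x| ^ p :=
    (continuous_gsin hp).abs.rpow_const fun _ => Or.inr (by linarith)
  have hpc : Continuous fun x => p * |gsin p x| ^ p := continuous_const.mul hc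
  have h := integral_eq_of_hasDerivAt_off_countable
    (fun x => gsin p x * slope p (gsin p x) ^ (p - 1))
    (fun x => 1 - p * |gsin p x| ^ p) (a := 0) (b := quarter p) countable_empty
    ((continuous_gsin hp).mul (continuous_slope_gsin_rpow hp)).continuousOn (by
      intro x hx
      rw [min_eq_left hq.le, max_eq_right hq.le, sdiff_empty] at hx
      refine ((hasDerivAt_gsin hp x).mul (hasDerivAt_slope_gsin_rpow hp hx.1 hx.2)).congr_deriv ?_
      have h1 := rpow_sub_one_mul_self hp (slope_nonneg p (gsin p x))
      have h2 := rpow_sub_one_mul_self hp (gsin_pos hp hx.1).le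
      rw [slope_rpow hp (abs_gsin_le p x)] at h1
      rw [abs_of_pos (gsin_pos hp hx.1)] at h1 ⊢
      linear_combination h1 - (p - 1) * h2)
    ((continuous_const.sub hpc).intervalIntegrable _ _)
  rw [intervalIntegral.integral_sub (by simp) (hpc.intervalIntegrable _ _),
    intervalIntegral.integral_const_mul, gsin_zero hp, gsin_quarter hp,
    slope_of_one_le hp (v := 1) (by simp), Real.zero_rpow (by linarith)] at h
  have he : ∫ x in (0 : ℝ)..quarter p, |gsin p x| ^ p
      = ∫ x in (0 : ℝ)..quarter p, gsin p x ^ p := by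
    refine intervalIntegral.integral_congr fun x hx => ?_
    rw [uIcc_of_le hq.le] at hx
    have : 0 ≤ gsin p x := by rw [← gsin_zero hp]; exact monotone_gsin hp hx.1
    simp only [abs_of_nonneg this]
  rw [he] at h
  simp only [intervalIntegral.integral_const, sub_zero, smul_eq_mul, mul_one, zero_mul,
    mul_zero] at h
  field_simp
  linarith

/-- The primitive of `slope ^ (p - 1)`. -/
def calib (p v : ℝ) : ℝ := ∫ x in (0 : ℝ)..v, slope p x ^ (p - 1)

lemma hasDerivAt_calib (hp : 1 < p) (v : ℝ) : HasDerivAt (calib p) (slope p v ^ (p - 1)) v :=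
  ((continuous_slope_rpow hp).integral_hasStrictDerivAt 0 v).hasDerivAt

lemma calib_zero : calib p 0 = 0 := by simp [calib]

lemma strictMonoOn_calib (hp : 1 < p) : StrictMonoOn (calib p) (Icc (-1) 1) := by
  refine strictMonoOn_of_deriv_pos (convex_Icc _ _)
    (fun v _ => (hasDerivAt_calib hp v).continuousAt.continuousWithinAt) fun v hv => ?_
  rw [interior_Icc] at hv
  rw [(hasDerivAt_calib hp v).deriv]
  exact Real.rpow_pos_of_pos (slope_pos hp (abs_lt.mpr hv)) _

/-- The substitution v = S(x) turns the integrand into (S')^p = 1 - S^p, whose integral over the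
quarter period is q - q/p. -/
lemma calib_one (hp : 1 < p) : calib p 1 = (p - 1) / p * quarter p := by
  have h := intervalIntegral.integral_comp_mul_deriv (a := 0) (b := quarter p)
    (fun x _ => hasDerivAt_gsin hp x) (continuous_slope_gsin hp).continuousOn
    (continuous_slope_rpow hp)
  rw [gsin_zero hp, gsin_quarter hp] at h
  rw [calib, ← h]
  have hq := quarter_pos hp
  have he : ∫ x in (0 : ℝ)..quarter p, ((fun v => slope p v ^ (p - 1)) ∘ gsin p) x
      * slope p (gsin p x) = ∫ x in (0 : ℝ)..quarter p, (1 - gsin p x ^ p) := by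
    refine intervalIntegral.integral_congr fun x hx => ?_
    rw [uIcc_of_le hq.le] at hx
    have h0 : 0 ≤ gsin p x := by rw [← gsin_zero hp]; exact monotone_gsin hp hx.1
    simp only [Function.comp]
    rw [rpow_sub_one_mul_self hp (slope_nonneg _ _), slope_rpow hp (abs_gsin_le p x),
      abs_of_nonneg h0]
  rw [he, intervalIntegral.integral_sub (by simp), integral_gsin_rpow hp]
  · simp only [intervalIntegral.integral_const, sub_zero, smul_eq_mul, mul_one]
    field_simp
  · exact ((continuous_gsin hp).rpow_const fun _ => Or.inr (by linarith)).intervalIntegrable _ _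

end slope

end

section

/-! ### Primitives of integrable functions -/

/-- `w` is a primitive on `[s, t]` of the interval integrable function `g`. -/
structure IsPrimitiveOn (s t : ℝ) (w g : ℝ → ℝ) : Prop where
  integrable : IntervalIntegrable g volume s t
  eq : ∀ x ∈ Icc s t, w x = w s + ∫ y in s..x, g y

namespace IsPrimitiveOn

variable {s t : ℝ} {w g w' g' : ℝ → ℝ}

lemma integrable_sub (h : IsPrimitiveOn s t w g) {x y : ℝ} (hx : x ∈ Icc s t) (hy : y ∈ Icc s t) :
    IntervalIntegrable g volume x y :=
  h.integrable.mono_set (by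
    rw [uIcc_of_le (hx.1.trans hx.2)]
    exact uIcc_subset_Icc hx hy)

lemma sub_eq (h : IsPrimitiveOn s t w g) {x y : ℝ} (hx : x ∈ Icc s t) (hy : y ∈ Icc s t) :
    w y - w x = ∫ z in x..y, g z := by
  have hs : s ∈ Icc s t := ⟨le_rfl, hx.1.trans hx.2⟩
  rw [h.eq x hx, h.eq y hy, ← intervalIntegral.integral_interval_sub_left
    (h.integrable_sub hs hy) (h.integrable_sub hs hx)]
  ring

lemma mono (h : IsPrimitiveOn s t w g) {x y : ℝ} (hx : x ∈ Icc s t) (hy : y ∈ Icc s t) :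
    IsPrimitiveOn x y w g where
  integrable := h.integrable_sub hx hy
  eq z hz := by
    rw [← h.sub_eq hx ⟨hx.1.trans hz.1, hz.2.trans hy.2⟩]
    ring

lemma absolutelyContinuous (h : IsPrimitiveOn s t w g) (hst : s ≤ t) :
    AbsolutelyContinuousOnInterval w s t := by
  have hF := h.integrable.absolutelyContinuousOnInterval_intervalIntegral
    (c := s) left_mem_uIcc
  rw [absolutelyContinuousOnInterval_iff] at hF ⊢
  intro ε hε
  obtain ⟨δ, hδ, H⟩ := hF ε hε
  refine ⟨δ, hδ, fun E hE hs => ?_⟩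
  convert H E hE hs using 1
  refine Finset.sum_congr rfl fun i hi => ?_
  have h1 := (hE.1 i hi).1
  have h2 := (hE.1 i hi).2
  rw [uIcc_of_le hst] at h1 h2
  rw [h.eq _ h1, h.eq _ h2, dist_add_left]

lemma continuousOn (h : IsPrimitiveOn s t w g) : ContinuousOn w (Icc s t) := by
  rcases le_or_gt s t with hst | hst
  · have := (h.absolutelyContinuous hst).continuousOn
    rwa [uIcc_of_le hst] at this
  · rw [Icc_eq_empty (not_le.mpr hst)]
    exact continuousOn_empty _

lemma ae_hasDerivAt (h : IsPrimitiveOn s t w g) :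
    ∀ᵐ x, x ∈ Ioo s t → HasDerivAt w (g x) x := by
  filter_upwards [h.integrable.ae_hasDerivAt_integral] with x hx hxst
  have hst : s ≤ t := (hxst.1.trans hxst.2).le
  have h1 := (hx (by rw [uIcc_of_le hst]; exact Ioo_subset_Icc_self hxst) s left_mem_uIcc).const_add
    (w s)
  refine h1.congr_of_eventuallyEq ?_
  filter_upwards [Ioo_mem_nhds hxst.1 hxst.2] with y hy
  exact h.eq y (Ioo_subset_Icc_self hy)

/-- The converse direction of the Lebesgue fundamental theorem. Together with `absolutelyContinuous`
and `ae_hasDerivAt` it reduces product and chain rules to pointwise derivatives almost everywhere.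
-/
lemma of_absolutelyContinuous (hst : s ≤ t) (hw : AbsolutelyContinuousOnInterval w s t)
    (hg : ∀ᵐ x, x ∈ Ioo s t → HasDerivAt w (g x) x) : IsPrimitiveOn s t w g := by
  have hne : ∀ᵐ x : ℝ, x ≠ t := Measure.ae_ne volume t
  have he : ∀ᵐ x, x ∈ Ioc s t → deriv w x = g x := by
    filter_upwards [hg, hne] with x hx hxt hxm
    exact (hx ⟨hxm.1, lt_of_le_of_ne hxm.2 hxt⟩).deriv
  constructor
  · refine hw.intervalIntegrable_deriv.congr_ae ?_
    rw [uIoc_of_le hst]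
    exact (ae_restrict_iff' measurableSet_Ioc).mpr he
  · intro x hx
    have hx' : AbsolutelyContinuousOnInterval w s x := hw.mono (by
      rw [uIcc_of_le hst, uIcc_of_le hx.1]
      exact Icc_subset_Icc le_rfl hx.2)
    have h1 := hx'.integral_deriv_eq_sub
    rw [intervalIntegral.integral_congr_ae (g := g)] at h1
    · rw [h1]; ring
    · rw [uIoc_of_le hx.1]
      filter_upwards [he] with y hy hys
      exact hy ⟨hys.1, hys.2.trans hx.2⟩

lemma of_continuous (hg : Continuous g) (hw : ∀ x, HasDerivAt w (g x) x) (s t : ℝ) :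
    IsPrimitiveOn s t w g where
  integrable := hg.intervalIntegrable _ _
  eq x hx := by
    rw [intervalIntegral.integral_eq_sub_of_hasDerivAt (fun y _ => hw y)
      (hg.intervalIntegrable _ _)]
    ring

lemma mul (h : IsPrimitiveOn s t w g) (h' : IsPrimitiveOn s t w' g') (hst : s ≤ t) :
    IsPrimitiveOn s t (fun x => w x * w' x) (fun x => g x * w' x + w x * g' x) := by
  refine of_absolutelyContinuous hst
    ((h.absolutelyContinuous hst).fun_mul (h'.absolutelyContinuous hst)) ?_
  filter_upwards [h.ae_hasDerivAt, h'.ae_hasDerivAt] with x h1 h2 hx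
  exact (h1 hx).mul (h2 hx)

lemma integral_mul (h : IsPrimitiveOn s t w g) (h' : IsPrimitiveOn s t w' g') (hst : s ≤ t) :
    ∫ x in s..t, w x * g' x = w t * w' t - w s * w' s - ∫ x in s..t, g x * w' x := by
  have h1 := (h.mul h' hst).sub_eq (left_mem_Icc.mpr hst) (right_mem_Icc.mpr hst)
  rw [h1, intervalIntegral.integral_add]
  · ring
  · exact h.integrable.mul_continuousOn (by rw [uIcc_of_le hst]; exact h'.continuousOn)
  · exact h'.integrable.continuousOn_mul (by rw [uIcc_of_le hst]; exact h.continuousOn)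

lemma comp (h : IsPrimitiveOn s t w g) (hst : s ≤ t) {Φ φ : ℝ → ℝ} (hφ : Continuous φ)
    (hΦ : ∀ x, HasDerivAt Φ (φ x) x) :
    IsPrimitiveOn s t (fun x => Φ (w x)) (fun x => φ (w x) * g x) := by
  refine of_absolutelyContinuous hst ?_ ?_
  · obtain ⟨R, hR⟩ := (isCompact_Icc.image_of_continuousOn h.continuousOn).isBounded.subset_closedBall
      (0 : ℝ)
    obtain ⟨K, hK⟩ := ((isCompact_closedBall (0 : ℝ) R).image_of_continuousOn
      hφ.continuousOn).isBounded.exists_norm_le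
    have hK0 : 0 ≤ |K| := abs_nonneg K
    -- Φ is Lipschitz on a ball containing the compact range of w. The added 1 keeps the constant
    -- positive, so that ε can be divided by it below.
    have hlip : ∀ x ∈ Icc s t, ∀ y ∈ Icc s t, dist (Φ (w x)) (Φ (w y)) ≤ (|K| + 1) * dist (w x) (w y) := by
      intro x hx y hy
      have := (convex_closedBall (0 : ℝ) R).norm_image_sub_le_of_norm_hasDerivWithin_le
        (f := Φ) (f' := φ) (C := |K| + 1) (fun z _ => (hΦ z).hasDerivWithinAt)
        (fun z hz => (hK _ (mem_image_of_mem φ hz)).trans (by linarith [le_abs_self K]))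
        (hR (mem_image_of_mem w hy)) (hR (mem_image_of_mem w hx))
      rwa [← dist_eq_norm, ← dist_eq_norm] at this
    have hA := h.absolutelyContinuous hst
    rw [absolutelyContinuousOnInterval_iff] at hA ⊢
    intro ε hε
    obtain ⟨δ, hδ, H⟩ := hA (ε / (|K| + 1)) (by positivity)
    refine ⟨δ, hδ, fun E hE hs => ?_⟩
    have h1 := H E hE hs
    rw [lt_div_iff₀ (by positivity), mul_comm, Finset.mul_sum] at h1
    refine lt_of_le_of_lt (Finset.sum_le_sum fun i hi => ?_) h1
    have h2 := hE.1 i hi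
    rw [uIcc_of_le hst] at h2
    exact hlip _ h2.1 _ h2.2
  · filter_upwards [h.ae_hasDerivAt] with x h1 hx
    exact (hΦ (w x)).comp x (h1 hx)

lemma const_mul (h : IsPrimitiveOn s t w g) (c : ℝ) :
    IsPrimitiveOn s t (fun x => c * w x) (fun x => c * g x) where
  integrable := h.integrable.const_mul c
  eq x hx := by
    rw [h.eq x hx, intervalIntegral.integral_const_mul]
    ring

lemma congr_ae (h : IsPrimitiveOn s t w g) (hst : s ≤ t)
    (hg : ∀ᵐ x, x ∈ Ioo s t → g x = g' x) : IsPrimitiveOn s t w g' := by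
  refine of_absolutelyContinuous hst (h.absolutelyContinuous hst) ?_
  filter_upwards [hg, h.ae_hasDerivAt] with x h1 h2 hx
  rw [← h1 hx]; exact h2 hx

/-- Invariance under `w ↦ -w(-·)`. -/
lemma reflect (h : IsPrimitiveOn s t w g) (hst : s ≤ t) :
    IsPrimitiveOn (-t) (-s) (fun x => -w (-x)) (fun x => g (-x)) where
  integrable := by
    have := h.integrable
    rw [IntervalIntegrable.iff_comp_neg] at this
    exact this.symm
  eq x hx := by
    have h1 := intervalIntegral.integral_comp_neg (a := -t) (b := x) g
    rw [h1, neg_neg, ← h.sub_eq ⟨by linarith [hx.2], by linarith [hx.1]⟩ ⟨hst, le_rfl⟩]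
    ring

end IsPrimitiveOn

end

section

/-! ### Sobolev functions as primitives -/

lemma exists_isTest_integral_eq_one {s t : ℝ} (hst : s < t) :
    ∃ ρ, IsTest s t ρ ∧ ∫ x in s..t, ρ x = 1 := by
  let f : ContDiffBump ((s + t) / 2) := ⟨(t - s) / 8, (t - s) / 4, by linarith, by linarith⟩
  have hsub : tsupport (f.normed volume) ⊆ Ioo s t := by
    rw [f.tsupport_normed_eq, Real.closedBall_eq_Icc]
    intro x hx
    change x ∈ Icc ((s + t) / 2 - (t - s) / 4) ((s + t) / 2 + (t - s) / 4) at hx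
    exact ⟨by linarith [hx.1], by linarith [hx.2]⟩
  refine ⟨f.normed volume, ⟨f.contDiff_normed, f.hasCompactSupport_normed, hsub⟩, ?_⟩
  have h := f.integral_normed (μ := volume)
  rw [intervalIntegral.integral_of_le hst.le, setIntegral_eq_integral_of_forall_compl_eq_zero, h]
  intro x hx
  by_contra hne
  exact hx (Ioo_subset_Ioc_self (hsub (subset_tsupport _ hne)))

namespace IsTest

variable {s t : ℝ} {η : ℝ → ℝ}

lemma eq_zero_of_notMem (h : IsTest s t η) {x : ℝ} (hx : x ∉ Ioo s t) : η x = 0 := by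
  by_contra hne
  exact hx (h.support (subset_tsupport _ hne))

lemma hasDerivAt (h : IsTest s t η) (x : ℝ) : HasDerivAt η (deriv η x) x :=
  (h.smooth.differentiable (by simp) x).hasDerivAt

lemma continuous_deriv (h : IsTest s t η) : Continuous (deriv η) :=
  h.smooth.continuous_deriv (by simp)

lemma isPrimitiveOn (h : IsTest s t η) (x y : ℝ) : IsPrimitiveOn x y η (deriv η) :=
  .of_continuous h.continuous_deriv h.hasDerivAt x y

lemma exists_Icc (h : IsTest s t η) (hst : s < t) :
    ∃ a b, s < a ∧ b < t ∧ a ≤ b ∧ tsupport η ⊆ Icc a b := by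
  rcases (tsupport η).eq_empty_or_nonempty with he | hne
  · exact ⟨(s + t) / 2, (s + t) / 2, by linarith, by linarith, le_rfl, by simp [he]⟩
  · have hc : IsCompact (tsupport η) := h.compact
    obtain ⟨a, ha, ha'⟩ := hc.exists_isLeast hne
    obtain ⟨b, hb, hb'⟩ := hc.exists_isGreatest hne
    exact ⟨a, b, (h.support ha).1, (h.support hb).2, ha' hb, fun x hx => ⟨ha' hx, hb' hx⟩⟩

/-- The primitive of a test function with zero integral is a test function. -/
lemma primitive (h : IsTest s t η) (hst : s < t) (h0 : ∫ x in s..t, η x = 0) :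
    IsTest s t (fun x => ∫ y in s..x, η y) ∧ ∀ x, deriv (fun x => ∫ y in s..x, η y) x = η x := by
  have hd : ∀ x, HasDerivAt (fun x => ∫ y in s..x, η y) (η x) x := fun x =>
    (h.smooth.continuous.integral_hasStrictDerivAt s x).hasDerivAt
  have hderiv : deriv (fun x => ∫ y in s..x, η y) = η := funext fun x => (hd x).deriv
  have hii : ∀ x y, IntervalIntegrable η volume x y := fun x y =>
    h.smooth.continuous.intervalIntegrable x y
  obtain ⟨a, b, hsa, hbt, hab, hsub⟩ := h.exists_Icc hst
  have hz : ∀ x y, (∀ z ∈ uIcc x y, z ∉ Icc a b) → ∫ z in x..y, η z = 0 := by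
    intro x y H
    rw [intervalIntegral.integral_congr (g := fun _ => (0 : ℝ)), intervalIntegral.integral_zero]
    intro z hz
    by_contra hne
    exact H z hz (hsub (subset_tsupport _ hne))
  have hsupp : tsupport (fun x => ∫ y in s..x, η y) ⊆ Icc a b := by
    refine closure_minimal (fun x hx => ?_) isClosed_Icc
    by_contra hxI
    apply hx
    rcases lt_or_ge x a with hxa | hxa
    · refine hz s x fun z hz hzI => ?_
      have : z ≤ max s x := hz.2
      have := max_lt hsa hxa
      linarith [hzI.1]
    · have hbx : b < x := by
        by_contra hbx
        exact hxI ⟨hxa, not_lt.mp hbx⟩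
      change ∫ y in s..x, η y = 0
      rw [← intervalIntegral.integral_add_adjacent_intervals (hii s t) (hii t x), h0, zero_add]
      refine hz t x fun z hz hzI => ?_
      have : min t x ≤ z := hz.1
      have := lt_min hbt hbx
      linarith [hzI.2]
  refine ⟨⟨?_, ?_, ?_⟩, fun x => (hd x).deriv⟩
  · rw [contDiff_infty_iff_deriv, hderiv]
    exact ⟨fun x => (hd x).differentiableAt, h.smooth⟩
  · exact isCompact_Icc.of_isClosed_subset (isClosed_tsupport _) hsupp
  · exact hsupp.trans fun x hx => ⟨by linarith [hx.1], by linarith [hx.2]⟩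

lemma sub_const_mul {ρ : ℝ → ℝ} (h : IsTest s t η) (hρ : IsTest s t ρ) (c : ℝ) :
    IsTest s t (fun x => η x - c * ρ x) := by
  have hsub : tsupport (fun x => η x - c * ρ x) ⊆ tsupport η ∪ tsupport ρ := by
    refine closure_minimal (fun x hx => ?_) ((isClosed_tsupport _).union (isClosed_tsupport _))
    by_contra hne
    rw [mem_union, not_or] at hne
    apply hx
    simp [image_eq_zero_of_notMem_tsupport hne.1, image_eq_zero_of_notMem_tsupport hne.2]
  refine ⟨h.smooth.sub (contDiff_const.mul hρ.smooth), ?_,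
    hsub.trans (union_subset h.support hρ.support)⟩
  exact (IsCompact.union h.compact hρ.compact).of_isClosed_subset (isClosed_tsupport _) hsub

end IsTest

lemma one_le_ofReal {p : ℝ} (hp : 1 < p) : (1 : ENNReal) ≤ ENNReal.ofReal p := by
  rw [← ENNReal.ofReal_one]; exact ENNReal.ofReal_le_ofReal hp.le

lemma intervalIntegrable_of_memLp {p s t : ℝ} {f : ℝ → ℝ} (hp : 1 < p) (hst : s ≤ t)
    (hf : MemLp f (ENNReal.ofReal p) (volOn s t)) : IntervalIntegrable f volume s t := by
  rw [intervalIntegrable_iff_integrableOn_Ioo_of_le hst]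
  exact hf.integrable (one_le_ofReal hp)

lemma setIntegral_Ioo_eq {s t : ℝ} (hst : s ≤ t) (f : ℝ → ℝ) :
    ∫ x in Ioo s t, f x = ∫ x in s..t, f x := by
  rw [intervalIntegral.integral_of_le hst, integral_Ioc_eq_integral_Ioo]

lemma ae_volOn_iff {s t : ℝ} {P : ℝ → Prop} :
    (∀ᵐ x ∂(volOn s t), P x) ↔ ∀ᵐ x, x ∈ Ioo s t → P x :=
  ae_restrict_iff' measurableSet_Ioo

/-- Elements of `W₀^{1,p}` are primitives of their derivatives vanishing at the end points. -/
lemma W0.exists_primitive {p T : ℝ} (hp : 1 < p) (hT : 0 < T) (u : W0 p T) :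
    ∃ w, IsPrimitiveOn (-T) T w u.der ∧ w (-T) = 0 ∧ w T = 0 ∧
      ∀ᵐ t ∂(volOn (-T) T), u t = w t := by
  obtain ⟨η, hη, h1, h2⟩ := u.approx
  have hTT : -T ≤ T := by linarith
  have hder := intervalIntegrable_of_memLp hp hTT u.memLp_der
  -- On an interval of finite length, L^p convergence of the derivatives implies L¹ convergence.
  have hlim1 : Tendsto (fun n => ∫ y in (-T)..T, |deriv (η n) y - u.der y|) atTop (𝓝 0) := by
    have hm : ∀ n, AEStronglyMeasurable (fun t => deriv (η n) t - u.der t) (volOn (-T) T) :=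
      fun n => ((hη n).continuous_deriv.aestronglyMeasurable).sub u.memLp_der.1
    have hb : ∀ n, eLpNorm (fun t => deriv (η n) t - u.der t) 1 (volOn (-T) T) ≤
        eLpNorm (fun t => deriv (η n) t - u.der t) (ENNReal.ofReal p) (volOn (-T) T) *
          (volOn (-T) T) univ ^ (1 / (1 : ENNReal).toReal - 1 / (ENNReal.ofReal p).toReal) :=
      fun n => eLpNorm_le_eLpNorm_mul_rpow_measure_univ (one_le_ofReal hp) (hm n)
    have hc : (volOn (-T) T) univ ^ (1 / (1 : ENNReal).toReal - 1 / (ENNReal.ofReal p).toReal)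
        ≠ ⊤ := by
      refine ENNReal.rpow_ne_top_of_nonneg ?_ (measure_ne_top _ _)
      rw [ENNReal.toReal_ofReal (by linarith), ENNReal.toReal_one, one_div_one, sub_nonneg,
        div_le_one (by linarith)]
      exact hp.le
    have ht := ENNReal.Tendsto.mul_const h2 (Or.inr hc)
    rw [zero_mul] at ht
    have ht' := tendsto_of_tendsto_of_tendsto_of_le_of_le tendsto_const_nhds ht
      (fun _ => zero_le) hb
    have hr := (ENNReal.tendsto_toReal ENNReal.zero_ne_top).comp ht'
    rw [ENNReal.toReal_zero] at hr
    refine hr.congr fun n => ?_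
    rw [Function.comp, eLpNorm_one_eq_lintegral_enorm, ← integral_norm_eq_lintegral_enorm (hm n),
      setIntegral_Ioo_eq hTT]
    rfl
  -- A test function is the integral of its derivative from -T, so L¹ convergence of the derivatives
  -- gives convergence at every point. In particular the limit vanishes at T.
  have hpt : ∀ x ∈ Icc (-T) T, Tendsto (fun n => η n x) atTop (𝓝 (∫ y in (-T)..x, u.der y)) := by
    intro x hx
    rw [tendsto_iff_dist_tendsto_zero]
    refine squeeze_zero (fun _ => dist_nonneg) (fun n => ?_) hlim1
    have hd := ((hη n).isPrimitiveOn (-T) T).sub_eq ⟨le_rfl, hTT⟩ hx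
    rw [(hη n).eq_zero_of_notMem (x := -T) (by simp), sub_zero] at hd
    have hi : IntervalIntegrable (fun y => deriv (η n) y - u.der y) volume (-T) T :=
      ((hη n).continuous_deriv.intervalIntegrable _ _).sub hder
    have hix : IntervalIntegrable u.der volume (-T) x := hder.mono_set (by
      rw [uIcc_of_le hTT, uIcc_of_le hx.1]; exact Icc_subset_Icc le_rfl hx.2)
    rw [hd, Real.dist_eq, ← intervalIntegral.integral_sub
      ((hη n).continuous_deriv.intervalIntegrable _ _) hix]
    refine (intervalIntegral.abs_integral_le_integral_abs hx.1).trans ?_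
    exact intervalIntegral.integral_mono_interval le_rfl hx.1 hx.2
      (Eventually.of_forall fun _ => abs_nonneg _) hi.abs
  refine ⟨fun x => ∫ y in (-T)..x, u.der y, ⟨hder, fun x _ => by simp⟩, by simp, ?_, ?_⟩
  · refine tendsto_nhds_unique (hpt T ⟨hTT, le_rfl⟩) ?_
    simp only [fun n => (hη n).eq_zero_of_notMem (x := T) (by simp)]
    exact tendsto_const_nhds
  -- A subsequence of the approximants converges almost everywhere to u, while the whole sequence
  -- converges pointwise to the primitive.
  · have hmeas := tendstoInMeasure_of_tendsto_eLpNorm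
      (by simpa using (by linarith : 0 < p))
      (fun n => (hη n).smooth.continuous.aestronglyMeasurable) u.memLp_toFun.1 h1
    obtain ⟨ns, hns, hae⟩ := hmeas.exists_seq_tendsto_ae
    filter_upwards [hae, ae_restrict_mem measurableSet_Ioo] with x hx hxm
    exact tendsto_nhds_unique hx ((hpt x (Ioo_subset_Icc_self hxm)).comp hns.tendsto_atTop)

/-- Sobolev functions on an interval are primitives of their weak derivatives. -/
lemma IsSobolevOn.exists_primitive {p s t : ℝ} {u g : ℝ → ℝ} (hp : 1 < p) (hst : s < t)
    (h : IsSobolevOn p s t u g) :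
    ∃ w, IsPrimitiveOn s t w g ∧ ∀ᵐ x ∂(volOn s t), u x = w x := by
  have hu := intervalIntegrable_of_memLp hp hst.le h.memLp_fun
  have hg := intervalIntegrable_of_memLp hp hst.le h.memLp_der
  set G : ℝ → ℝ := fun x => ∫ y in s..x, g y with hGdef
  have hG : IsPrimitiveOn s t G g := ⟨hg, fun x _ => by simp [hGdef]⟩
  have hGi : IntervalIntegrable G volume s t := by
    refine ContinuousOn.intervalIntegrable ?_
    rw [uIcc_of_le hst.le]; exact hG.continuousOn
  have hv : IntervalIntegrable (fun x => u x - G x) volume s t := hu.sub hGi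
  -- The du Bois-Reymond argument: u - G has zero weak derivative and must be shown to be constant.
  have hweak : ∀ η, IsTest s t η → ∫ x in s..t, (u x - G x) * deriv η x = 0 := by
    intro η hη
    have h1 := h.weak η hη
    rw [setIntegral_Ioo_eq hst.le, setIntegral_Ioo_eq hst.le] at h1
    have h2 := hG.integral_mul (hη.isPrimitiveOn s t) hst.le
    rw [hη.eq_zero_of_notMem (x := s) (by simp), hη.eq_zero_of_notMem (x := t) (by simp)] at h2
    have h3 : ∫ x in s..t, (u x - G x) * deriv η x
        = (∫ x in s..t, u x * deriv η x) - ∫ x in s..t, G x * deriv η x := by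
      rw [← intervalIntegral.integral_sub]
      · simp only [sub_mul]
      · exact hu.mul_continuousOn hη.continuous_deriv.continuousOn
      · exact hGi.mul_continuousOn hη.continuous_deriv.continuousOn
    rw [h3, h1, h2]; ring
  obtain ⟨ρ, hρ, hρ1⟩ := exists_isTest_integral_eq_one hst
  set c := ∫ x in s..t, (u x - G x) * ρ x with hc
  have hae : ∀ᵐ x, x ∈ Ioo s t → u x - G x - c = 0 := by
    refine isOpen_Ioo.ae_eq_zero_of_integral_contDiff_smul_eq_zero ?_ fun η hη1 hη2 hη3 => ?_
    · refine IntegrableOn.locallyIntegrableOn ?_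
      rw [← intervalIntegrable_iff_integrableOn_Ioo_of_le hst.le]
      exact hv.sub intervalIntegrable_const
    · have hη : IsTest s t η := ⟨hη1, hη2, hη3⟩
      have hηc := hη.smooth.continuous
      set m := ∫ x in s..t, η x with hm
      have hρc := hρ.smooth.continuous
      -- An arbitrary test function becomes a derivative of a test function once its mean is removed
      -- by a multiple of ρ; testing with that primitive identifies the constant as c.
      have hk0 : ∫ x in s..t, (η x - m * ρ x) = 0 := by
        rw [intervalIntegral.integral_sub (hηc.intervalIntegrable _ _)
          ((hρc.intervalIntegrable _ _).const_mul m),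
          intervalIntegral.integral_const_mul, hρ1, mul_one, sub_self]
      obtain ⟨hk1, hk2⟩ := (hη.sub_const_mul hρ m).primitive hst hk0
      have h4 := hweak _ hk1
      simp only [hk2] at h4
      have h5 : ∫ x in s..t, (u x - G x) * (η x - m * ρ x)
          = (∫ x in s..t, (u x - G x) * η x) - m * c := by
        rw [hc, ← intervalIntegral.integral_const_mul, ← intervalIntegral.integral_sub]
        · refine intervalIntegral.integral_congr fun x _ => ?_
          ring
        · exact hv.mul_continuousOn hηc.continuousOn
        · exact (hv.mul_continuousOn hρc.continuousOn).const_mul _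
      have h6 : ∫ x, η x • (u x - G x - c) = ∫ x in s..t, η x * (u x - G x - c) := by
        rw [intervalIntegral.integral_of_le hst.le,
          setIntegral_eq_integral_of_forall_compl_eq_zero]
        · rfl
        · intro x hx
          rw [hη.eq_zero_of_notMem fun hx' => hx (Ioo_subset_Ioc_self hx'), zero_mul]
      have h7 : ∫ x in s..t, η x * (u x - G x - c)
          = (∫ x in s..t, (u x - G x) * η x) - c * m := by
        rw [hm, ← intervalIntegral.integral_const_mul, ← intervalIntegral.integral_sub]
        · refine intervalIntegral.integral_congr fun x _ => ?_
          ring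
        · exact hv.mul_continuousOn hηc.continuousOn
        · exact (hηc.intervalIntegrable _ _).const_mul _
      rw [h6, h7]
      linarith
  refine ⟨fun x => c + G x, ⟨hg, fun x hx => ?_⟩, ?_⟩
  · simp [hGdef]
  · rw [ae_volOn_iff]
    filter_upwards [hae] with x hx hxm
    linarith [hx hxm]

lemma memLp_of_continuousOn {p s t : ℝ} {f : ℝ → ℝ} (hf : ContinuousOn f (Icc s t)) :
    MemLp f (ENNReal.ofReal p) (volOn s t) := by
  obtain ⟨C, hC⟩ := (isCompact_Icc.image_of_continuousOn hf).isBounded.exists_norm_le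
  refine MemLp.of_bound ((hf.mono Ioo_subset_Icc_self).aestronglyMeasurable measurableSet_Ioo) C ?_
  filter_upwards [ae_restrict_mem measurableSet_Ioo] with x hx
  exact hC _ (mem_image_of_mem f (Ioo_subset_Icc_self hx))

/-- Primitives of `L^p` functions are Sobolev functions. -/
lemma IsPrimitiveOn.isSobolevOn {p s t : ℝ} {u w g : ℝ → ℝ} (h : IsPrimitiveOn s t w g)
    (hst : s ≤ t) (hg : MemLp g (ENNReal.ofReal p) (volOn s t))
    (hu : ∀ᵐ x ∂(volOn s t), u x = w x) : IsSobolevOn p s t u g where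
  memLp_fun := (memLp_congr_ae hu).mpr (memLp_of_continuousOn h.continuousOn)
  memLp_der := hg
  weak η hη := by
    have h1 := h.integral_mul (hη.isPrimitiveOn s t) hst
    rw [hη.eq_zero_of_notMem (x := s) (by simp), hη.eq_zero_of_notMem (x := t) (by simp)] at h1
    rw [integral_congr_ae (g := fun x => w x * deriv η x), setIntegral_Ioo_eq hst,
      setIntegral_Ioo_eq hst, h1]
    · ring
    · filter_upwards [hu] with x hx
      rw [hx]

lemma tendsto_eLpNorm_of_dominated {p : ℝ} {μ : Measure ℝ} [IsFiniteMeasure μ] (hp : 1 < p)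
    {f : ℕ → ℝ → ℝ} {g : ℝ → ℝ} {C : ℝ} (hf : ∀ n, AEStronglyMeasurable (f n) μ)
    (hg : AEStronglyMeasurable g μ) (hb : ∀ n, ∀ᵐ x ∂μ, |f n x - g x| ≤ C)
    (hlim : ∀ᵐ x ∂μ, Tendsto (fun n => f n x) atTop (𝓝 (g x))) :
    Tendsto (fun n => eLpNorm (fun x => f n x - g x) (ENNReal.ofReal p) μ) atTop (𝓝 0) := by
  have h0 : ENNReal.ofReal p ≠ 0 := by simpa using (by linarith : 0 < p)
  have hpp : (ENNReal.ofReal p).toReal = p := ENNReal.toReal_ofReal (by linarith)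
  simp only [eLpNorm_eq_lintegral_rpow_enorm_toReal h0 ENNReal.ofReal_ne_top, hpp]
  have h : Tendsto (fun n => ∫⁻ x, ‖f n x - g x‖ₑ ^ p ∂μ) atTop (𝓝 (∫⁻ _, 0 ∂μ)) := by
    refine tendsto_lintegral_of_dominated_convergence' (fun _ => ENNReal.ofReal C ^ p)
      (fun n => ((hf n).sub hg).enorm.pow_const p) (fun n => ?_) ?_ ?_
    · filter_upwards [hb n] with x hx
      refine ENNReal.rpow_le_rpow ?_ (by linarith)
      rw [Real.enorm_eq_ofReal_abs]
      exact ENNReal.ofReal_le_ofReal hx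
    · rw [lintegral_const]
      exact ENNReal.mul_ne_top (ENNReal.rpow_ne_top_of_nonneg (by linarith) ENNReal.ofReal_ne_top)
        (measure_ne_top _ _)
    · filter_upwards [hlim] with x hx
      have h1 : Tendsto (fun n => ‖f n x - g x‖ₑ) atTop (𝓝 0) := by
        have := (hx.sub_const (g x)).enorm
        simpa using this
      have h2 := ((ENNReal.continuous_rpow_const (y := p)).tendsto 0).comp h1
      rwa [ENNReal.zero_rpow_of_pos (by linarith)] at h2
  rw [lintegral_zero] at h
  have h2 := ((ENNReal.continuous_rpow_const (y := 1 / p)).tendsto 0).comp h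
  rwa [ENNReal.zero_rpow_of_pos (by positivity)] at h2

end

/-! ### Approximation by test functions and membership in W₀^{1,p} -/

lemma exists_contDiff_approx {s t : ℝ} (hst : s ≤ t) {g : ℝ → ℝ} (hg : ContinuousOn g (Icc s t))
    {ε : ℝ} (hε : 0 < ε) : ∃ f : ℝ → ℝ, ContDiff ℝ ∞ f ∧ ∀ x ∈ Icc s t, |f x - g x| < ε := by
  -- Extending g by its end values makes it uniformly continuous on the line, so that it has uniform
  -- smooth approximants.
  have hu : UniformContinuous (IccExtend hst ((Icc s t).domRestrict g)) :=
    (CompactSpace.uniformContinuous_of_continuous hg.domRestrict).comp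
      (LipschitzWith.projIcc hst).uniformContinuous
  obtain ⟨f, hf, hfg⟩ := hu.exists_contDiff_dist_le hε
  refine ⟨f, hf, fun x hx => ?_⟩
  have := hfg x
  rwa [IccExtend_of_mem hst _ hx, Real.dist_eq] at this

/-- A function with continuous derivative on `[-T, T]` vanishing at the end points is in
`W₀^{1,p}`. -/
lemma W0.exists_of_isPrimitiveOn {p T : ℝ} (hp : 1 < p) (hT : 0 < T) {u w g : ℝ → ℝ}
    (hg : ContinuousOn g (Icc (-T) T)) (hw : IsPrimitiveOn (-T) T w g) (h0 : w (-T) = 0)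
    (h1 : w T = 0) (hu : ∀ᵐ x ∂(volOn (-T) T), u x = w x) :
    ∃ v : W0 p T, v.toFun = u ∧ v.der = g := by
  have hTT : -T ≤ T := by linarith
  obtain ⟨ρ, hρ, hρ1⟩ := exists_isTest_integral_eq_one (show -T < T by linarith)
  obtain ⟨C, hC⟩ := (isCompact_Icc.image_of_continuousOn hg).isBounded.exists_norm_le
  replace hC : ∀ x ∈ Icc (-T) T, |g x| ≤ C := fun x hx => hC _ (mem_image_of_mem g hx)
  have hC0 : 0 ≤ C := (abs_nonneg _).trans (hC T ⟨hTT, le_rfl⟩)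
  obtain ⟨R, hR⟩ := (isCompact_Icc.image_of_continuousOn
    hρ.smooth.continuous.continuousOn (s := Icc (-T) T)).isBounded.exists_norm_le
  replace hR : ∀ x ∈ Icc (-T) T, |ρ x| ≤ R := fun x hx => hR _ (mem_image_of_mem ρ hx)
  have hR0 : 0 ≤ R := (abs_nonneg _).trans (hR T ⟨hTT, le_rfl⟩)
  choose G hG hGg using fun n : ℕ => exists_contDiff_approx hTT hg
    (show (0 : ℝ) < 1 / ((n : ℝ) + 1) by positivity)
  -- These are the widths of the cut-off layers. The summand 3 makes twice the width smaller than T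
  -- already for n = 0, so the inner radius of the bump is positive.
  have hδ : ∀ n : ℕ, 0 < T / ((n : ℝ) + 3) ∧ 2 * (T / ((n : ℝ) + 3)) < T := fun n => by
    refine ⟨by positivity, ?_⟩
    have : T / ((n : ℝ) + 3) ≤ T / 3 := by
      apply div_le_div_of_nonneg_left hT.le (by norm_num)
      have : (0 : ℝ) ≤ n := Nat.cast_nonneg n
      linarith
    linarith
  let χ : ∀ n : ℕ, ContDiffBump (0 : ℝ) := fun n =>
    ⟨T - 2 * (T / ((n : ℝ) + 3)), T - T / ((n : ℝ) + 3), by linarith [(hδ n).2],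
      by linarith [(hδ n).1]⟩
  set f : ℕ → ℝ → ℝ := fun n x => χ n x * G n x with hf
  have hftest : ∀ n, IsTest (-T) T (f n) := fun n => by
    have hsub : tsupport (f n) ⊆ tsupport (χ n) := closure_mono (Function.support_mul_subset_left _ _)
    refine ⟨(χ n).contDiff.mul (hG n), (χ n).hasCompactSupport.of_isClosed_subset
      (isClosed_tsupport _) hsub, hsub.trans ?_⟩
    rw [(χ n).tsupport_eq, Real.closedBall_eq_Icc]
    intro x hx
    change x ∈ Icc (0 - (T - T / ((n : ℝ) + 3))) (0 + (T - T / ((n : ℝ) + 3))) at hx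
    exact ⟨by linarith [hx.1, (hδ n).1], by linarith [hx.2, (hδ n).1]⟩
  have hfb : ∀ n, ∀ x ∈ Icc (-T) T, |f n x| ≤ C + 1 := fun n x hx => by
    have h2 : |G n x| ≤ C + 1 := by
      have h3 := hGg n x hx
      have h4 : 1 / ((n : ℝ) + 1) ≤ 1 := by
        rw [div_le_one (by positivity)]
        have : (0 : ℝ) ≤ n := Nat.cast_nonneg n
        linarith
      have h5 := abs_sub_abs_le_abs_sub (G n x) (g x)
      linarith [hC x hx]
    rw [hf, abs_mul, abs_of_nonneg (χ n).nonneg]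
    calc χ n x * |G n x| ≤ 1 * |G n x| := by gcongr; exact (χ n).le_one
      _ ≤ C + 1 := by rwa [one_mul]
  have hflim : ∀ x ∈ Ioo (-T) T, Tendsto (fun n => f n x) atTop (𝓝 (g x)) := fun x hx => by
    have hlim : Tendsto (fun n : ℕ => T - 2 * (T / ((n : ℝ) + 3))) atTop (𝓝 T) := by
      have h3 : Tendsto (fun n : ℕ => (n : ℝ) + 3) atTop atTop :=
        tendsto_atTop_add_const_right _ _ tendsto_natCast_atTop_atTop
      have := ((h3.const_div_atTop T).const_mul 2).const_sub T
      simpa using this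
    have hχ : ∀ᶠ n in atTop, f n x = G n x := by
      filter_upwards [hlim.eventually (lt_mem_nhds (abs_lt.mpr hx))] with n hn
      have : χ n x = 1 := (χ n).one_of_mem_closedBall (by
        rw [mem_closedBall_zero_iff, Real.norm_eq_abs]; exact hn.le)
      rw [hf]; simp only [this, one_mul]
    have hGl : Tendsto (fun n => G n x) atTop (𝓝 (g x)) := by
      rw [tendsto_iff_dist_tendsto_zero]
      exact squeeze_zero (fun _ => dist_nonneg)
        (fun n => (hGg n x (Ioo_subset_Icc_self hx)).le) tendsto_one_div_add_atTop_nhds_zero_nat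
    exact hGl.congr' (hχ.mono fun n hn => hn.symm)
  have hne : ∀ᵐ x : ℝ, x ≠ T := Measure.ae_ne volume T
  set m : ℕ → ℝ := fun n => ∫ x in (-T)..T, f n x with hm
  have hmb : ∀ n, |m n| ≤ (C + 1) * (2 * T) := fun n => by
    have := intervalIntegral.norm_integral_le_of_norm_le_const (a := -T) (b := T) (f := f n)
      (C := C + 1) fun x hx => hfb n x (by
        rw [uIoc_of_le hTT] at hx; exact Ioc_subset_Icc_self hx)
    rw [abs_of_nonneg (by linarith : (0 : ℝ) ≤ T - -T)] at this
    rw [← Real.norm_eq_abs]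
    linarith
  have hmlim : Tendsto m atTop (𝓝 0) := by
    have h2 := hw.sub_eq ⟨le_rfl, hTT⟩ ⟨hTT, le_rfl⟩
    rw [h0, h1, sub_zero] at h2
    rw [h2]
    refine intervalIntegral.tendsto_integral_filter_of_dominated_convergence (fun _ => C + 1)
      (Eventually.of_forall fun n => (hftest n).smooth.continuous.aestronglyMeasurable)
      (Eventually.of_forall fun n => ae_of_all _ fun x hx => hfb n x ?_)
      intervalIntegrable_const ?_
    · rw [uIoc_of_le hTT] at hx; exact Ioc_subset_Icc_self hx
    · filter_upwards [hne] with x hxT hx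
      rw [uIoc_of_le hTT] at hx
      exact hflim x ⟨hx.1, lt_of_le_of_ne hx.2 hxT⟩
  -- The derivative is approximated first. The boundary values of w give g mean zero, so the means m
  -- n tend to 0; subtracting them makes the primitive of each approximant a test function without
  -- changing the limit.
  set h : ℕ → ℝ → ℝ := fun n x => f n x - m n * ρ x with hh
  have hhtest : ∀ n, IsTest (-T) T (h n) := fun n => (hftest n).sub_const_mul hρ (m n)
  set D : ℝ := C + 1 + (C + 1) * (2 * T) * R with hD
  have hhb : ∀ n, ∀ x ∈ Icc (-T) T, |h n x| ≤ D := fun n x hx => by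
    calc |f n x - m n * ρ x| ≤ |f n x| + |m n * ρ x| := abs_sub _ _
      _ ≤ D := by
        rw [abs_mul (m n)]
        exact add_le_add (hfb n x hx)
          (mul_le_mul (hmb n) (hR x hx) (abs_nonneg _) (by positivity))
  have hhlim : ∀ x ∈ Ioo (-T) T, Tendsto (fun n => h n x) atTop (𝓝 (g x)) := fun x hx => by
    have := (hflim x hx).sub (hmlim.mul_const (ρ x))
    simpa using this
  have hint : ∀ n, ∫ x in (-T)..T, h n x = 0 := fun n => by
    rw [hh, intervalIntegral.integral_sub ((hftest n).smooth.continuous.intervalIntegrable _ _)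
      ((hρ.smooth.continuous.intervalIntegrable _ _).const_mul _),
      intervalIntegral.integral_const_mul, hρ1, mul_one, sub_self]
  have hprim := fun n => (hhtest n).primitive (by linarith) (hint n)
  have hwx : ∀ x ∈ Icc (-T) T, w x = ∫ y in (-T)..x, g y := fun x hx => by
    rw [hw.eq x hx, h0, zero_add]
  have hgm : AEStronglyMeasurable g (volOn (-T) T) :=
    (hg.mono Ioo_subset_Icc_self).aestronglyMeasurable measurableSet_Ioo
  refine ⟨⟨u, g, (memLp_congr_ae hu).mpr (memLp_of_continuousOn hw.continuousOn),
    memLp_of_continuousOn hg, fun n x => ∫ y in (-T)..x, h n y, fun n => (hprim n).1, ?_, ?_⟩,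
    rfl, rfl⟩
  · have key : Tendsto (fun n => eLpNorm (fun x => (∫ y in (-T)..x, h n y) - w x)
        (ENNReal.ofReal p) (volOn (-T) T)) atTop (𝓝 0) := by
      refine tendsto_eLpNorm_of_dominated (C := (D + C) * (2 * T)) hp
        (fun n => (hprim n).1.smooth.continuous.aestronglyMeasurable)
        (memLp_of_continuousOn hw.continuousOn (p := p)).1 (fun n => ?_) ?_
      · filter_upwards [ae_restrict_mem measurableSet_Ioo] with x hx
        have hgi : IntervalIntegrable g volume (-T) x :=
          hw.integrable_sub ⟨le_rfl, hTT⟩ (Ioo_subset_Icc_self hx)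
        rw [hwx x (Ioo_subset_Icc_self hx), ← intervalIntegral.integral_sub
          ((hhtest n).smooth.continuous.intervalIntegrable _ _) hgi, ← Real.norm_eq_abs]
        refine (intervalIntegral.norm_integral_le_of_norm_le_const (C := D + C)
          fun y hy => ?_).trans ?_
        · rw [uIoc_of_le hx.1.le] at hy
          have hy' : y ∈ Icc (-T) T := ⟨hy.1.le, hy.2.trans hx.2.le⟩
          exact (abs_sub _ _).trans (add_le_add (hhb n y hy') (hC y hy'))
        · rw [abs_of_nonneg (by linarith [hx.1])]
          have : 0 ≤ D + C := by positivity
          gcongr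
          linarith [hx.2]
      · filter_upwards [ae_restrict_mem measurableSet_Ioo] with x hx
        rw [hwx x (Ioo_subset_Icc_self hx)]
        refine intervalIntegral.tendsto_integral_filter_of_dominated_convergence (fun _ => D)
          (Eventually.of_forall fun n => (hhtest n).smooth.continuous.aestronglyMeasurable)
          (Eventually.of_forall fun n => ae_of_all _ fun y hy => hhb n y ?_)
          intervalIntegrable_const (ae_of_all _ fun y hy => hhlim y ?_)
        · rw [uIoc_of_le hx.1.le] at hy
          exact ⟨hy.1.le, hy.2.trans hx.2.le⟩
        · rw [uIoc_of_le hx.1.le] at hy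
          exact ⟨hy.1, hy.2.trans_lt hx.2⟩
    refine key.congr fun n => eLpNorm_congr_ae ?_
    filter_upwards [hu] with x hx
    rw [hx]
  · simp only [(hprim _).2]
    refine tendsto_eLpNorm_of_dominated (C := D + C) hp
        (fun n => (hhtest n).smooth.continuous.aestronglyMeasurable) hgm (fun n => ?_) ?_
    · filter_upwards [ae_restrict_mem measurableSet_Ioo] with x hx
      exact (abs_sub _ _).trans (add_le_add (hhb n x (Ioo_subset_Icc_self hx))
        (hC x (Ioo_subset_Icc_self hx)))
    · filter_upwards [ae_restrict_mem measurableSet_Ioo] with x hx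
      exact hhlim x hx

/-- The negative of an element of `W₀^{1,p}`. -/
def W0.neg {p T : ℝ} (u : W0 p T) : W0 p T where
  toFun t := -u t
  der t := -u.der t
  memLp_toFun := u.memLp_toFun.neg
  memLp_der := u.memLp_der.neg
  approx := by
    obtain ⟨η, h1, h2, h3⟩ := u.approx
    refine ⟨fun n t => -η n t, fun n => ⟨(h1 n).smooth.neg, ?_, ?_⟩, ?_, ?_⟩
    · exact (h1 n).compact.neg
    · have : tsupport (fun t => -η n t) = tsupport (η n) := by
        simp only [tsupport]
        congr 1
        exact Function.support_neg (η n)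
      rw [this]; exact (h1 n).support
    · refine h2.congr fun n => ?_
      rw [← eLpNorm_neg]
      congr 1
      funext t
      simp only [Pi.neg_apply]
      ring
    · refine h3.congr fun n => ?_
      rw [← eLpNorm_neg]
      congr 1
      funext t
      simp only [Pi.neg_apply, deriv.fun_neg]
      ring

section

/-! ### The anisotropies `Hab` -/

section Hab

variable {a b : ℝ}

lemma Hab_of_nonneg {s : ℝ} (hs : 0 ≤ s) : Hab a b s = a * s := by
  rw [Hab, max_eq_left hs, max_eq_right (by linarith)]; ring

lemma Hab_of_nonpos {s : ℝ} (hs : s ≤ 0) : Hab a b s = -b * s := by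
  rw [Hab, max_eq_right hs, max_eq_left (by linarith)]; ring

lemma Hab_nonneg (ha : 0 ≤ a) (hb : 0 ≤ b) (s : ℝ) : 0 ≤ Hab a b s := by
  unfold Hab; positivity

lemma mul_le_Hab (ha : 0 ≤ a) (hb : 0 ≤ b) (s : ℝ) : a * s ≤ Hab a b s := by
  rcases le_total 0 s with h | h
  · rw [Hab_of_nonneg h]
  · rw [Hab_of_nonpos h]; nlinarith

lemma neg_mul_le_Hab (ha : 0 ≤ a) (hb : 0 ≤ b) (s : ℝ) : -b * s ≤ Hab a b s := by
  rcases le_total 0 s with h | h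
  · rw [Hab_of_nonneg h]; nlinarith
  · rw [Hab_of_nonpos h]

lemma Hab_le (ha : 0 ≤ a) (hb : 0 ≤ b) (s : ℝ) : Hab a b s ≤ (a + b) * |s| := by
  rcases le_total 0 s with h | h
  · rw [Hab_of_nonneg h, abs_of_nonneg h]; nlinarith
  · rw [Hab_of_nonpos h, abs_of_nonpos h]; nlinarith

lemma Hab_mul {c : ℝ} (hc : 0 ≤ c) (s : ℝ) : Hab a b (c * s) = c * Hab a b s := by
  rcases le_total 0 s with h | h
  · rw [Hab_of_nonneg h, Hab_of_nonneg (mul_nonneg hc h)]; ring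
  · rw [Hab_of_nonpos h, Hab_of_nonpos (mul_nonpos_of_nonneg_of_nonpos hc h)]; ring

lemma continuous_Hab (a b : ℝ) : Continuous (Hab a b) := by
  unfold Hab
  fun_prop

lemma Hab_neg (a b s : ℝ) : Hab a b (-s) = Hab b a s := by
  unfold Hab
  rw [neg_neg]; ring

lemma memLp_Hab {p T : ℝ} {g : ℝ → ℝ} (ha : 0 ≤ a) (hb : 0 ≤ b)
    (hg : MemLp g (ENNReal.ofReal p) (volOn (-T) T)) :
    MemLp (fun x => Hab a b (g x)) (ENNReal.ofReal p) (volOn (-T) T) := by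
  refine hg.of_le_mul (c := a + b) ((continuous_Hab a b).comp_aestronglyMeasurable hg.1) ?_
  filter_upwards with x
  rw [Real.norm_of_nonneg (Hab_nonneg ha hb _)]
  exact Hab_le ha hb _

lemma integrable_rpow_of_memLp {p : ℝ} {μ : Measure ℝ} {f : ℝ → ℝ} (hp : 1 < p)
    (hf : MemLp f (ENNReal.ofReal p) μ) : Integrable (fun x => |f x| ^ p) μ := by
  have := hf.integrable_norm_rpow (by simpa using (by linarith : 0 < p)) ENNReal.ofReal_ne_top
  rwa [ENNReal.toReal_ofReal (by linarith)] at this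

lemma intervalIntegrable_Hab_rpow {p T : ℝ} {g : ℝ → ℝ} (hp : 1 < p) (hT : 0 < T) (ha : 0 ≤ a)
    (hb : 0 ≤ b) (hg : MemLp g (ENNReal.ofReal p) (volOn (-T) T)) :
    IntervalIntegrable (fun x => Hab a b (g x) ^ p) volume (-T) T := by
  rw [intervalIntegrable_iff_integrableOn_Ioo_of_le (by linarith)]
  have := integrable_rpow_of_memLp hp (memLp_Hab ha hb hg)
  simp only [abs_of_nonneg (Hab_nonneg ha hb _)] at this
  exact this

end Hab

/-! ### The calibration inequality -/

section calibration

variable {p : ℝ}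

/-- Young's inequality, as Bernoulli's inequality for 1 + x = s/y multiplied by y^p. Strict
Bernoulli for x ≠ 0 gives the equality case; y = 0 is treated apart. -/
lemma mul_rpow_le_rpow_add (hp : 1 < p) {s y : ℝ} (hs : 0 ≤ s) (hy : 0 ≤ y) :
    p * y ^ (p - 1) * s ≤ s ^ p + (p - 1) * y ^ p ∧
      (s ^ p + (p - 1) * y ^ p - p * y ^ (p - 1) * s = 0 → s = y) := by
  rcases hy.eq_or_lt with rfl | hy
  · rw [Real.zero_rpow (by linarith), Real.zero_rpow (by linarith)]
    refine ⟨by simp only [mul_zero, zero_mul, add_zero]; positivity, fun h => ?_⟩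
    simp only [mul_zero, zero_mul, add_zero, sub_zero] at h
    exact ((Real.rpow_eq_zero_iff_of_nonneg hs).mp h).1
  · have hyp : 0 < y ^ p := Real.rpow_pos_of_pos hy p
    have hx : -1 ≤ s / y - 1 := by
      have : 0 ≤ s / y := by positivity
      linarith
    have hsy : (1 + (s / y - 1)) ^ p = s ^ p / y ^ p := by
      rw [add_sub_cancel, Real.div_rpow hs hy.le]
    have hy1 : y ^ (p - 1) = y ^ p / y := Real.rpow_sub_one hy.ne' p
    have hid : p * y ^ (p - 1) * s - (p - 1) * y ^ p = (1 + p * (s / y - 1)) * y ^ p := by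
      rw [hy1]; field_simp; ring
    constructor
    · have h := one_add_mul_self_le_rpow_one_add hx hp.le
      rw [hsy, le_div_iff₀ hyp] at h
      linarith
    · intro h
      by_contra hne
      have hx0 : s / y - 1 ≠ 0 := by
        rw [sub_ne_zero, Ne, div_eq_one_iff_eq hy.ne']; exact hne
      have h' := one_add_mul_self_lt_rpow_one_add hx hx0 hp
      rw [hsy, lt_div_iff₀ hyp] at h'
      linarith

/-- The frequency `(a + b) π_p / (4T)` in terms of the quarter period. -/
def freq (p T a b : ℝ) : ℝ := (a + b) * quarter p / (2 * T)

lemma freq_pos (hp : 1 < p) {T a b : ℝ} (hT : 0 < T) (ha : 0 < a) (hb : 0 ≤ b) :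
    0 < freq p T a b := by
  have := quarter_pos hp
  unfold freq
  positivity

lemma slope_rpow_le_one (hp : 1 < p) (v : ℝ) : slope p v ^ (p - 1) ≤ 1 :=
  Real.rpow_le_one (slope_nonneg _ _) (slope_le_one hp v) (by linarith)

lemma slope_rpow_nonneg (p v : ℝ) : 0 ≤ slope p v ^ (p - 1) :=
  Real.rpow_nonneg (slope_nonneg _ _) _

lemma aesm_slope_rpow (hp : 1 < p) {μ : Measure ℝ} {u : ℝ → ℝ}
    (hu : AEStronglyMeasurable u μ) : AEStronglyMeasurable (fun x => slope p (u x) ^ (p - 1)) μ :=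
  (continuous_slope_rpow hp).comp_aestronglyMeasurable hu

lemma intervalIntegrable_slope_mul (hp : 1 < p) {T : ℝ} (hT : 0 < T) {u f : ℝ → ℝ}
    (hu : AEStronglyMeasurable u (volOn (-T) T))
    (hf : MemLp f (ENNReal.ofReal p) (volOn (-T) T)) :
    IntervalIntegrable (fun x => slope p (u x) ^ (p - 1) * f x) volume (-T) T := by
  rw [intervalIntegrable_iff_integrableOn_Ioo_of_le (by linarith)]
  refine (hf.integrable (one_le_ofReal hp)).bdd_mul (aesm_slope_rpow hp hu) (c := 1) ?_
  filter_upwards with x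
  rw [Real.norm_of_nonneg (slope_rpow_nonneg _ _)]
  exact slope_rpow_le_one hp _

lemma ae_volOn_of_Ioc {s t : ℝ} {P : ℝ → Prop} (h : ∀ᵐ x ∂(volume.restrict (Ioc s t)), P x) :
    ∀ᵐ x ∂(volOn s t), P x := ae_restrict_of_ae_restrict_of_subset Ioo_subset_Ioc_self h

lemma ae_Ioc_of_volOn {s t : ℝ} {P : ℝ → Prop} (h : ∀ᵐ x ∂(volOn s t), P x) :
    ∀ᵐ x ∂(volume.restrict (Ioc s t)), P x := by
  rwa [← restrict_Ioo_eq_restrict_Ioc]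

/-- The calibration argument: the anisotropic energy of a function with values in `[-1, 1]` that
climbs from `0` to `1` before `σ`, and descends from `1` to `0` after `σ` if `b > 0`. -/
lemma calibration (hp : 1 < p) {T a b σ : ℝ} (hT : 0 < T) (ha : 0 < a) (hb : 0 ≤ b)
    (hσ : σ ∈ Icc (-T) T) {u g : ℝ → ℝ} (hum : AEStronglyMeasurable u (volOn (-T) T))
    (hg : MemLp g (ENNReal.ofReal p) (volOn (-T) T)) (hu : ∀ᵐ x ∂(volOn (-T) T), |u x| ≤ 1)
    (hL : calib p 1 ≤ ∫ x in (-T)..σ, slope p (u x) ^ (p - 1) * g x)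
    (hR : b * calib p 1 ≤ -b * ∫ x in σ..T, slope p (u x) ^ (p - 1) * g x) :
    (p - 1) * freq p T a b ^ p * ∫ t in Ioo (-T) T, |u t| ^ p ≤ energy p T (Hab a b) g ∧
    (energy p T (Hab a b) g = (p - 1) * freq p T a b ^ p * ∫ t in Ioo (-T) T, |u t| ^ p →
      (∀ᵐ x ∂(volOn (-T) T), Hab a b (g x) = freq p T a b * slope p (u x)) ∧
      (∀ᵐ x ∂(volOn (-T) σ), slope p (u x) ^ (p - 1) * (Hab a b (g x) - a * g x) = 0) ∧
      (∀ᵐ x ∂(volOn σ T), slope p (u x) ^ (p - 1) * (Hab a b (g x) + b * g x) = 0) ∧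
      ∫ x in (-T)..σ, slope p (u x) ^ (p - 1) * g x = calib p 1) := by
  set k := freq p T a b with hk
  have hk0 : 0 < k := freq_pos hp hT ha hb
  have hTT : -T ≤ T := by linarith
  have hsubL : ∀ {f : ℝ → ℝ}, IntervalIntegrable f volume (-T) T →
      IntervalIntegrable f volume (-T) σ := fun hf => hf.mono_set (by
    rw [uIcc_of_le hTT, uIcc_of_le hσ.1]; exact Icc_subset_Icc le_rfl hσ.2)
  have hsubR : ∀ {f : ℝ → ℝ}, IntervalIntegrable f volume (-T) T →
      IntervalIntegrable f volume σ T := fun hf => hf.mono_set (by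
    rw [uIcc_of_le hTT, uIcc_of_le hσ.2]; exact Icc_subset_Icc hσ.1 le_rfl)
  set H : ℝ → ℝ := fun x => Hab a b (g x) with hH
  have hH0 : ∀ x, 0 ≤ H x := fun x => Hab_nonneg ha.le hb _
  have hHm := memLp_Hab ha.le hb hg
  have iHp := intervalIntegrable_Hab_rpow hp hT ha.le hb hg
  have iup : IntervalIntegrable (fun x => |u x| ^ p) volume (-T) T := by
    rw [intervalIntegrable_iff_integrableOn_Ioo_of_le hTT]
    refine Integrable.of_bound ((continuous_abs.rpow_const fun _ =>
      Or.inr (by linarith)).comp_aestronglyMeasurable hum) 1 ?_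
    filter_upwards [hu] with x hx
    rw [Real.norm_of_nonneg (by positivity)]
    exact Real.rpow_le_one (abs_nonneg _) hx (by linarith)
  set P : ℝ → ℝ := fun x => slope p (u x) ^ (p - 1) with hP
  have iPg : IntervalIntegrable (fun x => P x * g x) volume (-T) T :=
    intervalIntegrable_slope_mul hp hT hum hg
  have iPH : IntervalIntegrable (fun x => P x * H x) volume (-T) T :=
    intervalIntegrable_slope_mul hp hT hum hHm
  -- The pointwise Young deficit for y = k `slope p (u x)`, with y^p already expanded as k^p(1 -
  -- |u|^p).
  set D : ℝ → ℝ := fun x => H x ^ p + ((p - 1) * k ^ p - (p - 1) * k ^ p * |u x| ^ p)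
    - p * k ^ (p - 1) * (P x * H x) with hD
  have hDeq : ∀ᵐ x ∂(volOn (-T) T), D x = H x ^ p + (p - 1) * (k * slope p (u x)) ^ p
      - p * (k * slope p (u x)) ^ (p - 1) * H x := by
    filter_upwards [hu] with x hx
    rw [hD, Real.mul_rpow hk0.le (slope_nonneg _ _), Real.mul_rpow hk0.le (slope_nonneg _ _),
      slope_rpow hp hx]
    ring
  have hD0 : ∀ᵐ x ∂(volume.restrict (Ioc (-T) T)), 0 ≤ D x := ae_Ioc_of_volOn (by
    filter_upwards [hDeq] with x hx
    rw [hx]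
    have := (mul_rpow_le_rpow_add hp (hH0 x)
      (mul_nonneg hk0.le (slope_nonneg p (u x)))).1
    linarith)
  have iup' := ((intervalIntegrable_const (μ := volume) (a := -T) (b := T)
    (c := (p - 1) * k ^ p)).sub (iup.const_mul ((p - 1) * k ^ p)))
  have iD : IntervalIntegrable D volume (-T) T :=
    (iHp.add iup').sub (iPH.const_mul (p * k ^ (p - 1)))
  have hDint : ∫ x in (-T)..T, D x = (∫ x in (-T)..T, H x ^ p)
      + ((p - 1) * k ^ p * (2 * T) - (p - 1) * k ^ p * ∫ x in (-T)..T, |u x| ^ p)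
      - p * k ^ (p - 1) * ∫ x in (-T)..T, P x * H x := by
    rw [hD, intervalIntegral.integral_sub (iHp.add iup') (iPH.const_mul _),
      intervalIntegral.integral_add iHp iup', intervalIntegral.integral_sub
      intervalIntegrable_const (iup.const_mul _),
      intervalIntegral.integral_const_mul ((p - 1) * k ^ p) fun x => |u x| ^ p,
      intervalIntegral.integral_const_mul (p * k ^ (p - 1)) fun x => P x * H x,
      intervalIntegral.integral_const, smul_eq_mul]
    ring
  -- The other two deficits: H lies above the line a s, used where u climbs, and above the line -b
  -- s, used where u descends.
  have hE1 : ∀ x, 0 ≤ P x * (H x - a * g x) := fun x =>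
    mul_nonneg (slope_rpow_nonneg _ _) (by have := mul_le_Hab ha.le hb (g x); linarith)
  have hE2 : ∀ x, 0 ≤ P x * (H x + b * g x) := fun x =>
    mul_nonneg (slope_rpow_nonneg _ _) (by have := neg_mul_le_Hab ha.le hb (g x); linarith)
  have iE1 : IntervalIntegrable (fun x => P x * (H x - a * g x)) volume (-T) σ := by
    refine ((hsubL iPH).sub ((hsubL iPg).const_mul a)).congr fun x _ => ?_
    simp only [hP, hH]; ring
  have iE2 : IntervalIntegrable (fun x => P x * (H x + b * g x)) volume σ T := by
    refine ((hsubR iPH).add ((hsubR iPg).const_mul b)).congr fun x _ => ?_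
    simp only [hP, hH]; ring
  have hE1int : ∫ x in (-T)..σ, P x * (H x - a * g x)
      = (∫ x in (-T)..σ, P x * H x) - a * ∫ x in (-T)..σ, P x * g x := by
    rw [← intervalIntegral.integral_const_mul, ← intervalIntegral.integral_sub (hsubL iPH)
      ((hsubL iPg).const_mul a)]
    refine intervalIntegral.integral_congr fun x _ => ?_
    simp only [hP, hH]; ring
  have hE2int : ∫ x in σ..T, P x * (H x + b * g x)
      = (∫ x in σ..T, P x * H x) + b * ∫ x in σ..T, P x * g x := by
    rw [← intervalIntegral.integral_const_mul, ← intervalIntegral.integral_add (hsubR iPH)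
      ((hsubR iPg).const_mul b)]
    refine intervalIntegral.integral_congr fun x _ => ?_
    simp only [hP, hH]; ring
  have hsplit := intervalIntegral.integral_add_adjacent_intervals (hsubL iPH) (hsubR iPH)
  have nD : 0 ≤ ∫ x in (-T)..T, D x := intervalIntegral.integral_nonneg_of_ae_restrict hTT (by
    rw [← restrict_Ioc_eq_restrict_Icc]; exact hD0)
  have nE1 : 0 ≤ ∫ x in (-T)..σ, P x * (H x - a * g x) :=
    intervalIntegral.integral_nonneg hσ.1 fun x _ => hE1 x
  have nE2 : 0 ≤ ∫ x in σ..T, P x * (H x + b * g x) :=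
    intervalIntegral.integral_nonneg hσ.2 fun x _ => hE2 x
  have hkk : k ^ (p - 1) * k = k ^ p := rpow_sub_one_mul_self hp hk0.le
  have hc0 : 0 < p * k ^ (p - 1) := mul_pos (by linarith) (Real.rpow_pos_of_pos hk0 _)
  -- This identity dictates the value of k: the guaranteed total variation of the calibration
  -- balances the constant produced by Young's inequality on an interval of length 2T.
  have hconst : p * k ^ (p - 1) * ((a + b) * calib p 1) = (p - 1) * k ^ p * (2 * T) := by
    have hkT : k * (2 * T) = (a + b) * quarter p := by
      rw [hk, freq]; field_simp
    rw [calib_one hp, ← hkk]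
    have hpp : p * ((p - 1) / p) = p - 1 := by field_simp
    linear_combination (-(p - 1) * (k ^ (p - 1))) * hkT + k ^ (p - 1) * (a + b) * quarter p * hpp
  have hen : energy p T (Hab a b) g = ∫ x in (-T)..T, H x ^ p := setIntegral_Ioo_eq hTT _
  rw [hen, setIntegral_Ioo_eq hTT]
  -- The energy gap is an exact sum of non-negative deficits. Its sign gives the inequality, and its
  -- vanishing makes each deficit vanish.
  have main : (∫ x in (-T)..T, H x ^ p) - (p - 1) * k ^ p * ∫ x in (-T)..T, |u x| ^ p
      = (∫ x in (-T)..T, D x) + p * k ^ (p - 1) * ((∫ x in (-T)..σ, P x * (H x - a * g x))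
        + (∫ x in σ..T, P x * (H x + b * g x))
        + a * ((∫ x in (-T)..σ, P x * g x) - calib p 1)
        + (-b * (∫ x in σ..T, P x * g x) - b * calib p 1)) := by
    rw [hDint, hE1int, hE2int]
    linear_combination hconst - p * k ^ (p - 1) * hsplit
  have nA : 0 ≤ a * ((∫ x in (-T)..σ, P x * g x) - calib p 1) :=
    mul_nonneg ha.le (by linarith)
  have nB : 0 ≤ -b * (∫ x in σ..T, P x * g x) - b * calib p 1 := by linarith
  refine ⟨?_, fun heq => ?_⟩
  · have : 0 ≤ p * k ^ (p - 1) * ((∫ x in (-T)..σ, P x * (H x - a * g x))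
        + (∫ x in σ..T, P x * (H x + b * g x))
        + a * ((∫ x in (-T)..σ, P x * g x) - calib p 1)
        + (-b * (∫ x in σ..T, P x * g x) - b * calib p 1)) := by positivity
    linarith
  · rw [heq, sub_self] at main
    have h1 : 0 ≤ (∫ x in (-T)..σ, P x * (H x - a * g x))
        + (∫ x in σ..T, P x * (H x + b * g x))
        + a * ((∫ x in (-T)..σ, P x * g x) - calib p 1)
        + (-b * (∫ x in σ..T, P x * g x) - b * calib p 1) := by positivity
    have h2 := mul_nonneg hc0.le h1
    have zD : ∫ x in (-T)..T, D x = 0 := by linarith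
    have z1 := (mul_eq_zero.mp (le_antisymm (by linarith) h2)).resolve_left hc0.ne'
    have zE1 : ∫ x in (-T)..σ, P x * (H x - a * g x) = 0 := by linarith
    have zE2 : ∫ x in σ..T, P x * (H x + b * g x) = 0 := by linarith
    have zA : a * ((∫ x in (-T)..σ, P x * g x) - calib p 1) = 0 := by linarith
    rw [intervalIntegral.integral_eq_zero_iff_of_le_of_nonneg_ae hTT hD0 iD] at zD
    rw [intervalIntegral.integral_eq_zero_iff_of_le_of_nonneg_ae hσ.1 (ae_of_all _ hE1) iE1] at zE1
    rw [intervalIntegral.integral_eq_zero_iff_of_le_of_nonneg_ae hσ.2 (ae_of_all _ hE2) iE2] at zE2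
    refine ⟨?_, ae_volOn_of_Ioc zE1, ae_volOn_of_Ioc zE2, ?_⟩
    · filter_upwards [hDeq, ae_volOn_of_Ioc zD] with x hx hx0
      exact (mul_rpow_le_rpow_add hp (hH0 x)
        (mul_nonneg hk0.le (slope_nonneg p (u x)))).2 (by rw [← hx]; exact hx0)
    · have := (mul_eq_zero.mp zA).resolve_left ha.ne'
      linarith

end calibration

end

section

/-! ### Uniqueness of the profile -/

section profile

variable {p : ℝ}

lemma IsPrimitiveOn.hasDerivAt {s t : ℝ} {w g : ℝ → ℝ} (h : IsPrimitiveOn s t w g)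
    (hg : ContinuousOn g (Icc s t)) {x : ℝ} (hx : x ∈ Ioo s t) : HasDerivAt w (g x) x := by
  have hs : s ∈ Icc s t := ⟨le_rfl, (hx.1.trans hx.2).le⟩
  have hgx : ContinuousOn g (Ioo s t) := hg.mono Ioo_subset_Icc_self
  have h1 := (intervalIntegral.integral_hasDerivAt_right
    (h.integrable_sub hs (Ioo_subset_Icc_self hx))
    (hgx.stronglyMeasurableAtFilter isOpen_Ioo x hx)
    (hgx.continuousAt (Ioo_mem_nhds hx.1 hx.2))).const_add (w s)
  refine h1.congr_of_eventuallyEq ?_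
  filter_upwards [Ioo_mem_nhds hx.1 hx.2] with y hy
  exact h.eq y (Ioo_subset_Icc_self hy)

/-- Below the value 1 the function `arc p ∘ w` has constant derivative κ, which determines w. The
equation degenerates at the value 1, but w is non-decreasing and bounded by 1, so it stays there. -/
lemma gsin_eq_of_isPrimitiveOn (hp : 1 < p) {s t κ : ℝ} {w : ℝ → ℝ} (hκ : 0 < κ)
    (h : IsPrimitiveOn s t w fun x => κ * slope p (w x)) (h0 : w s = 0)
    (h1 : ∀ x ∈ Icc s t, |w x| ≤ 1) {x : ℝ} (hx : x ∈ Icc s t) :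
    w x = gsin p (κ * (x - s)) := by
  have hs : s ∈ Icc s t := ⟨le_rfl, hx.1.trans hx.2⟩
  have hmono : ∀ y ∈ Icc s t, ∀ z ∈ Icc s t, y ≤ z → w y ≤ w z := fun y hy z hz hyz => by
    have := h.sub_eq hy hz
    have h2 : 0 ≤ ∫ v in y..z, κ * slope p (w v) :=
      intervalIntegral.integral_nonneg hyz fun v _ => mul_nonneg hκ.le (slope_nonneg _ _)
    linarith
  have hlt : ∀ y ∈ Icc s t, w y < 1 → w y = gsin p (κ * (y - s)) := fun y hy hy1 => by
    have hsy : Icc s y ⊆ Icc s t := Icc_subset_Icc le_rfl hy.2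
    have habs : ∀ z ∈ Icc s y, |w z| < 1 := fun z hz => by
      have h2 := hmono z (hsy hz) y hy hz.2
      have h3 := hmono s hs z (hsy hz) hz.1
      rw [abs_lt]
      constructor <;> linarith
    have hder : ∀ z ∈ Ioo s y, HasDerivAt (fun v => arc p (w v)) κ z := fun z hz => by
      have h2 := (hasDerivAt_arc hp (habs z (Ioo_subset_Icc_self hz))).comp z
        (h.hasDerivAt (continuousOn_const.mul
          ((continuous_slope hp).comp_continuousOn h.continuousOn)) ⟨hz.1, hz.2.trans_le hy.2⟩)
      refine h2.congr_deriv ?_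
      have := (slope_pos hp (habs z (Ioo_subset_Icc_self hz))).ne'
      field_simp
    have h2 := integral_eq_of_hasDerivAt_off_countable_of_le (fun v => arc p (w v)) (fun _ => κ)
      hy.1 countable_empty ((continuous_arc hp).comp_continuousOn (h.continuousOn.mono hsy))
      (fun z hz => hder z hz.1) intervalIntegrable_const
    rw [h0, arc_zero, sub_zero, intervalIntegral.integral_const, smul_eq_mul, mul_comm] at h2
    rw [h2, gsin_arc hp (h1 y hy)]
  rcases lt_or_ge (w x) 1 with hw | hw
  · exact hlt x hx hw
  · have hw1 : w x = 1 := le_antisymm (abs_le.mp (h1 x hx)).2 hw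
    refine le_antisymm ?_ (hw1 ▸ (abs_le.mp (abs_gsin_le p _)).2)
    rw [hw1]
    -- If the sine were still below 1 at x, then w would take the intermediate value (v+1)/2 > v at
    -- some earlier point, where it agrees with the sine and is therefore at most v.
    by_contra hv
    rw [not_le] at hv
    set v := gsin p (κ * (x - s)) with hvdef
    have hv0 : 0 ≤ v := by
      rw [hvdef, ← gsin_zero hp]
      exact monotone_gsin hp (mul_nonneg hκ.le (by linarith [hx.1]))
    have hc : ContinuousOn w (Icc s x) := h.continuousOn.mono (Icc_subset_Icc le_rfl hx.2)
    obtain ⟨y, hy, hwy⟩ := intermediate_value_Icc hx.1 hc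
      (show (v + 1) / 2 ∈ Icc (w s) (w x) by rw [h0, hw1]; constructor <;> linarith)
    have h2 := hlt y ⟨hy.1, hy.2.trans hx.2⟩ (by rw [hwy]; linarith)
    have h3 : gsin p (κ * (y - s)) ≤ v :=
      monotone_gsin hp (mul_le_mul_of_nonneg_left (by linarith [hy.2]) hκ.le)
    linarith

/-- The derivative of a primitive vanishes almost everywhere where the primitive is extremal. -/
lemma IsPrimitiveOn.ae_eq_zero_of_abs_eq_one {s t : ℝ} {w g : ℝ → ℝ} (h : IsPrimitiveOn s t w g)
    (h1 : ∀ x ∈ Icc s t, |w x| ≤ 1) : ∀ᵐ x, x ∈ Ioo s t → |w x| = 1 → g x = 0 := by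
  filter_upwards [h.ae_hasDerivAt] with x hx hxm hx1
  have hnhds : ∀ᶠ y in 𝓝 x, |w y| ≤ 1 := by
    filter_upwards [Ioo_mem_nhds hxm.1 hxm.2] with y hy using h1 y (Ioo_subset_Icc_self hy)
  rcases eq_or_eq_neg_of_abs_eq hx1 with he | he
  · have hm : IsLocalMax w x := by
      filter_upwards [hnhds] with y hy
      rw [he]; exact (abs_le.mp hy).2
    exact hm.hasDerivAt_eq_zero (hx hxm)
  · have hm : IsLocalMin w x := by
      filter_upwards [hnhds] with y hy
      rw [he]; exact (abs_le.mp hy).1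
    exact hm.hasDerivAt_eq_zero (hx hxm)

/-- The increasing part of the extremal profile. -/
def risingPart (p T t₀ t : ℝ) : ℝ := gsin p (quarter p * (T + t) / (T + t₀))

/-- The decreasing part of the extremal profile. -/
def fallingPart (p T t₀ t : ℝ) : ℝ :=
  -- For t₀ = T the quotient has denominator 0 and evaluates to 0, so the sine would be 0 instead of
  -- the saturated value 1. There is no descent in this case, which occurs for b = 0.
  if t₀ = T then 1 else gsin p (quarter p * (T - t) / (T - t₀))

/-- The extremal profile with maximum `1` attained at `t₀`. -/
def profile (p T t₀ t : ℝ) : ℝ := risingPart p T t₀ t + fallingPart p T t₀ t - 1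

/-- Each part saturates at 1 on the far side of t₀, so only one of them is active on either side.
The sum minus 1 is thus a C¹ profile with no gluing condition to check. -/
lemma risingPart_of_le (hp : 1 < p) {T t₀ t : ℝ} (h : -T < t₀) (ht : t₀ ≤ t) :
    risingPart p T t₀ t = 1 := by
  apply gsin_of_quarter_le hp
  rw [le_div_iff₀ (by linarith)]
  exact mul_le_mul_of_nonneg_left (by linarith) (quarter_pos hp).le

lemma fallingPart_of_le (hp : 1 < p) {T t₀ t : ℝ} (h : t₀ ≤ T) (ht : t ≤ t₀) :
    fallingPart p T t₀ t = 1 := by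
  unfold fallingPart
  split_ifs with h1
  · rfl
  · have : t₀ < T := lt_of_le_of_ne h h1
    apply gsin_of_quarter_le hp
    rw [le_div_iff₀ (by linarith)]
    exact mul_le_mul_of_nonneg_left (by linarith) (quarter_pos hp).le

lemma profile_of_le (hp : 1 < p) {T t₀ t : ℝ} (h : t₀ ≤ T) (ht : t ≤ t₀) :
    profile p T t₀ t = gsin p (quarter p * (T + t) / (T + t₀)) := by
  rw [profile, fallingPart_of_le hp h ht, risingPart]; ring

lemma profile_of_ge (hp : 1 < p) {T t₀ t : ℝ} (h : -T < t₀) (h1 : t₀ < T) (ht : t₀ ≤ t) :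
    profile p T t₀ t = gsin p (quarter p * (T - t) / (T - t₀)) := by
  rw [profile, risingPart_of_le hp h ht, fallingPart, if_neg h1.ne]; ring

lemma T_add_junction {T a b : ℝ} (ha : 0 < a) (hb : 0 ≤ b) :
    T + junction T a b = 2 * a * T / (a + b) := by
  unfold junction
  have : a + b ≠ 0 := by positivity
  field_simp; ring

lemma T_sub_junction {T a b : ℝ} (ha : 0 < a) (hb : 0 ≤ b) :
    T - junction T a b = 2 * b * T / (a + b) := by
  unfold junction
  have : a + b ≠ 0 := by positivity
  field_simp; ring

lemma neg_lt_junction {T a b : ℝ} (hT : 0 < T) (ha : 0 < a) (hb : 0 ≤ b) :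
    -T < junction T a b := by
  have h : 0 < 2 * a * T / (a + b) := by positivity
  linarith [T_add_junction (T := T) ha hb]

lemma junction_le {T a b : ℝ} (hT : 0 < T) (ha : 0 < a) (hb : 0 ≤ b) :
    junction T a b ≤ T := by
  have h : 0 ≤ 2 * b * T / (a + b) := by positivity
  linarith [T_sub_junction (T := T) ha hb]

lemma junction_lt {T a b : ℝ} (hT : 0 < T) (ha : 0 < a) (hb : 0 < b) :
    junction T a b < T := by
  have h : 0 < 2 * b * T / (a + b) := by positivity
  linarith [T_sub_junction (T := T) ha hb.le]

/-- At rate k/a the sine needs exactly the time T + t₀ to climb from 0 to 1; this is the origin of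
the junction point. -/
lemma freq_div_left {T a b : ℝ} (hT : 0 < T) (ha : 0 < a) (hb : 0 ≤ b) :
    freq p T a b / a = quarter p / (T + junction T a b) := by
  rw [T_add_junction ha hb, freq]
  have : a + b ≠ 0 := by positivity
  field_simp

lemma freq_div_right {T a b : ℝ} (hT : 0 < T) (ha : 0 < a) (hb : 0 < b) :
    freq p T a b / b = quarter p / (T - junction T a b) := by
  rw [T_sub_junction ha hb.le, freq]
  have : a + b ≠ 0 := by positivity
  field_simp

/-- The rising branch of a function attaining equality in the calibration argument. -/
lemma eq_gsin_of_calibrated (hp : 1 < p) {s σ a b k : ℝ} (ha : 0 < a) (hk : 0 < k)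
    {w g : ℝ → ℝ} (hsσ : s ≤ σ) (hw : IsPrimitiveOn s σ w g) (h0 : w s = 0) (h1 : w σ = 1)
    (hw1 : ∀ x ∈ Icc s σ, |w x| ≤ 1)
    (hH : ∀ᵐ x ∂(volOn s σ), Hab a b (g x) = k * slope p (w x))
    (hP : ∀ᵐ x ∂(volOn s σ), slope p (w x) ^ (p - 1) * (Hab a b (g x) - a * g x) = 0) :
    (∀ x ∈ Icc s σ, w x = gsin p (k / a * (x - s))) ∧ quarter p ≤ k / a * (σ - s) := by
  rw [ae_volOn_iff] at hH hP
  have hg : ∀ᵐ x, x ∈ Ioo s σ → g x = k / a * slope p (w x) := by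
    -- Where the slope is non-zero, P can be cancelled and g is determined. Where it is zero, |w| =
    -- 1 is extremal and g vanishes almost everywhere.
    filter_upwards [hH, hP, hw.ae_eq_zero_of_abs_eq_one hw1] with x h1 h2 h3 hx
    by_cases hs : slope p (w x) = 0
    · have : |w x| = 1 := by
        refine le_antisymm (hw1 x (Ioo_subset_Icc_self hx)) (not_lt.mp fun hlt => ?_)
        exact (slope_pos hp hlt).ne' hs
      rw [h3 hx this, hs, mul_zero]
    · have h4 : slope p (w x) ^ (p - 1) ≠ 0 :=
        (Real.rpow_pos_of_pos (lt_of_le_of_ne (slope_nonneg _ _) (Ne.symm hs)) _).ne'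
      have h5 := (mul_eq_zero.mp (h2 hx)).resolve_left h4
      rw [h1 hx] at h5
      field_simp
      linarith
  have hsin : ∀ x ∈ Icc s σ, w x = gsin p (k / a * (x - s)) := fun x hx =>
    gsin_eq_of_isPrimitiveOn hp (by positivity) (hw.congr_ae hsσ hg) h0 hw1 hx
  refine ⟨hsin, ?_⟩
  -- Before a full quarter period the sine is strictly below 1, contrary to w σ = 1.
  by_contra hlt
  rw [not_le] at hlt
  have h2 : 0 ≤ k / a * (σ - s) := mul_nonneg (by positivity) (by linarith)
  have h3 := abs_gsin_lt hp (x := k / a * (σ - s)) (by rwa [abs_of_nonneg h2])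
  rw [← hsin σ ⟨hsσ, le_rfl⟩, h1] at h3
  simp at h3

end profile

end

section

/-! ### Piecewise primitives -/

lemma ae_volOn_of_pieces {τ : ℕ → ℝ} {P : ℝ → Prop} (n : ℕ)
    (hP : ∀ i < n, ∀ᵐ x ∂(volOn (τ i) (τ (i + 1))), P x) :
    ∀ᵐ x ∂(volOn (τ 0) (τ n)), P x := by
  induction n with
  | zero => simp
  | succ n ih =>
    have h1 := ih fun i hi => hP i (by omega)
    have h2 := hP n (by omega)
    rw [ae_volOn_iff] at h1 h2 ⊢
    filter_upwards [h1, h2, Measure.ae_ne volume (τ n)] with x hx1 hx2 hx3 hx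
    rcases lt_or_gt_of_ne hx3 with h | h
    · exact hx1 ⟨hx.1, h⟩
    · exact hx2 ⟨h, hx.2⟩

/-- `u` has the derivative `g` piecewise, jumps downwards, and `u(-T) ≤ 0 ≤ u(T)`. -/
structure IsPwPrimitive (T : ℝ) (m : ℕ) (τ : ℕ → ℝ) (w : ℕ → ℝ → ℝ) (u g : ℝ → ℝ) : Prop where
  left : τ 0 = -T
  right : τ (m + 1) = T
  lt : ∀ i ≤ m, τ i < τ (i + 1)
  prim : ∀ i ≤ m, IsPrimitiveOn (τ i) (τ (i + 1)) (w i) g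
  ae_eq : ∀ i ≤ m, ∀ᵐ x ∂(volOn (τ i) (τ (i + 1))), u x = w i x
  nonpos : w 0 (-T) ≤ 0
  nonneg : 0 ≤ w m T
  jump : ∀ i < m, w (i + 1) (τ (i + 1)) < w i (τ (i + 1))

namespace IsPwPrimitive

variable {p T : ℝ} {m : ℕ} {τ : ℕ → ℝ} {w : ℕ → ℝ → ℝ} {u g : ℝ → ℝ}

lemma mono (h : IsPwPrimitive T m τ w u g) {i j : ℕ} (hij : i ≤ j) (hj : j ≤ m + 1) :
    τ i ≤ τ j := by
  induction j, hij using Nat.le_induction with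
  | base => exact le_rfl
  | succ j hij ih => exact (ih (by omega)).trans (h.lt j (by omega)).le

lemma mem_Icc (h : IsPwPrimitive T m τ w u g) {j : ℕ} (hj : j ≤ m) {y : ℝ}
    (hy : y ∈ Icc (τ j) (τ (j + 1))) : y ∈ Icc (-T) T :=
  ⟨(h.left ▸ h.mono (Nat.zero_le j) (by omega)).trans hy.1,
    hy.2.trans (h.right ▸ h.mono (by omega) le_rfl)⟩

lemma ae_volOn (h : IsPwPrimitive T m τ w u g) {P : ℝ → Prop}
    (hP : ∀ i ≤ m, ∀ᵐ x ∂(volOn (τ i) (τ (i + 1))), P x) : ∀ᵐ x ∂(volOn (-T) T), P x := by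
  have := ae_volOn_of_pieces (m + 1) fun i hi => hP i (by omega)
  rwa [h.left, h.right] at this

lemma const_mul (h : IsPwPrimitive T m τ w u g) {c : ℝ} (hc : 0 < c) :
    IsPwPrimitive T m τ (fun i x => c * w i x) (fun x => c * u x) (fun x => c * g x) where
  left := h.left
  right := h.right
  lt := h.lt
  prim i hi := (h.prim i hi).const_mul c
  ae_eq i hi := by filter_upwards [h.ae_eq i hi] with x hx; rw [hx]
  nonpos := mul_nonpos_of_nonneg_of_nonpos hc.le h.nonpos
  nonneg := mul_nonneg hc.le h.nonneg
  jump i hi := mul_lt_mul_of_pos_left (h.jump i hi) hc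

lemma ae_volOn_comp_neg {s t : ℝ} {P : ℝ → Prop} (h : ∀ᵐ x ∂(volOn s t), P x) :
    ∀ᵐ x ∂(volOn (-t) (-s)), P (-x) := by
  rw [ae_volOn_iff] at h ⊢
  filter_upwards [(Measure.measurePreserving_neg (volume : Measure ℝ)).quasiMeasurePreserving.ae h]
    with x hx hxm
  exact hx ⟨by linarith [hxm.2], by linarith [hxm.1]⟩

/-- Reversing both time and sign preserves the derivative up to reflection, keeps jumps downward and
exchanges the two boundary conditions. It turns a minimum into a maximum without interchanging a and
b. -/
lemma reflect (h : IsPwPrimitive T m τ w u g) :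
    IsPwPrimitive T m (fun i => -τ (m + 1 - i)) (fun i x => -w (m - i) (-x))
      (fun x => -u (-x)) (fun x => g (-x)) where
  left := by simp [h.right]
  right := by simp [h.left]
  lt i hi := by
    have := h.lt (m - i) (by omega)
    rw [show m - i + 1 = m + 1 - i by omega] at this
    rw [show m + 1 - (i + 1) = m - i by omega]
    linarith
  prim i hi := by
    have := (h.prim (m - i) (by omega)).reflect (h.lt (m - i) (by omega)).le
    rw [show m - i + 1 = m + 1 - i by omega] at this
    rwa [show m + 1 - (i + 1) = m - i by omega]
  ae_eq i hi := by
    have := ae_volOn_comp_neg (h.ae_eq (m - i) (by omega))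
    rw [show m - i + 1 = m + 1 - i by omega] at this
    rw [show m + 1 - (i + 1) = m - i by omega]
    filter_upwards [this] with x hx
    rw [hx]
  nonpos := by simpa using h.nonneg
  nonneg := by simpa using h.nonpos
  jump i hi := by
    have := h.jump (m - (i + 1)) (by omega)
    rw [show m - (i + 1) + 1 = m - i by omega] at this
    rw [show m + 1 - (i + 1) = m - i by omega, neg_neg]
    linarith

/-- The climb of `calib p ∘ u` is bounded by the integral of its piecewise derivative, strictly so
across a jump. -/
lemma calib_sub_le (hp : 1 < p) (h : IsPwPrimitive T m τ w u g)
    (hi : IntervalIntegrable (fun x => slope p (u x) ^ (p - 1) * g x) volume (-T) T)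
    (hw : ∀ i ≤ m, ∀ x ∈ Icc (τ i) (τ (i + 1)), |w i x| ≤ 1) (j : ℕ) (hj : j ≤ m) :
    ∀ y ∈ Icc (τ j) (τ (j + 1)),
      calib p (w j y) - calib p (w 0 (-T)) ≤ ∫ x in (-T)..y, slope p (u x) ^ (p - 1) * g x ∧
      (calib p (w j y) - calib p (w 0 (-T)) = ∫ x in (-T)..y, slope p (u x) ^ (p - 1) * g x →
        j = 0) := by
  have hT : ∀ {x y : ℝ}, x ∈ Icc (-T) T → y ∈ Icc (-T) T →
      IntervalIntegrable (fun x => slope p (u x) ^ (p - 1) * g x) volume x y := fun hx hy =>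
    hi.mono_set (by
      rw [uIcc_of_le (hx.1.trans hx.2)]
      exact uIcc_subset_Icc hx hy)
  have piece : ∀ j ≤ m, ∀ y ∈ Icc (τ j) (τ (j + 1)),
      calib p (w j y) - calib p (w j (τ j)) = ∫ x in (τ j)..y, slope p (u x) ^ (p - 1) * g x := by
    intro j hj y hy
    rw [((h.prim j hj).comp (h.lt j hj).le (continuous_slope_rpow hp)
      (hasDerivAt_calib hp)).sub_eq ⟨le_rfl, (h.lt j hj).le⟩ hy]
    refine intervalIntegral.integral_congr_ae ?_
    have hae := h.ae_eq j hj
    rw [ae_volOn_iff] at hae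
    filter_upwards [hae, Measure.ae_ne volume (τ (j + 1))] with x hx hne hxm
    rw [uIoc_of_le hy.1] at hxm
    rw [hx ⟨hxm.1, lt_of_le_of_ne (hxm.2.trans hy.2) hne⟩]
  have hTm : -T ∈ Icc (-T) T := by
    have := h.mem_Icc (Nat.zero_le m) ⟨le_rfl, (h.lt 0 (Nat.zero_le m)).le⟩
    rwa [h.left] at this
  induction j with
  | zero =>
    intro y hy
    have := piece 0 hj y hy
    rw [h.left] at this
    exact ⟨this.le, fun _ => rfl⟩
  | succ j ih =>
    intro y hy
    have hτj : τ (j + 1) ∈ Icc (τ j) (τ (j + 1)) := ⟨(h.lt j (by omega)).le, le_rfl⟩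
    have hτj' : τ (j + 1) ∈ Icc (τ (j + 1)) (τ (j + 1 + 1)) := ⟨le_rfl, (h.lt (j + 1) hj).le⟩
    have h1 := (ih (by omega) _ hτj).1
    have h2 := piece (j + 1) hj y hy
    have h3 := intervalIntegral.integral_add_adjacent_intervals
      (hT hTm (h.mem_Icc (by omega) hτj)) (hT (h.mem_Icc (by omega) hτj) (h.mem_Icc hj hy))
    -- The calibration is strictly increasing, so a downward jump loses height that the integral of
    -- the piecewise derivative does not register; hence the strict inequality past the first piece.
    have h4 : calib p (w (j + 1) (τ (j + 1))) < calib p (w j (τ (j + 1))) :=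
      strictMonoOn_calib hp (abs_le.mp (hw (j + 1) hj _ hτj')) (abs_le.mp (hw j (by omega) _ hτj))
        (h.jump j (by omega))
    have h5 : calib p (w (j + 1) y) - calib p (w 0 (-T))
        < ∫ x in (-T)..y, slope p (u x) ^ (p - 1) * g x := by linarith
    exact ⟨h5.le, fun he => absurd he h5.ne⟩

lemma ae_abs_le (h : IsPwPrimitive T m τ w u g) {M : ℝ}
    (hw : ∀ i ≤ m, ∀ x ∈ Icc (τ i) (τ (i + 1)), |w i x| ≤ M) :
    ∀ᵐ x ∂(volOn (-T) T), |u x| ≤ M := by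
  refine h.ae_volOn fun i hi => ?_
  filter_upwards [h.ae_eq i hi, ae_restrict_mem measurableSet_Ioo] with x hx hxm
  rw [hx]; exact hw i hi x (Ioo_subset_Icc_self hxm)

/-- The Poincaré inequality and its equality case for functions with maximum modulus `1` attained
at a positive value. -/
lemma poincare_of_max_one (hp : 1 < p) (hT : 0 < T) {a b : ℝ} (ha : 0 < a) (hb : 0 ≤ b)
    (h : IsPwPrimitive T m τ w u g) (hz : 0 < b → m = 0 ∧ w 0 (-T) = 0 ∧ w 0 T = 0)
    (hum : AEStronglyMeasurable u (volOn (-T) T)) (hg : MemLp g (ENNReal.ofReal p) (volOn (-T) T))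
    (hw : ∀ i ≤ m, ∀ x ∈ Icc (τ i) (τ (i + 1)), |w i x| ≤ 1) {j : ℕ} (hj : j ≤ m) {σ : ℝ}
    (hσ : σ ∈ Icc (τ j) (τ (j + 1))) (hwσ : w j σ = 1) :
    (p - 1) * freq p T a b ^ p * ∫ t in Ioo (-T) T, |u t| ^ p ≤ energy p T (Hab a b) g ∧
    (energy p T (Hab a b) g = (p - 1) * freq p T a b ^ p * ∫ t in Ioo (-T) T, |u t| ^ p →
      ∀ᵐ x ∂(volOn (-T) T), u x = profile p T (junction T a b) x) := by
  have hi := intervalIntegrable_slope_mul hp hT hum hg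
  have hTT : -T ≤ T := by linarith
  have hσT := h.mem_Icc hj hσ
  obtain ⟨hL, hL'⟩ := h.calib_sub_le hp hi hw j hj σ hσ
  have h0mem : -T ∈ Icc (τ 0) (τ (0 + 1)) := ⟨h.left.le, h.left ▸ (h.lt 0 (Nat.zero_le m)).le⟩
  have hw0 := abs_le.mp (hw 0 (Nat.zero_le m) (-T) h0mem)
  have hcal0 : calib p (w 0 (-T)) ≤ 0 := by
    rw [← calib_zero (p := p)]
    exact (strictMonoOn_calib hp).monotoneOn hw0 ⟨by norm_num, by norm_num⟩ h.nonpos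
  rw [hwσ] at hL hL'
  -- For b = 0 there is nothing to prove. For b > 0 there is a single piece, with value 0 at T, so
  -- the descent is computed exactly.
  have hR : b * calib p 1 ≤ -b * ∫ x in σ..T, slope p (u x) ^ (p - 1) * g x := by
    rcases hb.eq_or_lt with rfl | hb
    · simp
    · obtain ⟨rfl, hz0, hz1⟩ := hz hb
      obtain rfl : j = 0 := by omega
      have hprim := (h.prim 0 le_rfl).comp (h.lt 0 le_rfl).le (continuous_slope_rpow hp)
        (hasDerivAt_calib hp)
      have h2 := hprim.sub_eq hσ (y := T) ⟨h.left.le.trans hTT, h.right.ge⟩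
      have h3 : ∫ x in σ..T, slope p (u x) ^ (p - 1) * g x
          = ∫ x in σ..T, slope p (w 0 x) ^ (p - 1) * g x := by
        refine intervalIntegral.integral_congr_ae ?_
        have hae := h.ae_eq 0 le_rfl
        rw [h.left, zero_add, ← zero_add 1, h.right, ae_volOn_iff] at hae
        filter_upwards [hae, Measure.ae_ne volume T] with x hx hne hxm
        rw [uIoc_of_le hσT.2] at hxm
        rw [hx ⟨hσT.1.trans_lt hxm.1, lt_of_le_of_ne hxm.2 hne⟩]
      rw [h3, ← h2, hz1, hwσ, calib_zero]
      linarith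
  obtain ⟨hineq, heq⟩ := calibration hp hT ha hb hσT hum hg (h.ae_abs_le hw)
    (by linarith) hR
  refine ⟨hineq, fun he => ?_⟩
  obtain ⟨e1, e2, e3, e4⟩ := heq he
  have hk := freq_pos hp hT ha hb
  -- Equality makes the climb equal to `calib p 1`. This leaves no room for a negative initial
  -- value, and then none for a jump before σ.
  have hcal0' : calib p (w 0 (-T)) = 0 := by linarith
  have hw00 : w 0 (-T) = 0 := by
    refine (strictMonoOn_calib hp).injOn hw0 ⟨by norm_num, by norm_num⟩ ?_
    rw [hcal0', calib_zero]
  obtain rfl : j = 0 := hL' (by linarith)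
  have hτ1 : τ (0 + 1) ≤ T := h.right ▸ h.mono (by omega) le_rfl
  have hprim0 := h.prim 0 (Nat.zero_le m)
  have hae0 := h.ae_eq 0 (Nat.zero_le m)
  have hw1 := hw 0 (Nat.zero_le m)
  rw [h.left] at hprim0 hae0 hσ hw1
  have restr : ∀ {P : ℝ → Prop} {s t s' t' : ℝ}, s ≤ s' → t' ≤ t →
      (∀ᵐ x ∂(volOn s t), P x) → ∀ᵐ x ∂(volOn s' t'), P x := fun hs ht hP =>
    ae_restrict_of_ae_restrict_of_subset (Ioo_subset_Ioo hs ht) hP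
  have hr := eq_gsin_of_calibrated hp ha (b := b) hk hσT.1
    (hprim0.mono ⟨le_rfl, hσ.1.trans hσ.2⟩ hσ) hw00 hwσ
    (fun x hx => hw1 x ⟨hx.1, hx.2.trans hσ.2⟩) (by
      filter_upwards [restr le_rfl hσT.2 e1, restr le_rfl hσ.2 hae0] with x h1 h2
      rw [h1, h2]) (by
      filter_upwards [e2, restr le_rfl hσ.2 hae0] with x h1 h2
      rw [← h2, h1])
  obtain ⟨hr1, hr2⟩ := hr
  have hjT := neg_lt_junction hT ha hb
  have hjT' := junction_le hT ha hb
  rw [freq_div_left hT ha hb] at hr1 hr2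
  rw [sub_neg_eq_add, div_mul_eq_mul_div, le_div_iff₀ (by linarith)] at hr2
  -- The interval before σ must contain a full quarter period at rate k/a.
  have hσj : junction T a b ≤ σ := by
    have := le_of_mul_le_mul_left hr2 (quarter_pos hp)
    linarith
  -- For b = 0 the junction is T, so σ = T: the first piece is the whole interval and no jump
  -- remains.
  rcases hb.eq_or_lt with rfl | hb
  · have hj0 : junction T a 0 = T := by
      have := T_sub_junction (T := T) ha le_rfl
      simp only [mul_zero, zero_mul, zero_div] at this
      linarith
    have hσe : σ = T := le_antisymm hσT.2 (hj0 ▸ hσj)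
    have hτT : τ (0 + 1) = T := le_antisymm hτ1 (hσe ▸ hσ.2)
    rw [hτT] at hae0
    filter_upwards [hae0, ae_restrict_mem measurableSet_Ioo] with x hx hxm
    rw [hx, hr1 x ⟨hxm.1.le, hσe ▸ hxm.2.le⟩, profile_of_le hp hjT' (by rw [hj0]; exact hxm.2.le)]
    congr 1
    ring
  · obtain ⟨rfl, hz0, hz1⟩ := hz hb
    have hτT : τ (0 + 1) = T := h.right
    rw [hτT] at hae0 hprim0 hσ hw1
    -- Reversing time turns the descent after σ into an ascent from 0 to 1 with a and b exchanged,
    -- so the same rigidity statement yields the opposite bound on σ.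
    have hprimR : IsPrimitiveOn (-T) (-σ) (fun x => w 0 (-x)) (fun x => -g (-x)) := by
      have := ((hprim0.mono hσT ⟨hTT, le_rfl⟩).reflect hσT.2).const_mul (-1)
      simpa using this
    have hl := eq_gsin_of_calibrated hp hb (b := a) hk (by linarith [hσT.2] : -T ≤ -σ)
      hprimR (by simpa using hz1) (by simpa using hwσ)
      (fun x hx => hw1 (-x) ⟨by linarith [hx.2, hσT.1], by linarith [hx.1]⟩) (by
        filter_upwards [ae_volOn_comp_neg (restr hσT.1 le_rfl e1),
          ae_volOn_comp_neg (restr hσT.1 le_rfl hae0)] with x h1 h2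
        rw [Hab_neg, h1, h2]) (by
        filter_upwards [ae_volOn_comp_neg e3,
          ae_volOn_comp_neg (restr hσT.1 le_rfl hae0)] with x h1 h2
        rw [Hab_neg, ← h2, ← h1]
        ring)
    obtain ⟨hl1, hl2⟩ := hl
    have hjlt := junction_lt hT ha hb
    rw [freq_div_right hT ha hb] at hl1 hl2
    rw [sub_neg_eq_add, div_mul_eq_mul_div, le_div_iff₀ (by linarith)] at hl2
    have hσj' : σ ≤ junction T a b := by
      have := le_of_mul_le_mul_left hl2 (quarter_pos hp)
      linarith
    have hσe : σ = junction T a b := le_antisymm hσj' hσj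
    filter_upwards [hae0, ae_restrict_mem measurableSet_Ioo] with x hx hxm
    rw [hx]
    rcases le_total x σ with hxσ | hxσ
    · rw [hr1 x ⟨hxm.1.le, hxσ⟩, profile_of_le hp hjT' (hσe ▸ hxσ)]
      congr 1
      ring
    · have := hl1 (-x) ⟨by linarith [hxm.2], by linarith⟩
      rw [neg_neg] at this
      rw [this, profile_of_ge hp hjT hjlt (hσe ▸ hxσ)]
      congr 1
      ring

end IsPwPrimitive

end

section

/-! ### The asymmetric Poincaré inequality -/

lemma measurePreserving_neg_Ioo (T : ℝ) :
    MeasurePreserving (fun x : ℝ => -x) (volOn (-T) T) (volOn (-T) T) := by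
  have h := (Measure.measurePreserving_neg (volume : Measure ℝ)).restrict_preimage
    (measurableSet_Ioo (a := -T) (b := T))
  have hs : Neg.neg ⁻¹' Ioo (-T) T = Ioo (-T) T := by
    ext x
    simp only [mem_preimage, mem_Ioo]
    constructor <;> rintro ⟨h1, h2⟩ <;> constructor <;> linarith
  rwa [hs] at h

lemma setIntegral_comp_neg (T : ℝ) (f : ℝ → ℝ) :
    ∫ x in Ioo (-T) T, f (-x) = ∫ x in Ioo (-T) T, f x :=
  (measurePreserving_neg_Ioo T).integral_comp (MeasurableEquiv.neg ℝ).measurableEmbedding f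

lemma energy_comp_neg (p T : ℝ) (H g : ℝ → ℝ) :
    energy p T H (fun x => g (-x)) = energy p T H g :=
  setIntegral_comp_neg T fun x => H (g x) ^ p

lemma energy_const_mul {p T a b c : ℝ} (ha : 0 ≤ a) (hb : 0 ≤ b) (hc : 0 ≤ c) (g : ℝ → ℝ) :
    energy p T (Hab a b) (fun x => c * g x) = c ^ p * energy p T (Hab a b) g := by
  unfold energy
  rw [← integral_const_mul]
  refine integral_congr_ae (ae_of_all _ fun x => ?_)
  simp only [Hab_mul hc, Real.mul_rpow hc (Hab_nonneg ha hb _)]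

lemma integral_abs_rpow_const_mul {p T c : ℝ} (hc : 0 ≤ c) (u : ℝ → ℝ) :
    ∫ x in Ioo (-T) T, |c * u x| ^ p = c ^ p * ∫ x in Ioo (-T) T, |u x| ^ p := by
  rw [← integral_const_mul]
  refine integral_congr_ae (ae_of_all _ fun x => ?_)
  simp only [abs_mul, abs_of_nonneg hc, Real.mul_rpow hc (abs_nonneg _)]

lemma energy_nonneg {p T a b : ℝ} (ha : 0 ≤ a) (hb : 0 ≤ b) (g : ℝ → ℝ) :
    0 ≤ energy p T (Hab a b) g :=
  integral_nonneg fun _ => Real.rpow_nonneg (Hab_nonneg ha hb _) _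

namespace IsPwPrimitive

variable {p T : ℝ} {m : ℕ} {τ : ℕ → ℝ} {w : ℕ → ℝ → ℝ} {u g : ℝ → ℝ}

lemma exists_max (h : IsPwPrimitive T m τ w u g) :
    ∃ j ≤ m, ∃ σ ∈ Icc (τ j) (τ (j + 1)), ∀ i ≤ m, ∀ x ∈ Icc (τ i) (τ (i + 1)),
      |w i x| ≤ |w j σ| := by
  have hmax : ∀ i : ℕ, ∃ σ, i ≤ m → σ ∈ Icc (τ i) (τ (i + 1)) ∧
      ∀ x ∈ Icc (τ i) (τ (i + 1)), |w i x| ≤ |w i σ| := fun i => by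
    by_cases hi : i ≤ m
    · obtain ⟨σ, h1, h2⟩ := isCompact_Icc.exists_isMaxOn (nonempty_Icc.mpr (h.lt i hi).le)
        (h.prim i hi).continuousOn.abs
      exact ⟨σ, fun _ => ⟨h1, fun x hx => h2 hx⟩⟩
    · exact ⟨0, fun hi' => absurd hi' hi⟩
  choose σ hσ using hmax
  obtain ⟨j, hj, hjm⟩ := (Finset.range (m + 1)).exists_max_image (fun i => |w i (σ i)|)
    ⟨0, by simp⟩
  have hj' : j ≤ m := by simpa [Nat.lt_succ_iff] using hj
  refine ⟨j, hj', σ j, (hσ j hj').1, fun i hi x hx => ?_⟩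
  exact ((hσ i hi).2 x hx).trans (hjm i (by simpa [Nat.lt_succ_iff] using hi))

lemma poincare_of_max_pos (hp : 1 < p) (hT : 0 < T) {a b : ℝ} (ha : 0 < a) (hb : 0 ≤ b)
    (h : IsPwPrimitive T m τ w u g) (hz : 0 < b → m = 0 ∧ w 0 (-T) = 0 ∧ w 0 T = 0)
    (hum : AEStronglyMeasurable u (volOn (-T) T)) (hg : MemLp g (ENNReal.ofReal p) (volOn (-T) T))
    {j : ℕ} (hj : j ≤ m) {σ : ℝ} (hσ : σ ∈ Icc (τ j) (τ (j + 1))) (hpos : 0 < w j σ)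
    (hw : ∀ i ≤ m, ∀ x ∈ Icc (τ i) (τ (i + 1)), |w i x| ≤ w j σ) :
    (p - 1) * freq p T a b ^ p * ∫ t in Ioo (-T) T, |u t| ^ p ≤ energy p T (Hab a b) g ∧
    (energy p T (Hab a b) g = (p - 1) * freq p T a b ^ p * ∫ t in Ioo (-T) T, |u t| ^ p →
      ∀ᵐ x ∂(volOn (-T) T), u x = w j σ * profile p T (junction T a b) x) := by
  set M := w j σ with hM
  have hM' : 0 < M⁻¹ := inv_pos.mpr hpos
  have hMp : 0 < M⁻¹ ^ p := Real.rpow_pos_of_pos hM' p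
  obtain ⟨h1, h2⟩ := poincare_of_max_one hp hT ha hb (h.const_mul hM')
    (fun hb => by obtain ⟨h1, h2, h3⟩ := hz hb; simp [h1, h2, h3]) (hum.const_mul _)
    (hg.const_mul _) (fun i hi x hx => by
      rw [abs_mul, abs_of_pos hM', inv_mul_le_one₀ hpos]
      exact hw i hi x hx) hj hσ (inv_mul_cancel₀ hpos.ne')
  rw [energy_const_mul ha.le hb hM'.le, integral_abs_rpow_const_mul hM'.le] at h1 h2
  constructor
  · refine le_of_mul_le_mul_left ?_ hMp
    linarith
  · intro he
    filter_upwards [h2 (by rw [he]; ring)] with x hx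
    rw [← hx, mul_inv_cancel_left₀ hpos.ne']

lemma poincare (hp : 1 < p) (hT : 0 < T) {a b : ℝ} (ha : 0 < a) (hb : 0 ≤ b)
    (h : IsPwPrimitive T m τ w u g) (hz : 0 < b → m = 0 ∧ w 0 (-T) = 0 ∧ w 0 T = 0)
    (hum : AEStronglyMeasurable u (volOn (-T) T))
    (hg : MemLp g (ENNReal.ofReal p) (volOn (-T) T)) :
    (p - 1) * freq p T a b ^ p * ∫ t in Ioo (-T) T, |u t| ^ p ≤ energy p T (Hab a b) g ∧
    ((¬ ∀ᵐ x ∂(volOn (-T) T), u x = 0) →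
      energy p T (Hab a b) g = (p - 1) * freq p T a b ^ p * ∫ t in Ioo (-T) T, |u t| ^ p →
      ∃ c, 0 < c ∧ ((∀ᵐ x ∂(volOn (-T) T), u x = c * profile p T (junction T a b) x) ∨
        ∀ᵐ x ∂(volOn (-T) T), u x = -c * profile p T (junction T a b) (-x))) := by
  obtain ⟨j, hj, σ, hσ, hmax⟩ := h.exists_max
  rcases lt_trichotomy (w j σ) 0 with hneg | hzero | hpos
  -- The largest modulus is attained at a negative value: pass to -u(-·), where the piece of index j
  -- becomes m - j.
  · have hσ' : -σ ∈ Icc (-τ (m + 1 - (m - j))) (-τ (m + 1 - (m - j + 1))) := by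
      rw [show m + 1 - (m - j) = j + 1 by omega, show m + 1 - (m - j + 1) = j by omega]
      exact ⟨by linarith [hσ.2], by linarith [hσ.1]⟩
    have hjj : m - (m - j) = j := by omega
    obtain ⟨h1, h2⟩ := poincare_of_max_pos hp hT ha hb h.reflect
      (fun hb => by obtain ⟨rfl, h2, h3⟩ := hz hb; simp [h2, h3])
      (hum.comp_quasiMeasurePreserving (measurePreserving_neg_Ioo T).quasiMeasurePreserving).neg
      (hg.comp_measurePreserving (measurePreserving_neg_Ioo T)) (j := m - j) (by omega) hσ'
      (by rw [hjj, neg_neg]; linarith) (fun i hi x hx => by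
        rw [hjj, neg_neg, abs_neg, ← abs_of_neg hneg]
        refine hmax (m - i) (by omega) (-x) ?_
        rw [show m + 1 - (i + 1) = m - i by omega] at hx
        rw [show m - i + 1 = m + 1 - i by omega]
        exact ⟨by linarith [hx.2], by linarith [hx.1]⟩)
    have hE := energy_comp_neg p T (Hab a b) g
    have hN : ∫ t in Ioo (-T) T, |-u (-t)| ^ p = ∫ t in Ioo (-T) T, |u t| ^ p := by
      simp only [abs_neg]
      exact setIntegral_comp_neg T fun t => |u t| ^ p
    rw [hE, hN] at h1 h2
    refine ⟨h1, fun _ he => ⟨-w j σ, by linarith, Or.inr ?_⟩⟩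
    have h3 := ae_volOn_comp_neg (h2 he)
    simp only [neg_neg, hjj] at h3
    filter_upwards [h3] with x hx
    rw [neg_neg]
    linarith
  · have hu0 : ∀ᵐ x ∂(volOn (-T) T), u x = 0 := by
      filter_upwards [h.ae_abs_le hmax] with x hx
      rwa [hzero, abs_zero, abs_nonpos_iff] at hx
    refine ⟨?_, fun h => absurd hu0 h⟩
    rw [integral_congr_ae (g := fun _ => (0 : ℝ))]
    · simpa using energy_nonneg ha.le hb g
    · filter_upwards [hu0] with x hx
      rw [hx, abs_zero, Real.zero_rpow (by linarith)]
  · obtain ⟨h1, h2⟩ := poincare_of_max_pos hp hT ha hb h hz hum hg hj hσ hpos (by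
      rwa [abs_of_pos hpos] at hmax)
    exact ⟨h1, fun _ he => ⟨_, hpos, Or.inl (h2 he)⟩⟩

end IsPwPrimitive

lemma IsPrimitiveOn.isPwPrimitive {T : ℝ} (hT : 0 < T) {u w g : ℝ → ℝ}
    (hw : IsPrimitiveOn (-T) T w g) (hu : ∀ᵐ x ∂(volOn (-T) T), u x = w x) (h0 : w (-T) ≤ 0)
    (h1 : 0 ≤ w T) :
    IsPwPrimitive T 0 (fun i => if i = 0 then -T else T) (fun _ => w) u g where
  left := by simp
  right := by simp
  lt i hi := by
    obtain rfl : i = 0 := by omega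
    simp only [if_true, zero_add, one_ne_zero, if_false]
    linarith
  prim i hi := by
    obtain rfl : i = 0 := by omega
    simpa using hw
  ae_eq i hi := by
    obtain rfl : i = 0 := by omega
    simpa using hu
  nonpos := h0
  nonneg := h1
  jump i hi := absurd hi (Nat.not_lt_zero i)

lemma memLp_volOn_of_pieces {p : ENNReal} {τ : ℕ → ℝ} {f : ℝ → ℝ} (n : ℕ)
    (hf : ∀ i < n, MemLp f p (volOn (τ i) (τ (i + 1)))) : MemLp f p (volOn (τ 0) (τ n)) := by
  induction n with
  | zero => simp [volOn]
  | succ n ih =>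
    have h1 := ih fun i hi => hf i (by omega)
    have h2 := hf n (by omega)
    rw [volOn, restrict_Ioo_eq_restrict_Ioc] at h1
    have h3 := MemLp.piecewise (μ := volOn (τ 0) (τ (n + 1))) (s := Iic (τ n)) (f := f) (g := f)
      measurableSet_Iic (h1.mono_measure ?_) (h2.mono_measure ?_) (p := p)
    · rwa [piecewise_same] at h3
    · rw [volOn, Measure.restrict_restrict measurableSet_Iic]
      exact Measure.restrict_mono_set volume
        (show Iic (τ n) ∩ Ioo (τ 0) (τ (n + 1)) ⊆ Ioc (τ 0) (τ n) from fun x hx => ⟨hx.2.1, hx.1⟩)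
    · rw [volOn, Measure.restrict_restrict measurableSet_Iic.compl]
      exact Measure.restrict_mono_set volume
        (show (Iic (τ n))ᶜ ∩ Ioo (τ 0) (τ (n + 1)) ⊆ Ioo (τ n) (τ (n + 1)) from
          fun x hx => ⟨not_le.mp hx.1, hx.2.2⟩)

lemma IsAdmissible.exists_isPwPrimitive {p T b : ℝ} (hp : 1 < p) (hT : 0 < T) {u g : ℝ → ℝ}
    (h : IsAdmissible p T b u g) :
    AEStronglyMeasurable u (volOn (-T) T) ∧ MemLp g (ENNReal.ofReal p) (volOn (-T) T) ∧
      ∃ m τ w, IsPwPrimitive T m τ w u g ∧ (0 < b → m = 0 ∧ w 0 (-T) = 0 ∧ w 0 T = 0) := by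
  rcases h with ⟨-, v, rfl, rfl⟩ | ⟨rfl, m, τ, w, h1, h2, h3, h4, h5, h6, h7, h8⟩
  · obtain ⟨w, hw, h0, h1, hu⟩ := v.exists_primitive hp hT
    exact ⟨v.memLp_toFun.1, v.memLp_der, 0, _, _, hw.isPwPrimitive hT hu h0.le h1.ge,
      fun _ => ⟨rfl, h0, h1⟩⟩
  · have hu := memLp_volOn_of_pieces (m + 1) fun i hi => (h4 i (by omega)).memLp_fun
    have hg := memLp_volOn_of_pieces (m + 1) fun i hi => (h4 i (by omega)).memLp_der
    rw [h1, h2] at hu hg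
    refine ⟨hu.1, hg, m, τ, w, ⟨h1, h2, h3, fun i hi => ?_, fun i hi => (h5 i hi).2, h6, h7, h8⟩,
      fun h => absurd h (lt_irrefl 0)⟩
    obtain ⟨w', hw', huw'⟩ := (h4 i hi).exists_primitive hp (h3 i hi)
    -- The primitive and the given continuous representative agree almost everywhere, hence at every
    -- point of the closed piece; this transfers boundary values and jumps.
    have hae : w' =ᵐ[volume.restrict (Icc (τ i) (τ (i + 1)))] w i := by
      rw [← restrict_Ioo_eq_restrict_Icc]
      filter_upwards [huw', (h5 i hi).2] with x hx1 hx2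
      rw [← hx1, hx2]
    have heq := Measure.eqOn_Icc_of_ae_eq volume (h3 i hi).ne hae hw'.continuousOn (h5 i hi).1
    refine ⟨hw'.integrable, fun x hx => ?_⟩
    rw [← heq hx, ← heq ⟨le_rfl, (h3 i hi).le⟩]
    exact hw'.eq x hx

end

section

/-! ### The extremal profile -/

section extremal

variable {p T : ℝ}

/-- The derivative of the extremal profile. -/
def profileDeriv (p T t₀ t : ℝ) : ℝ :=
  quarter p / (T + t₀) * slope p (risingPart p T t₀ t) -
    if t₀ = T then 0 else quarter p / (T - t₀) * slope p (fallingPart p T t₀ t)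

lemma hasDerivAt_profile (hp : 1 < p) (T t₀ t : ℝ) :
    HasDerivAt (profile p T t₀) (profileDeriv p T t₀ t) t := by
  have h1 : HasDerivAt (risingPart p T t₀)
      (quarter p / (T + t₀) * slope p (risingPart p T t₀ t)) t := by
    have hl : HasDerivAt (fun t : ℝ => quarter p * (T + t) / (T + t₀)) (quarter p / (T + t₀)) t := by
      simpa using (((hasDerivAt_id t).const_add T).const_mul (quarter p)).div_const (T + t₀)
    exact ((hasDerivAt_gsin hp _).comp t hl).congr_deriv (by rw [risingPart, mul_comm])
  unfold profileDeriv profile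
  split_ifs with h
  · have he : fallingPart p T t₀ = fun _ => 1 := by
      funext t; simp [fallingPart, h]
    simp only [he, add_sub_cancel_right, sub_zero]
    exact h1
  · have h2 : HasDerivAt (fallingPart p T t₀)
        (-(quarter p / (T - t₀) * slope p (fallingPart p T t₀ t))) t := by
      have hl : HasDerivAt (fun t : ℝ => quarter p * (T - t) / (T - t₀))
          (-(quarter p / (T - t₀))) t := by
        simpa [neg_div] using (((hasDerivAt_id t).const_sub T).const_mul (quarter p)).div_const (T - t₀)
      have he : fallingPart p T t₀ = fun t => gsin p (quarter p * (T - t) / (T - t₀)) := by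
        funext t; simp [fallingPart, h]
      rw [he]
      exact ((hasDerivAt_gsin hp _).comp t hl).congr_deriv (by ring)
    exact ((h1.add h2).sub_const 1)

lemma continuous_risingPart (hp : 1 < p) (T t₀ : ℝ) : Continuous (risingPart p T t₀) :=
  (continuous_gsin hp).comp (by fun_prop)

lemma continuous_fallingPart (hp : 1 < p) (T t₀ : ℝ) : Continuous (fallingPart p T t₀) := by
  unfold fallingPart
  split_ifs
  · exact continuous_const
  · exact (continuous_gsin hp).comp (by fun_prop)

lemma continuous_profile (hp : 1 < p) (T t₀ : ℝ) : Continuous (profile p T t₀) :=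
  ((continuous_risingPart hp T t₀).add (continuous_fallingPart hp T t₀)).sub continuous_const

lemma continuous_profileDeriv (hp : 1 < p) (T t₀ : ℝ) : Continuous (profileDeriv p T t₀) := by
  unfold profileDeriv
  refine (continuous_const.mul ((continuous_slope hp).comp (continuous_risingPart hp T t₀))).sub ?_
  split_ifs
  · exact continuous_const
  · exact continuous_const.mul ((continuous_slope hp).comp (continuous_fallingPart hp T t₀))

lemma slope_one (hp : 1 < p) : slope p 1 = 0 := slope_of_one_le hp (by simp)

lemma profileDeriv_of_le (hp : 1 < p) {t₀ t : ℝ} (h : t₀ ≤ T) (ht : t ≤ t₀) :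
    profileDeriv p T t₀ t = quarter p / (T + t₀) * slope p (profile p T t₀ t) := by
  rw [profileDeriv, profile, fallingPart_of_le hp h ht, slope_one hp, add_sub_cancel_right]
  simp

lemma profileDeriv_of_ge (hp : 1 < p) {t₀ t : ℝ} (h : -T < t₀) (h1 : t₀ < T) (ht : t₀ ≤ t) :
    profileDeriv p T t₀ t = -(quarter p / (T - t₀)) * slope p (profile p T t₀ t) := by
  rw [profileDeriv, profile, risingPart_of_le hp h ht, slope_one hp, if_neg h1.ne,
    add_sub_cancel_left]
  ring

variable {a b : ℝ}

/-- This is the equality case of Young's inequality: the rates k/a and k/b of the two branches are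
undone by the factors a and b, leaving one relation on the whole interval. -/
lemma Hab_profileDeriv (hp : 1 < p) (hT : 0 < T) (ha : 0 < a) (hb : 0 ≤ b) {t : ℝ}
    (ht : t ∈ Ioo (-T) T) :
    Hab a b (profileDeriv p T (junction T a b) t)
      = freq p T a b * slope p (profile p T (junction T a b) t) := by
  have hs := slope_nonneg p (profile p T (junction T a b) t)
  have hk := freq_pos hp hT ha hb
  rcases le_total t (junction T a b) with h | h
  · rw [profileDeriv_of_le hp (junction_le hT ha hb) h, ← freq_div_left hT ha hb,
      Hab_of_nonneg (by positivity)]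
    field_simp
  · rcases hb.eq_or_lt with rfl | hb
    · have := T_sub_junction (T := T) ha le_rfl
      simp only [mul_zero, zero_mul, zero_div] at this
      linarith [ht.2]
    · rw [profileDeriv_of_ge hp (neg_lt_junction hT ha hb.le) (junction_lt hT ha hb) h,
        ← freq_div_right hT ha hb, Hab_of_nonpos]
      · field_simp
      · have : 0 ≤ freq p T a b / b * slope p (profile p T (junction T a b) t) := by positivity
        linarith

lemma profile_neg_T (hp : 1 < p) {t₀ : ℝ} (h0 : -T < t₀) (h : t₀ ≤ T) :
    profile p T t₀ (-T) = 0 := by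
  rw [profile_of_le hp h h0.le]
  simp [gsin_zero hp]

lemma profile_T (hp : 1 < p) {t₀ : ℝ} (h0 : -T < t₀) (h : t₀ < T) : profile p T t₀ T = 0 := by
  rw [profile_of_ge hp h0 h h.le]
  simp [gsin_zero hp]

lemma profile_self (hp : 1 < p) {t₀ : ℝ} (h0 : -T < t₀) (h : t₀ ≤ T) : profile p T t₀ t₀ = 1 := by
  rw [profile, risingPart_of_le hp h0 le_rfl, fallingPart_of_le hp h le_rfl]; ring

lemma profile_pos (hp : 1 < p) {t₀ t : ℝ} (h0 : -T < t₀) (h : t₀ ≤ T) (ht : t ∈ Ioo (-T) T) :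
    0 < profile p T t₀ t := by
  have hq := quarter_pos hp
  rcases le_total t t₀ with h1 | h1
  · rw [profile_of_le hp h h1]
    exact gsin_pos hp (div_pos (mul_pos hq (by linarith [ht.1])) (by linarith))
  · rcases h.eq_or_lt with rfl | h
    · linarith [ht.2]
    · rw [profile_of_ge hp h0 h h1]
      exact gsin_pos hp (div_pos (mul_pos hq (by linarith [ht.2])) (by linarith))

lemma profile_le_one (hp : 1 < p) {t₀ : ℝ} (h0 : -T < t₀) (h : t₀ ≤ T) (t : ℝ) :
    profile p T t₀ t ≤ 1 := by
  rcases le_total t t₀ with h1 | h1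
  · rw [profile_of_le hp h h1]
    exact (abs_le.mp (abs_gsin_le _ _)).2
  · have h2 : fallingPart p T t₀ t ≤ 1 := by
      unfold fallingPart
      split_ifs
      · exact le_rfl
      · exact (abs_le.mp (abs_gsin_le _ _)).2
    rw [profile, risingPart_of_le hp h0 h1]
    linarith

lemma profile_lt_one (hp : 1 < p) {t₀ t : ℝ} (h0 : -T < t₀) (h : t₀ ≤ T) (ht : t ∈ Ioo (-T) T)
    (hne : t ≠ t₀) : profile p T t₀ t < 1 := by
  have hq := quarter_pos hp
  refine (abs_lt.mp ?_).2
  rcases lt_or_gt_of_ne hne with h1 | h1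
  · have hpos : 0 < T + t₀ := by linarith
    rw [profile_of_le hp h h1.le]
    refine abs_gsin_lt hp ?_
    rw [abs_of_pos (div_pos (mul_pos hq (by linarith [ht.1])) hpos), div_lt_iff₀ hpos]
    exact mul_lt_mul_of_pos_left (by linarith) hq
  · have hpos : 0 < T - t₀ := by linarith [ht.2]
    rw [profile_of_ge hp h0 (by linarith) h1.le]
    refine abs_gsin_lt hp ?_
    rw [abs_of_pos (div_pos (mul_pos hq (by linarith [ht.2])) hpos), div_lt_iff₀ hpos]
    exact mul_lt_mul_of_pos_left (by linarith) hq

/-- Each branch is an affine rescaling of the sine on a quarter period. The lengths T + t₀ and T -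
t₀ add up to 2T, so the result does not depend on t₀. -/
lemma integral_comp_profile (hp : 1 < p) {t₀ : ℝ} (h0 : -T < t₀) (h : t₀ ≤ T) {f : ℝ → ℝ}
    (hf : Continuous f) :
    ∫ t in (-T)..T, f (profile p T t₀ t) = 2 * T / quarter p * ∫ x in (0 : ℝ)..quarter p, f (gsin p x) := by
  have hq := quarter_pos hp
  have hc : Continuous fun t => f (profile p T t₀ t) := hf.comp (continuous_profile hp T t₀)
  rw [← intervalIntegral.integral_add_adjacent_intervals (b := t₀) (hc.intervalIntegrable _ _)
    (hc.intervalIntegrable _ _)]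
  have h1 : ∫ t in (-T)..t₀, f (profile p T t₀ t)
      = (T + t₀) / quarter p * ∫ x in (0 : ℝ)..quarter p, f (gsin p x) := by
    have hpos : T + t₀ ≠ 0 := by linarith
    have he : ∫ t in (-T)..t₀, f (profile p T t₀ t)
        = ∫ t in (-T)..t₀, f (gsin p (quarter p / (T + t₀) * t + quarter p * T / (T + t₀))) := by
      refine intervalIntegral.integral_congr fun t ht => ?_
      rw [uIcc_of_le h0.le] at ht
      simp only [profile_of_le hp h ht.2]
      congr 2
      ring
    rw [he, intervalIntegral.integral_comp_mul_add (fun x => f (gsin p x)) (by positivity)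
      (quarter p * T / (T + t₀)), smul_eq_mul, inv_div]
    congr 2
    · ring
    · field_simp
      ring
  have h2 : ∫ t in t₀..T, f (profile p T t₀ t)
      = (T - t₀) / quarter p * ∫ x in (0 : ℝ)..quarter p, f (gsin p x) := by
    rcases h.eq_or_lt with rfl | h
    · simp
    have hpos : T - t₀ ≠ 0 := by linarith
    have he : ∫ t in t₀..T, f (profile p T t₀ t)
        = ∫ t in t₀..T, f (gsin p (quarter p * T / (T - t₀) - quarter p / (T - t₀) * t)) := by
      refine intervalIntegral.integral_congr fun t ht => ?_
      rw [uIcc_of_le h.le] at ht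
      simp only [profile_of_ge hp h0 h ht.1]
      congr 2
      ring
    rw [he, intervalIntegral.integral_comp_sub_mul (fun x => f (gsin p x)) (by positivity)
      (quarter p * T / (T - t₀)), smul_eq_mul, inv_div]
    congr 2
    · ring
    · field_simp
  rw [h1, h2]
  ring

lemma integral_abs_profile_rpow (hp : 1 < p) (hT : 0 < T) {t₀ : ℝ} (h0 : -T < t₀) (h : t₀ ≤ T) :
    ∫ t in Ioo (-T) T, |profile p T t₀ t| ^ p = 2 * T / p := by
  have hq := quarter_pos hp
  rw [setIntegral_Ioo_eq (by linarith), integral_comp_profile hp h0 h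
    (continuous_abs.rpow_const fun _ => Or.inr (by linarith))]
  have : ∫ x in (0 : ℝ)..quarter p, |gsin p x| ^ p = quarter p / p := by
    rw [← integral_gsin_rpow hp]
    refine intervalIntegral.integral_congr fun x hx => ?_
    rw [uIcc_of_le hq.le] at hx
    have : 0 ≤ gsin p x := by rw [← gsin_zero hp]; exact monotone_gsin hp hx.1
    simp only [abs_of_nonneg this]
  rw [this]
  field_simp

lemma energy_profileDeriv (hp : 1 < p) (hT : 0 < T) (ha : 0 < a) (hb : 0 ≤ b) :
    energy p T (Hab a b) (profileDeriv p T (junction T a b))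
      = (p - 1) * freq p T a b ^ p * (2 * T / p) := by
  have h0 := neg_lt_junction hT ha hb
  have h1 := junction_le hT ha hb
  have hk := freq_pos hp hT ha hb
  have hc : Continuous fun t => |profile p T (junction T a b) t| ^ p :=
    (continuous_profile hp T _).abs.rpow_const fun _ => Or.inr (by linarith)
  have he : energy p T (Hab a b) (profileDeriv p T (junction T a b))
      = ∫ t in Ioo (-T) T, freq p T a b ^ p * (1 - |profile p T (junction T a b) t| ^ p) := by
    refine setIntegral_congr_fun measurableSet_Ioo fun t ht => ?_
    have hle : |profile p T (junction T a b) t| ≤ 1 := by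
      rw [abs_of_pos (profile_pos hp h0 h1 ht)]; exact profile_le_one hp h0 h1 t
    simp only [Hab_profileDeriv hp hT ha hb ht, Real.mul_rpow hk.le (slope_nonneg _ _),
      slope_rpow hp hle]
  rw [he, integral_const_mul, setIntegral_Ioo_eq (by linarith), intervalIntegral.integral_sub
    intervalIntegrable_const (hc.intervalIntegrable _ _), ← setIntegral_Ioo_eq (by linarith)
    fun t => |profile p T (junction T a b) t| ^ p, integral_abs_profile_rpow hp hT h0 h1,
    intervalIntegral.integral_const, smul_eq_mul]
  field_simp
  ring

lemma isAdmissible_of_hasDerivAt (hp : 1 < p) (hT : 0 < T) (hb : 0 ≤ b) {u w g : ℝ → ℝ}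
    (hg : Continuous g) (hw : ∀ x, HasDerivAt w (g x) x) (hu : ∀ᵐ x ∂(volOn (-T) T), u x = w x)
    (h0 : w (-T) ≤ 0) (h1 : 0 ≤ w T) (hz : 0 < b → w (-T) = 0 ∧ w T = 0) :
    IsAdmissible p T b u g := by
  have hprim := IsPrimitiveOn.of_continuous hg hw (-T) T
  rcases hb.eq_or_lt with rfl | hb
  · refine Or.inr ⟨rfl, 0, fun i => if i = 0 then -T else T, fun _ => w, ?_⟩
    have h := hprim.isPwPrimitive hT hu h0 h1
    refine ⟨h.left, h.right, h.lt, fun i hi => ?_, fun i hi => ⟨(h.prim i hi).continuousOn,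
      h.ae_eq i hi⟩, h0, h1, fun i hi => absurd hi (Nat.not_lt_zero i)⟩
    exact (h.prim i hi).isSobolevOn (h.lt i hi).le (memLp_of_continuousOn hg.continuousOn)
      (h.ae_eq i hi)
  · exact Or.inl ⟨hb, W0.exists_of_isPrimitiveOn hp hT hg.continuousOn hprim (hz hb).1 (hz hb).2 hu⟩

lemma W0.exists_const_mul_profile (hp : 1 < p) (hT : 0 < T) {t₀ : ℝ} (h0 : -T < t₀) (h : t₀ < T)
    (c : ℝ) : ∃ v : W0 p T, v.toFun = (fun t => c * profile p T t₀ t) ∧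
      v.der = fun t => c * profileDeriv p T t₀ t :=
  W0.exists_of_isPrimitiveOn hp hT
    (continuous_const.mul (continuous_profileDeriv hp T t₀)).continuousOn
    (.of_continuous (continuous_const.mul (continuous_profileDeriv hp T t₀))
      (fun t => (hasDerivAt_profile hp T t₀ t).const_mul c) _ _)
    (by rw [profile_neg_T hp h0 h.le, mul_zero]) (by rw [profile_T hp h0 h, mul_zero])
    (ae_of_all _ fun _ => rfl)

lemma hasDerivAt_Hab_of_pos {s : ℝ} (hs : 0 < s) : HasDerivAt (Hab a b) a s := by
  have h : HasDerivAt (fun s : ℝ => a * s) a s := by simpa using (hasDerivAt_id s).const_mul a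
  refine h.congr_of_eventuallyEq ?_
  filter_upwards [Ioi_mem_nhds hs] with x hx using Hab_of_nonneg (le_of_lt hx)

lemma hasDerivAt_Hab_of_neg {s : ℝ} (hs : s < 0) : HasDerivAt (Hab a b) (-b) s := by
  have h : HasDerivAt (fun s : ℝ => -b * s) (-b) s := by
    simpa using (hasDerivAt_id s).const_mul (-b)
  refine h.congr_of_eventuallyEq ?_
  filter_upwards [Iio_mem_nhds hs] with x hx using Hab_of_nonpos (le_of_lt hx)

lemma profileDeriv_pos (hp : 1 < p) {t₀ t : ℝ} (h0 : -T < t₀) (h : t₀ ≤ T) (ht : t ∈ Ioo (-T) T)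
    (h1 : t < t₀) : 0 < profileDeriv p T t₀ t := by
  rw [profileDeriv_of_le hp h h1.le]
  refine mul_pos (div_pos (quarter_pos hp) (by linarith)) (slope_pos hp ?_)
  rw [abs_of_pos (profile_pos hp h0 h ht)]
  exact profile_lt_one hp h0 h ht h1.ne

lemma profileDeriv_neg (hp : 1 < p) {t₀ t : ℝ} (h0 : -T < t₀) (h : t₀ ≤ T) (ht : t ∈ Ioo (-T) T)
    (h1 : t₀ < t) : profileDeriv p T t₀ t < 0 := by
  have hlt : t₀ < T := h1.trans ht.2
  rw [profileDeriv_of_ge hp h0 hlt h1.le]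
  have : 0 < quarter p / (T - t₀) * slope p (profile p T t₀ t) := by
    refine mul_pos (div_pos (quarter_pos hp) (by linarith)) (slope_pos hp ?_)
    rw [abs_of_pos (profile_pos hp h0 h ht)]
    exact profile_lt_one hp h0 h ht h1.ne'
  linarith

/-- The generalized cosine function is differentiable at positive points other than `quarter`. -/
lemma hasDerivAt_slope_gsin_rpow_of_gt (hp : 1 < p) {x : ℝ} (hx : quarter p < x) :
    HasDerivAt (fun x => slope p (gsin p x) ^ (p - 1)) 0 x := by
  refine (hasDerivAt_const x (0 : ℝ)).congr_of_eventuallyEq ?_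
  filter_upwards [Ioi_mem_nhds hx] with y hy
  rw [gsin_of_quarter_le hp (le_of_lt hy), slope_one hp, Real.zero_rpow (by linarith)]

lemma IsPrimitiveOn.of_hasDerivAt_off_countable {s t : ℝ} {F f : ℝ → ℝ} {S : Set ℝ}
    (hS : S.Countable) (hF : Continuous F) (hf : Continuous f)
    (hd : ∀ x ∈ Ioo s t \ S, HasDerivAt F (f x) x) : IsPrimitiveOn s t F f where
  integrable := hf.intervalIntegrable _ _
  eq x hx := by
    have h := integral_eq_of_hasDerivAt_off_countable_of_le F f hx.1 hS hF.continuousOn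
      (fun y hy => hd y ⟨⟨hy.1.1, hy.1.2.trans_le hx.2⟩, hy.2⟩) (hf.intervalIntegrable _ _)
    rw [h]; ring

/-- The extremal profile solves the anisotropic eigenvalue equation. -/
lemma negLaplacian_profile (hp : 1 < p) (hT : 0 < T) (ha : 0 < a) (hb : 0 < b) {c : ℝ} (hc : 0 < c)
    {v : W0 p T} (hv : v.toFun = fun t => c * profile p T (junction T a b) t)
    (hvd : v.der = fun t => c * profileDeriv p T (junction T a b) t) (ψ : W0 p T) :
    negLaplacian p T (Hab a b) v ψ = (p - 1) * freq p T a b ^ p *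
      ∫ t in Ioo (-T) T, |v t| ^ (p - 2) * v t * ψ t := by
  have hTT : -T ≤ T := by linarith
  set t₀ := junction T a b with ht₀
  have h0 : -T < t₀ := neg_lt_junction hT ha hb.le
  have h1 : t₀ < T := junction_lt hT ha hb
  have hk := freq_pos hp hT ha hb.le
  set k := freq p T a b with hkdef
  have hka : k / a = quarter p / (T + t₀) := freq_div_left hT ha hb.le
  have hkb : k / b = quarter p / (T - t₀) := freq_div_right hT ha hb
  have hkp : k ^ (p - 1) * k = k ^ p := rpow_sub_one_mul_self hp hk.le
  have hak : a * (k / a) = k := mul_div_cancel₀ k ha.ne'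
  have hbk : b * (k / b) = k := mul_div_cancel₀ k hb.ne'
  set C : ℝ → ℝ := fun x => slope p (gsin p x) ^ (p - 1) with hC
  have hCc : Continuous C := continuous_slope_gsin_rpow hp
  -- A continuous representative of the flux H^{p-1}(v')H'(v'). The generalized cosine vanishes
  -- beyond the quarter period, so only one of the two terms is active on each side of t₀.
  set F : ℝ → ℝ := fun t => c ^ (p - 1) * k ^ (p - 1) *
    (a * C (quarter p * (T + t) / (T + t₀)) - b * C (quarter p * (T - t) / (T - t₀))) with hF
  set f : ℝ → ℝ := fun t => -((p - 1) * k ^ p) * (c ^ (p - 1) * profile p T t₀ t ^ (p - 1)) with hf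
  have hCz : ∀ x, quarter p ≤ x → C x = 0 := fun x hx => by
    simp only [hC, gsin_of_quarter_le hp hx, slope_one hp, Real.zero_rpow (by linarith : p - 1 ≠ 0)]
  have hleft : ∀ t, t ≤ t₀ → quarter p ≤ quarter p * (T - t) / (T - t₀) := fun t ht => by
    rw [le_div_iff₀ (by linarith)]
    exact mul_le_mul_of_nonneg_left (by linarith) (quarter_pos hp).le
  have hright : ∀ t, t₀ ≤ t → quarter p ≤ quarter p * (T + t) / (T + t₀) := fun t ht => by
    rw [le_div_iff₀ (by linarith)]
    exact mul_le_mul_of_nonneg_left (by linarith) (quarter_pos hp).le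
  have hFprim : IsPrimitiveOn (-T) T F f := by
    -- At t₀ both cosine terms have a kink; one exceptional point is harmless for a continuous
    -- function with continuous f.
    refine .of_hasDerivAt_off_countable (S := {t₀}) (countable_singleton _) ?_ ?_ ?_
    · exact continuous_const.mul ((continuous_const.mul (hCc.comp (by fun_prop))).sub
        (continuous_const.mul (hCc.comp (by fun_prop))))
    · exact continuous_const.mul (continuous_const.mul ((continuous_profile hp T t₀).rpow_const
        fun _ => Or.inr (by linarith)))
    · rintro t ⟨ht, hne⟩
      have hlA : HasDerivAt (fun t : ℝ => quarter p * (T + t) / (T + t₀)) (k / a) t := by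
        rw [hka]
        simpa using (((hasDerivAt_id t).const_add T).const_mul (quarter p)).div_const (T + t₀)
      have hlB : HasDerivAt (fun t : ℝ => quarter p * (T - t) / (T - t₀)) (-(k / b)) t := by
        rw [hkb]
        simpa [neg_div] using
          (((hasDerivAt_id t).const_sub T).const_mul (quarter p)).div_const (T - t₀)
      have hq := quarter_pos hp
      rcases lt_or_gt_of_ne (show t ≠ t₀ from hne) with hlt | hgt
      · have hA := (hasDerivAt_slope_gsin_rpow hp (x := quarter p * (T + t) / (T + t₀))
          (div_pos (mul_pos hq (by linarith [ht.1])) (by linarith)) (by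
            rw [div_lt_iff₀ (by linarith)]
            exact mul_lt_mul_of_pos_left (by linarith) hq)).comp t hlA
        have hB := (hasDerivAt_slope_gsin_rpow_of_gt hp (x := quarter p * (T - t) / (T - t₀)) (by
            rw [lt_div_iff₀ (by linarith)]
            exact mul_lt_mul_of_pos_left (by linarith) hq)).comp t hlB
        refine (((hA.const_mul a).sub (hB.const_mul b)).const_mul
          (c ^ (p - 1) * k ^ (p - 1))).congr_deriv ?_
        simp only [hf]
        rw [profile_of_le hp h1.le hlt.le]
        linear_combination (-(p - 1) * gsin p (quarter p * (T + t) / (T + t₀)) ^ (p - 1)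
          * c ^ (p - 1)) * (k ^ (p - 1) * hak + hkp)
      · have hA := (hasDerivAt_slope_gsin_rpow_of_gt hp (x := quarter p * (T + t) / (T + t₀)) (by
            rw [lt_div_iff₀ (by linarith)]
            exact mul_lt_mul_of_pos_left (by linarith) hq)).comp t hlA
        have hB := (hasDerivAt_slope_gsin_rpow hp (x := quarter p * (T - t) / (T - t₀))
          (div_pos (mul_pos hq (by linarith [ht.2])) (by linarith)) (by
            rw [div_lt_iff₀ (by linarith)]
            exact mul_lt_mul_of_pos_left (by linarith) hq)).comp t hlB
        refine (((hA.const_mul a).sub (hB.const_mul b)).const_mul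
          (c ^ (p - 1) * k ^ (p - 1))).congr_deriv ?_
        simp only [hf]
        rw [profile_of_ge hp h0 h1 hgt.le]
        linear_combination (-(p - 1) * gsin p (quarter p * (T - t) / (T - t₀)) ^ (p - 1)
          * c ^ (p - 1)) * (k ^ (p - 1) * hbk + hkp)
  obtain ⟨w, hw, hw0, hw1, hψ⟩ := ψ.exists_primitive hp hT
  -- The boundary terms vanish with ψ, so no condition is needed on the flux at ±T.
  have hparts := hFprim.integral_mul hw hTT
  rw [hw0, hw1, mul_zero, mul_zero, sub_zero, zero_sub] at hparts
  have hL : negLaplacian p T (Hab a b) v ψ = ∫ t in (-T)..T, F t * ψ.der t := by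
    rw [← setIntegral_Ioo_eq hTT, negLaplacian]
    refine integral_congr_ae ?_
    filter_upwards [ae_restrict_mem measurableSet_Ioo,
      ae_restrict_of_ae (Measure.ae_ne volume t₀)] with t ht hne
    congr 1
    simp only [hvd]
    rw [Hab_mul hc.le, Hab_profileDeriv hp hT ha hb.le ht, ← ht₀, ← hkdef,
      Real.mul_rpow hc.le (mul_nonneg hk.le (slope_nonneg _ _)),
      Real.mul_rpow hk.le (slope_nonneg _ _)]
    rcases lt_or_gt_of_ne hne with hlt | hgt
    · rw [(hasDerivAt_Hab_of_pos (mul_pos hc (profileDeriv_pos hp h0 h1.le ht hlt))).deriv]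
      simp only [hF]
      rw [hCz _ (hleft t hlt.le), profile_of_le hp h1.le hlt.le]
      ring
    · rw [(hasDerivAt_Hab_of_neg (mul_neg_of_pos_of_neg hc
        (profileDeriv_neg hp h0 h1.le ht hgt))).deriv]
      simp only [hF]
      rw [hCz _ (hright t hgt.le), profile_of_ge hp h0 h1 hgt.le]
      ring
  rw [hL, hparts, ← integral_const_mul, ← setIntegral_Ioo_eq hTT, ← integral_neg]
  refine integral_congr_ae ?_
  filter_upwards [ae_restrict_mem measurableSet_Ioo, hψ] with t ht hψt
  have hpos := profile_pos hp h0 h1.le ht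
  rw [hψt]
  simp only [hv, hf]
  rw [abs_of_pos (mul_pos hc hpos), ← Real.rpow_add_one (mul_pos hc hpos).ne',
    show p - 2 + 1 = p - 1 by ring, Real.mul_rpow hc.le hpos.le]
  ring

end extremal

end

section

/-! ### The least energy level -/

section level

variable {p T a b : ℝ}

/-- Here b = 0 is included: this case gives the lower bound for the level and later excludes a
fundamental frequency. -/
lemma W0.poincare (hp : 1 < p) (hT : 0 < T) (ha : 0 < a) (hb : 0 ≤ b) (v : W0 p T) :
    (p - 1) * freq p T a b ^ p * ∫ t in Ioo (-T) T, |v t| ^ p ≤ energy p T (Hab a b) v.der ∧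
    ((¬ ∀ᵐ x ∂(volOn (-T) T), v x = 0) →
      energy p T (Hab a b) v.der = (p - 1) * freq p T a b ^ p * ∫ t in Ioo (-T) T, |v t| ^ p →
      ∃ c, 0 < c ∧ ((∀ᵐ x ∂(volOn (-T) T), v x = c * profile p T (junction T a b) x) ∨
        ∀ᵐ x ∂(volOn (-T) T), v x = -c * profile p T (junction T a b) (-x))) := by
  obtain ⟨w, hw, h0, h1, hv⟩ := v.exists_primitive hp hT
  exact (hw.isPwPrimitive hT hv h0.le h1.ge).poincare hp hT ha hb (fun _ => ⟨rfl, h0, h1⟩)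
    v.memLp_toFun.1 v.memLp_der

lemma integral_eq_one_of_pNorm_eq_one (hp : 1 < p) {u : ℝ → ℝ} (h : pNorm p T u = 1) :
    ∫ t in Ioo (-T) T, |u t| ^ p = 1 := by
  have h0 : 0 ≤ ∫ t in Ioo (-T) T, |u t| ^ p :=
    integral_nonneg fun _ => Real.rpow_nonneg (abs_nonneg _) _
  unfold pNorm at h
  have h1 := congrArg (fun x => x ^ p) h
  simp only [Real.one_rpow] at h1
  rwa [← Real.rpow_mul h0, one_div_mul_cancel (by linarith), Real.rpow_one] at h1

/-- The constant normalizing the extremal profiles in `L^p`. -/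
def normConst (p T : ℝ) : ℝ := (2 * T / p) ^ (-(1 / p))

lemma normConst_pos (hp : 1 < p) (hT : 0 < T) : 0 < normConst p T :=
  Real.rpow_pos_of_pos (by positivity) _

lemma normConst_rpow (hp : 1 < p) (hT : 0 < T) : normConst p T ^ p * (2 * T / p) = 1 := by
  have h : 0 < 2 * T / p := by positivity
  rw [normConst, ← Real.rpow_mul h.le, show -(1 / p) * p = -1 by field_simp, Real.rpow_neg_one,
    inv_mul_cancel₀ h.ne']

lemma pNorm_normConst_mul_profile (hp : 1 < p) (hT : 0 < T) {t₀ : ℝ} (h0 : -T < t₀) (h : t₀ ≤ T) :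
    pNorm p T (fun t => normConst p T * profile p T t₀ t) = 1 := by
  rw [pNorm, integral_abs_rpow_const_mul (normConst_pos hp hT).le,
    integral_abs_profile_rpow hp hT h0 h, normConst_rpow hp hT, Real.one_rpow]

lemma energy_mono (hp : 1 < p) (hT : 0 < T) (ha : 0 ≤ a) (hb : 0 ≤ b) {b' : ℝ} (hbb : b ≤ b')
    {g : ℝ → ℝ} (hg : MemLp g (ENNReal.ofReal p) (volOn (-T) T)) :
    energy p T (Hab a b) g ≤ energy p T (Hab a b') g := by
  have hi := intervalIntegrable_Hab_rpow hp hT ha (hb.trans hbb) hg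
  rw [intervalIntegrable_iff_integrableOn_Ioo_of_le (by linarith)] at hi
  refine integral_mono_of_nonneg (ae_of_all _ fun _ => Real.rpow_nonneg (Hab_nonneg ha hb _) _) hi
    (ae_of_all _ fun x => Real.rpow_le_rpow (Hab_nonneg ha hb _) ?_ (by linarith))
  unfold Hab
  gcongr

/-- The lower bound is the Poincaré inequality. For the upper bound the competitor is the profile
for a parameter b' > b, followed by b' → b; this also covers b = 0, whose own profile does not
vanish at T and so is not in W₀^{1,p}. -/
lemma level_Hab (hp : 1 < p) (hT : 0 < T) (ha : 0 < a) (hb : 0 ≤ b) :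
    level p T (Hab a b) = (p - 1) * freq p T a b ^ p := by
  have hmem : ∀ b', b ≤ b' → 0 < b' → ∃ E ∈ {E | ∃ u : W0 p T, pNorm p T u = 1 ∧
      E = energy p T (Hab a b) u.der}, E ≤ (p - 1) * freq p T a b' ^ p := by
    intro b' hbb hb'
    have h0 := neg_lt_junction hT ha hb'.le
    have h1 := junction_lt hT ha hb'
    obtain ⟨v, hv, hvd⟩ := W0.exists_const_mul_profile hp hT h0 h1 (normConst p T)
    refine ⟨_, ⟨v, ?_, rfl⟩, (energy_mono hp hT ha.le hb hbb v.memLp_der).trans ?_⟩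
    · rw [hv]; exact pNorm_normConst_mul_profile hp hT h0 h1.le
    · rw [hvd, energy_const_mul ha.le hb'.le (normConst_pos hp hT).le,
        energy_profileDeriv hp hT ha hb'.le]
      have := normConst_rpow hp hT
      refine le_of_eq ?_
      linear_combination ((p - 1) * freq p T a b' ^ p) * this
  have hlow : ∀ E ∈ {E | ∃ u : W0 p T, pNorm p T u = 1 ∧ E = energy p T (Hab a b) u.der},
      (p - 1) * freq p T a b ^ p ≤ E := by
    rintro E ⟨u, hu, rfl⟩
    have := (u.poincare hp hT ha hb).1
    rwa [integral_eq_one_of_pNorm_eq_one hp hu, mul_one] at this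
  apply le_antisymm
  · have hlim : Tendsto (fun b' => (p - 1) * freq p T a b' ^ p) (𝓝[>] b)
        (𝓝 ((p - 1) * freq p T a b ^ p)) := by
      have hc : Continuous fun b' => (p - 1) * freq p T a b' ^ p := by
        unfold freq
        exact continuous_const.mul (Continuous.rpow_const (by fun_prop) fun _ =>
          Or.inr (by linarith))
      exact hc.continuousAt.tendsto.mono_left nhdsWithin_le_nhds
    refine ge_of_tendsto hlim ?_
    filter_upwards [self_mem_nhdsWithin] with b' hb'
    obtain ⟨E, hE, hle⟩ := hmem b' (le_of_lt hb') (hb.trans_lt hb')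
    exact (csInf_le ⟨_, hlow⟩ hE).trans hle
  · obtain ⟨E, hE, -⟩ := hmem (b + 1) (by linarith) (by linarith)
    exact le_csInf ⟨E, hE⟩ hlow

lemma Hab_one_one : Hab 1 1 = fun s : ℝ => |s| := by
  funext s
  rcases le_total 0 s with h | h
  · rw [Hab_of_nonneg h, abs_of_nonneg h, one_mul]
  · rw [Hab_of_nonpos h, abs_of_nonpos h, neg_one_mul]

lemma lambda1_eq (hp : 1 < p) (hT : 0 < T) : lambda1 p T = (p - 1) * freq p T 1 1 ^ p := by
  rw [lambda1, ← Hab_one_one, level_Hab hp hT one_pos zero_le_one]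

lemma level_Hab_eq_lambda1 (hp : 1 < p) (hT : 0 < T) (ha : 0 < a) (hb : 0 ≤ b) :
    level p T (Hab a b) = ((a + b) / 2) ^ p * lambda1 p T := by
  have hk : 0 < freq p T 1 1 := freq_pos hp hT one_pos zero_le_one
  have : freq p T a b = (a + b) / 2 * freq p T 1 1 := by
    unfold freq; ring
  rw [level_Hab hp hT ha hb, lambda1_eq hp hT, this, Real.mul_rpow (by positivity) hk.le]
  ring

/-! ### The principal eigenfunction -/

/-- The p-Laplace flux is the anisotropic one for a = b = 1. At s = 0 both sides have a zero factor,
so the derivative assigned at the kink plays no role. -/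
lemma abs_rpow_mul_eq (hp : 1 < p) (s : ℝ) :
    |s| ^ (p - 2) * s = Hab 1 1 s ^ (p - 1) * deriv (Hab 1 1) s := by
  have hs : ∀ x : ℝ, 0 < x → x ^ (p - 2) * x = x ^ (p - 1) := fun x hx => by
    rw [← Real.rpow_add_one hx.ne']; congr 1; ring
  rcases lt_trichotomy s 0 with h | rfl | h
  · rw [(hasDerivAt_Hab_of_neg h).deriv, congrFun Hab_one_one s, abs_of_neg h,
      ← hs (-s) (by linarith)]
    ring
  · rw [congrFun Hab_one_one 0, abs_zero, Real.zero_rpow (by linarith : p - 1 ≠ 0)]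
    ring
  · rw [(hasDerivAt_Hab_of_pos h).deriv, congrFun Hab_one_one s, abs_of_pos h, hs s h, mul_one]

lemma junction_one_one (T : ℝ) : junction T 1 1 = 0 := by simp [junction]

lemma exists_isPrincipalEigenfunction (hp : 1 < p) (hT : 0 < T) :
    ∃ φ : W0 p T, IsPrincipalEigenfunction p T φ := by
  have h0 := neg_lt_junction hT one_pos zero_le_one
  have h1 := junction_lt hT one_pos one_pos
  have hc := normConst_pos hp hT
  obtain ⟨v, hv, hvd⟩ := W0.exists_const_mul_profile hp hT h0 h1 (normConst p T)
  refine ⟨v, ?_, ?_, fun ψ => ?_⟩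
  · rw [hv]; exact pNorm_normConst_mul_profile hp hT h0 h1.le
  · filter_upwards [ae_restrict_mem measurableSet_Ioo] with t ht
    rw [hv]; exact mul_pos hc (profile_pos hp h0 h1.le ht)
  · rw [lambda1_eq hp hT, ← negLaplacian_profile hp hT one_pos one_pos hc hv hvd ψ]
    simp only [abs_rpow_mul_eq hp, negLaplacian]

lemma abs_rpow_mul_mul_self (hp : 1 < p) (s : ℝ) : |s| ^ (p - 2) * s * s = |s| ^ p := by
  rcases eq_or_ne s 0 with rfl | hs
  · rw [abs_zero, Real.zero_rpow (by linarith : p ≠ 0)]; ring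
  · rw [mul_assoc, ← abs_mul_abs_self s, ← mul_assoc, ← Real.rpow_add_one (abs_ne_zero.mpr hs),
      ← Real.rpow_add_one (abs_ne_zero.mpr hs)]
    congr 1; ring

lemma volOn_ae_neBot (hT : 0 < T) : (ae (volOn (-T) T)).NeBot := by
  rw [ae_neBot, Ne, Measure.restrict_eq_zero, Real.volume_Ioo, ENNReal.ofReal_eq_zero]
  linarith

lemma not_ae_eq_zero_of_pos (hT : 0 < T) {u : ℝ → ℝ}
    (h : ∀ᵐ t ∂(volOn (-T) T), 0 < u t) : ¬ ∀ᵐ t ∂(volOn (-T) T), u t = 0 := by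
  intro h'
  have := volOn_ae_neBot hT
  obtain ⟨t, h1, h2⟩ := (h.and h').exists
  linarith

lemma profile_comp_neg_pos (hp : 1 < p) {t₀ t : ℝ} (h0 : -T < t₀) (h : t₀ ≤ T)
    (ht : t ∈ Ioo (-T) T) : 0 < profile p T t₀ (-t) :=
  profile_pos hp h0 h ⟨by linarith [ht.2], by linarith [ht.1]⟩

/-- The principal eigenfunction is a multiple of the symmetric profile. -/
lemma IsPrincipalEigenfunction.exists_eq (hp : 1 < p) (hT : 0 < T) {φ : W0 p T}
    (h : IsPrincipalEigenfunction p T φ) :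
    ∃ c, 0 < c ∧ ∀ᵐ t ∂(volOn (-T) T), φ t = c * profile p T 0 t := by
  -- Testing with φ itself gives equality in the Poincaré inequality for a = b = 1; positivity then
  -- excludes the negative alternative.
  have he := h.eqn φ
  simp only [abs_rpow_mul_mul_self hp] at he
  have hE : energy p T (Hab 1 1) φ.der
      = (p - 1) * freq p T 1 1 ^ p * ∫ t in Ioo (-T) T, |φ t| ^ p := by
    rw [← lambda1_eq hp hT, ← he, Hab_one_one, energy]
  obtain ⟨c, hc, hor⟩ := (φ.poincare hp hT one_pos zero_le_one).2
    (not_ae_eq_zero_of_pos hT h.pos) hE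
  rw [junction_one_one] at hor
  refine ⟨c, hc, hor.resolve_right fun h2 => ?_⟩
  have := volOn_ae_neBot hT
  obtain ⟨t, ⟨h3, h4⟩, h5⟩ := ((h.pos.and h2).and (ae_restrict_mem measurableSet_Ioo)).exists
  have := mul_pos hc (profile_comp_neg_pos hp (t₀ := 0) (by linarith) hT.le h5)
  linarith

/-! ### The glued functions as rescaled profiles -/

lemma ae_comp_affine {P : ℝ → Prop} (h : ∀ᵐ x, P x) {m : ℝ} (hm : m ≠ 0) (n : ℝ) :
    ∀ᵐ x, P (m * x + n) := by
  have h1 := (measurePreserving_add_right (volume : Measure ℝ) n).quasiMeasurePreserving.ae h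
  rw [ae_iff] at h1 ⊢
  have h2 := Real.volume_preimage_mul_left hm {x | ¬ P (x + n)}
  rw [h1, mul_zero] at h2
  exact h2

lemma profile_zero_of_nonpos (hp : 1 < p) (hT : 0 < T) {y : ℝ} (hy : y ≤ 0) :
    profile p T 0 y = gsin p (quarter p * (T + y) / T) := by
  rw [profile_of_le hp hT.le hy, add_zero]

lemma profile_zero_of_nonneg (hp : 1 < p) (hT : 0 < T) {y : ℝ} (hy : 0 ≤ y) :
    profile p T 0 y = gsin p (quarter p * (T - y) / T) := by
  rw [profile_of_ge hp (by linarith) hT hy, sub_zero]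

/-- The two affine substitutions carry the halves of the symmetric profile onto the two branches of
the asymmetric one. Since φ is only known almost everywhere, the substitutions must have non-zero
linear coefficient. -/
lemma uGlued_ae_eq (hp : 1 < p) (hT : 0 < T) {t₀ c d : ℝ} (h0 : -T < t₀) (h1 : t₀ ≤ T) {φ : ℝ → ℝ}
    (hφ : ∀ᵐ t ∂(volOn (-T) T), φ t = d * profile p T 0 t) :
    ∀ᵐ t ∂(volOn (-T) T), uGlued T t₀ c φ t = c * d * profile p T t₀ t := by
  rw [ae_volOn_iff] at hφ ⊢
  have hl := ae_comp_affine hφ (m := T / (T + t₀)) (by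
    have : T + t₀ ≠ 0 := by linarith
    positivity) (-(T * t₀ / (T + t₀)))
  have hr : t₀ < T → ∀ᵐ t, T / (T - t₀) * t + -(T * t₀ / (T - t₀)) ∈ Ioo (-T) T →
      φ (T / (T - t₀) * t + -(T * t₀ / (T - t₀)))
        = d * profile p T 0 (T / (T - t₀) * t + -(T * t₀ / (T - t₀))) := fun h =>
    ae_comp_affine hφ (by
      have : T - t₀ ≠ 0 := by linarith
      positivity) _
  -- For t₀ = T the coefficient degenerates to 0, but then the right branch is empty and the
  -- implication is vacuous.
  have hr' : ∀ᵐ t, t₀ < T → T / (T - t₀) * t + -(T * t₀ / (T - t₀)) ∈ Ioo (-T) T →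
      φ (T / (T - t₀) * t + -(T * t₀ / (T - t₀)))
        = d * profile p T 0 (T / (T - t₀) * t + -(T * t₀ / (T - t₀))) := by
    by_cases h : t₀ < T
    · filter_upwards [hr h] with t ht _ using ht
    · exact ae_of_all _ fun t h' => absurd h' h
  filter_upwards [hl, hr'] with t htl htr ht
  unfold uGlued
  split_ifs with hlt
  · have hpos : 0 < T + t₀ := by linarith
    have e : T * (t - t₀) / (T + t₀) = T / (T + t₀) * t + -(T * t₀ / (T + t₀)) := by ring
    rw [← e] at htl
    have hy : T * (t - t₀) / (T + t₀) < 0 :=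
      div_neg_of_neg_of_pos (mul_neg_of_pos_of_neg hT (by linarith)) hpos
    have hy2 : -T < T * (t - t₀) / (T + t₀) := by
      rw [lt_div_iff₀ hpos]; nlinarith [ht.1]
    rw [htl ⟨hy2, by linarith⟩, profile_zero_of_nonpos hp hT hy.le, profile_of_le hp h1 hlt.le]
    have : quarter p * (T + T * (t - t₀) / (T + t₀)) / T = quarter p * (T + t) / (T + t₀) := by
      field_simp; ring
    rw [this]; ring
  · rw [not_lt] at hlt
    have hlt' : t₀ < T := hlt.trans_lt ht.2
    have hpos : 0 < T - t₀ := by linarith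
    have e : T * (t - t₀) / (T - t₀) = T / (T - t₀) * t + -(T * t₀ / (T - t₀)) := by ring
    replace htr := htr hlt'
    rw [← e] at htr
    have hy : 0 ≤ T * (t - t₀) / (T - t₀) :=
      div_nonneg (mul_nonneg hT.le (by linarith)) hpos.le
    have hy2 : T * (t - t₀) / (T - t₀) < T := by
      rw [div_lt_iff₀ hpos]; nlinarith [ht.2]
    rw [htr ⟨by linarith, hy2⟩, profile_zero_of_nonneg hp hT hy, profile_of_ge hp h0 hlt' hlt]
    have : quarter p * (T - T * (t - t₀) / (T - t₀)) / T = quarter p * (T - t) / (T - t₀) := by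
      field_simp; ring
    rw [this]; ring

lemma profile_zero_neg (hp : 1 < p) (hT : 0 < T) (t : ℝ) :
    profile p T 0 (-t) = profile p T 0 t := by
  rcases le_total t 0 with h | h
  · rw [profile_zero_of_nonpos hp hT h, profile_zero_of_nonneg hp hT (by linarith), sub_neg_eq_add]
  · rw [profile_zero_of_nonneg hp hT h, profile_zero_of_nonpos hp hT (by linarith),
      ← sub_eq_add_neg]

/-- Reduces the second family to the first by reflection. The point -t₀ is excluded because
reflection reverses the branch convention there. -/
lemma vGlued_eq {t₀ c : ℝ} {φ : ℝ → ℝ} {t : ℝ} (ht : t ≠ -t₀) :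
    vGlued T t₀ c φ t = -uGlued T t₀ c (fun x => φ (-x)) (-t) := by
  unfold vGlued uGlued
  have h1 : -(T * (-t - t₀) / (T - t₀)) = T * (t + t₀) / (T - t₀) := by ring
  have h2 : -(T * (-t - t₀) / (T + t₀)) = T * (t + t₀) / (T + t₀) := by ring
  rcases lt_or_gt_of_ne ht with h | h
  · rw [if_pos h, if_neg (by linarith)]
    simp only [h1, neg_mul]
  · rw [if_neg (by linarith), if_pos (by linarith)]
    simp only [h2, neg_mul]

lemma vGlued_ae_eq (hp : 1 < p) (hT : 0 < T) {t₀ c d : ℝ} (h0 : -T < t₀) (h1 : t₀ ≤ T) {φ : ℝ → ℝ}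
    (hφ : ∀ᵐ t ∂(volOn (-T) T), φ t = d * profile p T 0 t) :
    ∀ᵐ t ∂(volOn (-T) T), vGlued T t₀ c φ t = -(c * d) * profile p T t₀ (-t) := by
  have hφ' : ∀ᵐ t ∂(volOn (-T) T), φ (-t) = d * profile p T 0 t := by
    filter_upwards [(measurePreserving_neg_Ioo T).quasiMeasurePreserving.ae hφ] with t ht
    rw [ht, profile_zero_neg hp hT]
  have h := (measurePreserving_neg_Ioo T).quasiMeasurePreserving.ae
    (uGlued_ae_eq hp hT (c := c) h0 h1 hφ')
  filter_upwards [h, ae_restrict_of_ae (Measure.ae_ne volume (-t₀))] with t ht hne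
  rw [vGlued_eq hne, ht]
  ring

/-! ### Extremizers -/

lemma isExtremizer_of_ae_eq_profile (hp : 1 < p) (hT : 0 < T) (ha : 0 < a) (hb : 0 ≤ b) {c : ℝ}
    (hc : 0 < c) {u : ℝ → ℝ}
    (hu : ∀ᵐ t ∂(volOn (-T) T), u t = c * profile p T (junction T a b) t) :
    IsExtremizer p T a b u := by
  have h0 := neg_lt_junction hT ha hb
  have h1 := junction_le hT ha hb
  refine ⟨fun t => c * profileDeriv p T (junction T a b) t, isAdmissible_of_hasDerivAt hp hT hb
    (w := fun t => c * profile p T (junction T a b) t)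
    (continuous_const.mul (continuous_profileDeriv hp _ _))
    (fun t => (hasDerivAt_profile hp _ _ t).const_mul c) hu ?_ ?_ ?_, ?_, ?_⟩
  · rw [profile_neg_T hp h0 h1, mul_zero]
  -- If t₀ = T the end value is c > 0, so only the sign condition of the piecewise class holds.
  · rcases h1.eq_or_lt with h | h
    · have := profile_self hp h0 h1
      rw [h] at this
      rw [h, this]; linarith
    · rw [profile_T hp h0 h, mul_zero]
  · intro hb
    rw [profile_neg_T hp h0 h1, profile_T hp h0 (junction_lt hT ha hb), mul_zero]
    exact ⟨rfl, rfl⟩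
  · refine not_ae_eq_zero_of_pos hT ?_
    filter_upwards [hu, ae_restrict_mem measurableSet_Ioo] with t ht htm
    rw [ht]; exact mul_pos hc (profile_pos hp h0 h1 htm)
  · have hN : ∫ t in Ioo (-T) T, |u t| ^ p = c ^ p * (2 * T / p) := by
      rw [← integral_abs_profile_rpow hp hT h0 h1, ← integral_abs_rpow_const_mul hc.le]
      refine integral_congr_ae ?_
      filter_upwards [hu] with t ht
      rw [ht]
    rw [energy_const_mul ha.le hb hc.le, energy_profileDeriv hp hT ha hb, hN,
      level_Hab hp hT ha hb]
    ring

lemma isExtremizer_of_ae_eq_neg_profile (hp : 1 < p) (hT : 0 < T) (ha : 0 < a) (hb : 0 ≤ b) {c : ℝ}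
    (hc : 0 < c) {u : ℝ → ℝ}
    (hu : ∀ᵐ t ∂(volOn (-T) T), u t = -c * profile p T (junction T a b) (-t)) :
    IsExtremizer p T a b u := by
  have h0 := neg_lt_junction hT ha hb
  have h1 := junction_le hT ha hb
  have hT1 : 0 ≤ profile p T (junction T a b) T := by
    rcases h1.eq_or_lt with h | h
    · have := profile_self hp h0 h1
      rw [h] at this
      rw [h, this]; exact zero_le_one
    · rw [profile_T hp h0 h]
  refine ⟨fun t => c * profileDeriv p T (junction T a b) (-t), isAdmissible_of_hasDerivAt hp hT hb
    (w := fun t => -c * profile p T (junction T a b) (-t))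
    (continuous_const.mul ((continuous_profileDeriv hp _ _).comp continuous_neg))
    (fun t => ?_) hu ?_ ?_ ?_, ?_, ?_⟩
  · have := ((hasDerivAt_profile hp T (junction T a b) (-t)).comp t (hasDerivAt_neg t)).const_mul (-c)
    exact this.congr_deriv (by ring)
  · rw [neg_neg]
    have := mul_nonneg hc.le hT1
    linarith
  · rw [profile_neg_T hp h0 h1, mul_zero]
  · intro hb
    rw [neg_neg, profile_neg_T hp h0 h1, profile_T hp h0 (junction_lt hT ha hb), mul_zero]
    exact ⟨rfl, rfl⟩
  · intro hz
    refine not_ae_eq_zero_of_pos hT (u := fun t => -u t) ?_ (by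
      filter_upwards [hz] with t ht
      rw [ht, neg_zero])
    filter_upwards [hu, ae_restrict_mem measurableSet_Ioo] with t ht htm
    have := mul_pos hc (profile_comp_neg_pos hp h0 h1 htm)
    rw [ht]; linarith
  · have hN : ∫ t in Ioo (-T) T, |u t| ^ p = c ^ p * (2 * T / p) := by
      rw [← integral_abs_profile_rpow hp hT h0 h1, ← integral_abs_rpow_const_mul hc.le,
        ← setIntegral_comp_neg T fun t => |c * profile p T (junction T a b) t| ^ p]
      refine integral_congr_ae ?_
      filter_upwards [hu] with t ht
      rw [ht, neg_mul, abs_neg]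
    rw [energy_const_mul ha.le hb hc.le,
      energy_comp_neg p T (Hab a b) (profileDeriv p T (junction T a b)),
      energy_profileDeriv hp hT ha hb, hN, level_Hab hp hT ha hb]
    ring

lemma isExtremizer_iff (hp : 1 < p) (hT : 0 < T) (ha : 0 < a) (hb : 0 ≤ b) {φ : W0 p T}
    (hφ : IsPrincipalEigenfunction p T φ) (u : ℝ → ℝ) :
    IsExtremizer p T a b u ↔ ∃ c : ℝ, 0 < c ∧
      ((∀ᵐ t ∂(volOn (-T) T), u t = uGlued T (junction T a b) c φ t) ∨
        (∀ᵐ t ∂(volOn (-T) T), u t = vGlued T (junction T a b) c φ t)) := by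
  have h0 := neg_lt_junction hT ha hb
  have h1 := junction_le hT ha hb
  obtain ⟨d, hd, hφd⟩ := hφ.exists_eq hp hT
  constructor
  · rintro ⟨g, hadm, hne, he⟩
    obtain ⟨hum, hg, m, τ, w, hw, hz⟩ := hadm.exists_isPwPrimitive hp hT
    rw [level_Hab hp hT ha hb] at he
    obtain ⟨c, hc, hor⟩ := (hw.poincare hp hT ha hb hz hum hg).2 hne he
    have hcd : c / d * d = c := div_mul_cancel₀ c hd.ne'
    -- The factor d relating φ to the symmetric profile is absorbed into the constant.
    refine ⟨c / d, by positivity, hor.imp (fun h => ?_) fun h => ?_⟩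
    · filter_upwards [h, uGlued_ae_eq hp hT (c := c / d) h0 h1 hφd] with t h2 h3
      rw [h2, h3, hcd]
    · filter_upwards [h, vGlued_ae_eq hp hT (c := c / d) h0 h1 hφd] with t h2 h3
      rw [h2, h3, hcd]
  · rintro ⟨c, hc, h | h⟩
    · refine isExtremizer_of_ae_eq_profile hp hT ha hb (mul_pos hc hd) ?_
      filter_upwards [h, uGlued_ae_eq hp hT (c := c) h0 h1 hφd] with t h2 h3
      rw [h2, h3]
    · refine isExtremizer_of_ae_eq_neg_profile hp hT ha hb (mul_pos hc hd) ?_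
      filter_upwards [h, vGlued_ae_eq hp hT (c := c) h0 h1 hφd] with t h2 h3
      rw [h2, h3]

/-! ### Fundamental frequencies -/

lemma isFundamentalFrequency_of_pos (hp : 1 < p) (hT : 0 < T) (ha : 0 < a) (hb : 0 < b) :
    IsFundamentalFrequency p T (Hab a b) := by
  have h0 := neg_lt_junction hT ha hb.le
  have h1 := junction_lt hT ha hb
  obtain ⟨v, hv, hvd⟩ := W0.exists_const_mul_profile hp hT h0 h1 1
  refine ⟨v, not_ae_eq_zero_of_pos hT ?_, ?_, ?_, fun ψ => ?_⟩
  · filter_upwards [ae_restrict_mem measurableSet_Ioo] with t ht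
    rw [hv]; exact mul_pos one_pos (profile_pos hp h0 h1.le ht)
  · filter_upwards [ae_restrict_mem measurableSet_Ioo,
      ae_restrict_of_ae (Measure.ae_ne volume (junction T a b))] with t ht hne
    simp only [hvd, one_mul]
    rcases lt_or_gt_of_ne hne with h | h
    · exact (hasDerivAt_Hab_of_pos (profileDeriv_pos hp h0 h1.le ht h)).differentiableAt
    · exact (hasDerivAt_Hab_of_neg (profileDeriv_neg hp h0 h1.le ht h)).differentiableAt
  · exact (measurable_deriv _).comp_aemeasurable v.memLp_der.1.aemeasurable
  · rw [level_Hab hp hT ha hb.le, negLaplacian_profile hp hT ha hb one_pos hv hvd ψ]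

/-- Euler's relation s H'(s) = H(s) for s > 0. For s ≤ 0 the factor H^{p-1} already vanishes, so the
derivative at the kink does not matter. -/
lemma Hab_rpow_mul_deriv_mul (hp : 1 < p) (ha : 0 < a) (s : ℝ) :
    Hab a 0 s ^ (p - 1) * deriv (Hab a 0) s * s = Hab a 0 s ^ p := by
  rcases le_or_gt s 0 with h | h
  · rw [Hab_of_nonpos h, neg_zero, zero_mul, Real.zero_rpow (by linarith : p - 1 ≠ 0),
      Real.zero_rpow (by linarith : p ≠ 0)]
    ring
  · rw [(hasDerivAt_Hab_of_pos h).deriv, Hab_of_nonneg h.le, mul_assoc,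
      rpow_sub_one_mul_self hp (by positivity)]

lemma junction_zero (ha : 0 < a) (T : ℝ) : junction T a 0 = T := by
  have := T_sub_junction (T := T) ha le_rfl
  simp only [mul_zero, zero_mul, zero_div] at this
  linarith

/-- A solution tested with itself attains equality, so it is a multiple of the profile with t₀ = T
or of its reflection. Either takes a non-zero value at an end point, whereas the continuous
representative of u vanishes there. -/
lemma not_isFundamentalFrequency_zero (hp : 1 < p) (hT : 0 < T) (ha : 0 < a) :
    ¬ IsFundamentalFrequency p T (Hab a 0) := by
  rintro ⟨u, hne, -, -, heq⟩
  have he := heq u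
  simp only [negLaplacian, Hab_rpow_mul_deriv_mul hp ha, abs_rpow_mul_mul_self hp] at he
  rw [level_Hab hp hT ha le_rfl] at he
  obtain ⟨c, hc, hor⟩ := (u.poincare hp hT ha le_rfl).2 hne he
  rw [junction_zero ha] at hor
  obtain ⟨w, hw, h0, h1, hu⟩ := u.exists_primitive hp hT
  have hT1 : profile p T T T = 1 := profile_self hp (by linarith) le_rfl
  have hTT : -T ≤ T := by linarith
  have key : ∀ f : ℝ → ℝ, Continuous f → (∀ᵐ t ∂(volOn (-T) T), u t = f t) →
      EqOn w f (Icc (-T) T) := fun f hf hae => by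
    refine Measure.eqOn_Icc_of_ae_eq volume (by linarith) ?_ hw.continuousOn hf.continuousOn
    rw [← restrict_Ioo_eq_restrict_Icc]
    filter_upwards [hu, hae] with t h2 h3
    rw [← h2, h3]
  have hpc := continuous_profile hp T T
  rcases hor with h | h
  · have h2 := key (fun t => c * profile p T T t) (continuous_const.mul hpc) h ⟨hTT, le_rfl⟩
    simp only [h1, hT1] at h2
    linarith
  · have h2 := key (fun t => -c * profile p T T (-t))
      (continuous_const.mul (hpc.comp continuous_neg)) h ⟨le_rfl, hTT⟩
    simp only [neg_neg] at h2
    rw [h0, hT1] at h2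
    linarith

lemma isFundamentalFrequency_Hab_iff (hp : 1 < p) (hT : 0 < T) (ha : 0 < a) (hb : 0 ≤ b) :
    IsFundamentalFrequency p T (Hab a b) ↔ 0 < b := by
  refine ⟨fun h => ?_, isFundamentalFrequency_of_pos hp hT ha⟩
  rcases hb.eq_or_lt with rfl | hb
  · exact absurd h (not_isFundamentalFrequency_zero hp hT ha)
  · exact hb

/-! ### Exchange of a and b, and the class of operators -/

lemma level_Hab_swap (p T a b : ℝ) : level p T (Hab a b) = level p T (Hab b a) := by
  have key : ∀ a b : ℝ, {E | ∃ u : W0 p T, pNorm p T u = 1 ∧ E = energy p T (Hab a b) u.der} ⊆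
      {E | ∃ u : W0 p T, pNorm p T u = 1 ∧ E = energy p T (Hab b a) u.der} := by
    rintro a b E ⟨u, hu, rfl⟩
    refine ⟨u.neg, ?_, ?_⟩
    · rw [← hu]; simp only [pNorm, W0.neg, abs_neg]
    · simp only [energy, W0.neg, Hab_neg]
  exact congrArg sInf ((key a b).antisymm (key b a))

/-- The map u ↦ -u exchanges positive and negative slopes. It reduces the degenerate anisotropies
with a = 0 to those with b = 0. -/
lemma IsFundamentalFrequency.swap (h : IsFundamentalFrequency p T (Hab a b)) :
    IsFundamentalFrequency p T (Hab b a) := by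
  obtain ⟨u, hne, hd, -, heq⟩ := h
  have hfun : Hab b a = fun s => Hab a b (-s) := funext fun s => (Hab_neg a b s).symm
  have hderiv : ∀ s, deriv (Hab b a) (-s) = -deriv (Hab a b) s := fun s => by
    rw [hfun, deriv_comp_neg, neg_neg]
  refine ⟨u.neg, fun h => hne ?_, ?_, ?_, fun ψ => ?_⟩
  · filter_upwards [h] with t ht
    exact neg_eq_zero.mp ht
  · filter_upwards [hd] with t ht
    rw [hfun]
    change DifferentiableAt ℝ (Hab a b ∘ Neg.neg) (-u.der t)
    refine DifferentiableAt.comp _ ?_ differentiable_neg.differentiableAt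
    rwa [neg_neg]
  · exact (measurable_deriv _).comp_aemeasurable u.neg.memLp_der.1.aemeasurable
  · have h1 : negLaplacian p T (Hab b a) u.neg ψ = -negLaplacian p T (Hab a b) u ψ := by
      rw [negLaplacian, negLaplacian, ← integral_neg]
      refine integral_congr_ae (ae_of_all _ fun t => ?_)
      simp only [W0.neg, hderiv, Hab_neg]
      ring
    have h2 : ∫ t in Ioo (-T) T, |u.neg t| ^ (p - 2) * u.neg t * ψ t
        = -∫ t in Ioo (-T) T, |u t| ^ (p - 2) * u t * ψ t := by
      rw [← integral_neg]
      refine integral_congr_ae (ae_of_all _ fun t => ?_)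
      simp only [W0.neg, abs_neg]
      ring
    rw [h1, h2, heq ψ, level_Hab_swap p T b a]
    ring

lemma Hab_mem_Anisotropies (ha : 0 ≤ a) (hb : 0 ≤ b) : Hab a b ∈ Anisotropies := by
  refine ⟨Hab_nonneg ha hb, ⟨convex_univ, fun x _ y _ m n hm hn _ => ?_⟩,
    fun t ht x => Hab_mul ht.le x⟩
  simp only [smul_eq_mul]
  rcases le_total 0 (m * x + n * y) with h | h
  · rw [Hab_of_nonneg h]
    nlinarith [mul_le_mul_of_nonneg_left (mul_le_Hab ha hb x) hm,
      mul_le_mul_of_nonneg_left (mul_le_Hab ha hb y) hn]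
  · rw [Hab_of_nonpos h]
    nlinarith [mul_le_mul_of_nonneg_left (neg_mul_le_Hab ha hb x) hm,
      mul_le_mul_of_nonneg_left (neg_mul_le_Hab ha hb y) hn]

/-- Homogeneity determines H on each half-line by its value at 1 or -1, and H(0) = H(2·0) = 2H(0)
forces H(0) = 0. -/
lemma eq_Hab_of_mem_Anisotropies {H : ℝ → ℝ} (hH : H ∈ Anisotropies) :
    H = Hab (H 1) (H (-1)) := by
  obtain ⟨-, -, hhom⟩ := hH
  funext x
  rcases lt_trichotomy x 0 with h | rfl | h
  · rw [Hab_of_nonpos h.le]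
    have := hhom (-x) (by linarith) (-1)
    rw [mul_neg_one, neg_neg] at this
    rw [this]; ring
  · have := hhom 2 two_pos 0
    rw [mul_zero] at this
    rw [Hab_of_nonneg le_rfl, mul_zero]
    linarith
  · rw [Hab_of_nonneg h.le]
    have := hhom x h 1
    rw [mul_one] at this
    rw [this]; ring

lemma ellipticClass_eq (hp : 1 < p) (hT : 0 < T) :
    ellipticClass p T = {L | ∃ a b : ℝ, 0 < a ∧ 0 < b ∧ L = negLaplacian p T (Hab a b)} := by
  ext L
  constructor
  · rintro ⟨H, hH, hne, hff, rfl⟩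
    have hHab := eq_Hab_of_mem_Anisotropies hH
    have ha := hH.1 1
    have hb := hH.1 (-1)
    generalize H 1 = a at hHab ha
    generalize H (-1) = b at hHab hb
    subst hHab
    rcases ha.eq_or_lt with rfl | ha
    · rcases hb.eq_or_lt with rfl | hb
      · exact absurd (funext fun s => by simp [Hab]) hne
      · exact absurd hff.swap (not_isFundamentalFrequency_zero hp hT hb)
    · exact ⟨a, b, ha, (isFundamentalFrequency_Hab_iff hp hT ha hb).mp hff, rfl⟩
  · rintro ⟨a, b, ha, hb, rfl⟩
    refine ⟨Hab a b, Hab_mem_Anisotropies ha.le hb.le, fun h => ?_,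
      isFundamentalFrequency_of_pos hp hT ha hb, rfl⟩
    have := congrFun h 1
    rw [Hab_of_nonneg zero_le_one, mul_one, Pi.zero_apply] at this
    exact ha.ne' this

end level

end

end

end AsymPoincare

theorem theorem1p1 (p T : ℝ) (hp : 1 < p) (hT : 0 < T) :
    (∃ φ : W0 p T, IsPrincipalEigenfunction p T φ) ∧
    (∀ a b : ℝ, 0 < a → 0 ≤ b →
      level p T (Hab a b) = ((a + b) / 2) ^ p * lambda1 p T ∧
      (∀ u g : ℝ → ℝ, IsAdmissible p T b u g →
        level p T (Hab a b) * ∫ t in Set.Ioo (-T) T, |u t| ^ p ≤ energy p T (Hab a b) g) ∧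
      (∀ φ : W0 p T, IsPrincipalEigenfunction p T φ → ∀ u : ℝ → ℝ,
        IsExtremizer p T a b u ↔ ∃ c : ℝ, 0 < c ∧
          ((∀ᵐ t ∂(volOn (-T) T), u t = uGlued T (junction T a b) c φ t) ∨
            (∀ᵐ t ∂(volOn (-T) T), u t = vGlued T (junction T a b) c φ t))) ∧
      (IsFundamentalFrequency p T (Hab a b) ↔ 0 < b)) ∧
    ellipticClass p T = {L | ∃ a b : ℝ, 0 < a ∧ 0 < b ∧ L = negLaplacian p T (Hab a b)} := by
  refine ⟨exists_isPrincipalEigenfunction hp hT, fun a b ha hb =>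
    ⟨level_Hab_eq_lambda1 hp hT ha hb, fun u g h => ?_, fun φ hφ u => isExtremizer_iff hp hT ha hb hφ u,
      isFundamentalFrequency_Hab_iff hp hT ha hb⟩, ellipticClass_eq hp hT⟩
  obtain ⟨hum, hg, m, τ, w, hw, hz⟩ := h.exists_isPwPrimitive hp hT
  rw [level_Hab hp hT ha hb]
  exact (hw.poincare hp hT ha hb hz hum hg).1
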